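/- **Cohomology functors.** Let $G$ be a locally profinite group, $\Sigma\subseteq G$ an open submonoid and $A$ a commutative ring. Let $\mathcal P(G,\Sigma)$ be the category of open compact subgroups $U\subseteq\Sigma$ of $G$, with $\operatorname{Hom}(U,V)=\{g\in U\backslash\Sigma/V: g^{-1}Ug\subseteq V\}$ and $[g]\circ[h]=[hg]$. A *cohomology functor* for $(G,\Sigma)$ is a pair of functors $M^\star:\mathcal P(G,\Sigma)^{\rm op}\to A\text{-Mod}$, $M_\star:\mathcal P(G,\Sigma^{-1})\to A\text{-Mod}$ (with $[g]^\star$, $[g]_\star$ the images of $[g]$, and $\mathrm{pr}=[1]$) that agree on objects, with $[g]^\star=[g^{-1}]_\star$ whenever $g\in\Sigma$ and $g^{-1}Ug=V$. It is *Cartesian* if for all $U,U'\subseteq V$ one has $\mathrm{pr}^\star\circ\mathrm{pr}_\star=\sum_{\gamma\in U\backslash V/U'}\mathrm{pr}_\star\circ[\gamma]^\star: M(U')\to M(U)$, where the summand of $\gamma$ factors through $M(\gamma U'\gamma^{-1}\cap U)$. For a compact subgroup $K\subseteq\Sigma$ put $M_{\mathrm{Iw}}(K)=\varprojlim_{U\supseteq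 K}M(U)$ (limit under $\mathrm{pr}_\star$ over open compact $U\subseteq\Sigma$). For $M$ Cartesian there are pushforwards $[g]_\star$ on $M_{\mathrm{Iw}}$, and pullbacks $[g]^\star$ for finite-index inclusions $g^{-1}K'g\subseteq K$. The pullback for $K'\subseteq K$ is given at finite level by the maps $\mathrm{pr}^\star:M(U)\to M(U')$ for $U\supseteq K$, $U'\supseteq K'$ with $U'\subseteq U$, $U'\cap K=K'$ and $[U:U']=[K:K']$. For a closed subgroup $\iota:H\hookrightarrow G$ and Cartesian cohomology functors $M_H$, $M_G$ for $(H,\Sigma\cap H)$, $(G,\Sigma)$, a *pushforward map* $\iota_\star:M_H\to M_G$ is a family of $A$-linear maps $M_H(U)\to M_{G,\mathrm{Iw}}(\iota(U))$ that is compatible with all $[h]_\star$ and $[h]^\star$. **Groups.** Let $\iota:H\hookrightarrow G$ be a closed immersion of reductive group schemes over $\mathbf Z_p$ (smooth, affine, with connected reductive geometric fibres). For a cocharacter $\mu$ over $\mathbf Z_p$ of a reductive group scheme $R$, let $P_R(\mu)=\{g:\lim_{t\to0}\mu(t)g\mu(t)^{-1}\text{ exists}\}$ be the associated parabolic subgroup,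 with Levi subgroup $Z_R(\mu)$ and unipotent radical $U_R(\mu)=\{g:\lim_{t\to0}\mu(t)g\mu(t)^{-1}=1\}$. A *mirabolic* subgroup of $R$ is a closed subgroup scheme of the form $U_R(\mu)\cdot L^0$, where $L^0$ is a closed normal subgroup scheme of $Z_R(\mu)$. Let $Q_H^0$ be a mirabolic subgroup of $H$. Let $\eta$ be a cocharacter of $G$ and write $Q_G=P_G(\eta)$, $L_G=Z_G(\eta)$, $N_G=U_G(\eta)$, $\bar Q_G=P_G(\eta^{-1})$, $\bar N_G=U_G(\eta^{-1})$, $\tau=\eta(p)$; so $\eta$ is central in $L_G$ and strictly dominant for $Q_G$. Let $L_G^0$ be a closed normal subgroup scheme of $L_G$ and put $\bar Q_G^0=\bar N_G L_G^0$, $Q_G^0=N_GL_G^0$. Let $u\in G(\mathbf Z_p)$ be such that (A) the $Q_H^0$-orbit of $u$ in $\mathcal F=G/\bar Q_G$ is open, in the scheme-theoretic sense that the orbit map $Q_H^0\to\mathcal F$, $h\mapsto hu$, is smooth (so that its image is an open subscheme, onto which it is surjective étale-locally); (B) $u^{-1}Q_H^0u\cap\bar Q_G\subseteq\bar Q_G^0$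 as subgroup schemes. For $r\ge0$ put $U_r=\{g\in G(\mathbf Z_p):\tau^{-r}g\tau^r\in G(\mathbf Z_p),\ g\bmod p^r\in\bar Q_G^0\}$ and $V_r=\tau^{-r}U_r\tau^r$. These are open compact subgroups of $G(\mathbf Q_p)$. **Theorem.** Let $\Sigma\subseteq G(\mathbf Q_p)$ be an open submonoid containing $G(\mathbf Z_p)$ and $\tau^{-1}$, let $M_G$, $M_H$ be Cartesian cohomology functors for $(G(\mathbf Q_p),\Sigma)$ and $(H(\mathbf Q_p),\Sigma\cap H(\mathbf Q_p))$ with coefficients in a commutative ring $A$, and let $\iota_\star:M_H\to M_G$ be a pushforward map. For $z_H\in M_{H,\mathrm{Iw}}(Q_H^0(\mathbf Z_p))$ and $r\ge1$ let $z_{G,r}\in M_G(U_r)$ be the image of $z_H$ under $$M_{H,\mathrm{Iw}}(Q_H^0(\mathbf Z_p))\xrightarrow{\mathrm{pr}^\star}M_{H,\mathrm{Iw}}(Q_H^0(\mathbf Z_p)\cap uU_ru^{-1})\xrightarrow{[u]_\star\circ\iota_\star}M_G(U_r),$$ and let $\xi_{G,r}=[\tau^r]_\star z_{G,r}\in M_G(V_r)$.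 Let $\mathcal T=[\tau]_\star\circ\mathrm{pr}^\star:M_G(V_r)\to M_G(V_r\cap\tau V_r\tau^{-1})\to M_G(V_r)$ be the Hecke operator of the double coset $[V_r\tau^{-1}V_r]$, and let $M_G(V_r)^{\mathrm{fs}}=A[\mathcal T,\mathcal T^{-1}]\otimes_{A[\mathcal T]}M_G(V_r)$. Then $z_{G,r}$ is well-defined; for all $r\ge1$ we have $V_{r+1}\subseteq V_r$, and $\mathrm{pr}_\star:M_G(V_{r+1})\to M_G(V_r)$ commutes with $\mathcal T$, so that we can put $$M_{G,\mathrm{Iw}}(Q_G^0(\mathbf Z_p))^{\mathrm{fs}}=\varprojlim_{r\ge1}M_G(V_r)^{\mathrm{fs}};$$ and $z_H\mapsto(\mathcal T^{-r}\otimes\xi_{G,r})_{r\ge1}$ is a well-defined $A$-linear map $M_{H,\mathrm{Iw}}(Q_H^0(\mathbf Z_p))\to M_{G,\mathrm{Iw}}(Q_G^0(\mathbf Z_p))^{\mathrm{fs}}$; in particular, the system $(\mathcal T^{-r}\otimes\xi_{G,r})_{r\ge1}$ is compatible under the maps induced by $\mathrm{pr}_\star$. -/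

import Mathlib

open scoped TensorProduct LaurentPolynomial Polynomial

noncomputable section

namespace NormRel

/-! ## Cohomology functors on a topological group -/

section Cohomology

/-- `g⁻¹ U g ⊆ V`. -/
def Carries {G : Type*} [Group G] (g : G) (U V : Subgroup G) : Prop :=
  ∀ x ∈ U, g⁻¹ * x * g ∈ V

theorem carries_one {G : Type*} [Group G] {U V : Subgroup G} (h : U ≤ V) : Carries 1 U V := by
  intro x hx
  simpa using h hx

theorem one_inv_mem {G : Type*} [Group G] (S : Submonoid G) : (1 : G)⁻¹ ∈ S := by
  simp

variable {G : Type*} [Group G] [TopologicalSpace G]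

/-- The open compact subgroups of `G` contained in the submonoid `S`: the objects of the category
`P(G, S)` (and of `P(G, S⁻¹)`). -/
structure Level (S : Submonoid G) where
  toSubgroup : Subgroup G
  isOpen : IsOpen (toSubgroup : Set G)
  isCompact : IsCompact (toSubgroup : Set G)
  le : ∀ g ∈ toSubgroup, g ∈ S

section Operations

variable [IsTopologicalGroup G] {S : Submonoid G}

theorem isOpen_map_conj {U : Subgroup G} (hU : IsOpen (U : Set G)) (g : G) :
    IsOpen ((U.map (MulAut.conj g).toMonoidHom : Subgroup G) : Set G) := by
  have : ((U.map (MulAut.conj g).toMonoidHom : Subgroup G) : Set G) =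
      (fun x => g⁻¹ * x * g) ⁻¹' (U : Set G) := by
    ext x
    simp only [Subgroup.coe_map, Set.mem_image, SetLike.mem_coe, Set.mem_preimage]
    constructor
    · rintro ⟨y, hy, rfl⟩
      simpa [mul_assoc] using hy
    · intro hx
      exact ⟨_, hx, by simp [mul_assoc]⟩
  rw [this]
  exact hU.preimage (by fun_prop)

/-- The open compact subgroup `U ∩ W`, for `U` a level and `W` an open subgroup. -/
def Level.inter (U : Level S) (W : Subgroup G) (hW : IsOpen (W : Set G)) : Level S where
  toSubgroup := U.toSubgroup ⊓ W
  isOpen := by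
    rw [Subgroup.coe_inf]
    exact U.isOpen.inter hW
  isCompact := by
    rw [Subgroup.coe_inf]
    exact U.isCompact.inter_right (Subgroup.isClosed_of_isOpen W hW)
  le g hg := U.le g hg.1

/-- The level `U ∩ g U' g⁻¹`. -/
def Level.interConj (U U' : Level S) (g : G) : Level S :=
  U.inter (U'.toSubgroup.map (MulAut.conj g).toMonoidHom) (isOpen_map_conj U'.isOpen g)

theorem Level.interConj_le (U U' : Level S) (g : G) :
    (U.interConj U' g).toSubgroup ≤ U.toSubgroup := inf_le_left

theorem Level.carries_interConj (U U' : Level S) (g : G) :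
    Carries g (U.interConj U' g).toSubgroup U'.toSubgroup := by
  rintro x ⟨-, y, hy, rfl⟩
  simpa [mul_assoc] using hy

/-- The level `g U g⁻¹`, when it is still contained in `S`. -/
def Level.conj (U : Level S) (g : G) (h : ∀ x ∈ U.toSubgroup, g * x * g⁻¹ ∈ S) : Level S where
  toSubgroup := U.toSubgroup.map (MulAut.conj g).toMonoidHom
  isOpen := isOpen_map_conj U.isOpen g
  isCompact := by
    rw [Subgroup.coe_map]
    refine U.isCompact.image ?_
    change Continuous fun x => g * x * g⁻¹
    fun_prop
  le := by
    rintro _ ⟨x, hx, rfl⟩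
    exact h x hx

/-- `g` carries `g U g⁻¹` into `U`. -/
theorem Level.carries_conj (U : Level S) (g : G) (h : ∀ x ∈ U.toSubgroup, g * x * g⁻¹ ∈ S) :
    Carries g (U.conj g h).toSubgroup U.toSubgroup := by
  rintro _ ⟨y, hy, rfl⟩
  simpa [mul_assoc] using hy

/-- `g⁻¹` carries `U` into `g U g⁻¹`. -/
theorem Level.carries_conj_inv (U : Level S) (g : G)
    (h : ∀ x ∈ U.toSubgroup, g * x * g⁻¹ ∈ S) :
    Carries g⁻¹ U.toSubgroup (U.conj g h).toSubgroup := by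
  intro x hx
  exact ⟨x, hx, by simp⟩

/-- The level `ι⁻¹(U)` of `H`, for a closed topological embedding of groups `ι : H → G`. -/
def Level.comap {H : Type*} [Group H] [TopologicalSpace H] (ι : H →* G)
    (hι : Topology.IsClosedEmbedding ι) (U : Level S) : Level (S.comap ι) where
  toSubgroup := U.toSubgroup.comap ι
  isOpen := U.isOpen.preimage hι.continuous
  isCompact := hι.isCompact_preimage U.isCompact
  le _ hg := U.le _ hg

end Operations

/-- A cohomology functor for `(G, S)` with coefficients in `A`: a covariant functor `M_⋆` on
`P(G, S⁻¹)` (with `[g]_⋆ = push g`) and a contravariant functor `M^⋆` on `P(G, S)`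
(with `[g]^⋆ = pull g`) with values in `A`-modules, agreeing on objects, and with
`[g]^⋆ = [g⁻¹]_⋆` whenever `g⁻¹ U g = V`.  A morphism `U → V` is a double coset `U g V`
with `g⁻¹ U g ⊆ V`; here the functors are given on representatives `g`, depend only on the
double coset, and are compatible with the composition `[h] ∘ [g] = [g h]`. -/
structure CohomologyFunctor (S : Submonoid G) (A : Type*) [CommRing A] where
  obj : Level S → Type*
  [addCommGroup : ∀ U, AddCommGroup (obj U)]
  [module : ∀ U, Module A (obj U)]
  push {U V : Level S} (g : G) (hg : g⁻¹ ∈ S) (h : Carries g U.toSubgroup V.toSubgroup) :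
    obj U →ₗ[A] obj V
  pull {U V : Level S} (g : G) (hg : g ∈ S) (h : Carries g U.toSubgroup V.toSubgroup) :
    obj V →ₗ[A] obj U
  push_coset {U V : Level S} (g g' : G) (hg : g⁻¹ ∈ S) (hg' : g'⁻¹ ∈ S)
    (h : Carries g U.toSubgroup V.toSubgroup) (h' : Carries g' U.toSubgroup V.toSubgroup)
    (hc : ∃ a ∈ U.toSubgroup, ∃ b ∈ V.toSubgroup, g' = a * g * b) :
    push g hg h = push g' hg' h'
  push_one (U : Level S) :
    push 1 (one_inv_mem S) (carries_one (le_refl U.toSubgroup)) = LinearMap.id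
  push_mul {U V W : Level S} (g h : G) (hg : g⁻¹ ∈ S) (hh : h⁻¹ ∈ S) (hgh : (g * h)⁻¹ ∈ S)
    (hUV : Carries g U.toSubgroup V.toSubgroup) (hVW : Carries h V.toSubgroup W.toSubgroup)
    (hUW : Carries (g * h) U.toSubgroup W.toSubgroup) :
    push (g * h) hgh hUW = push h hh hVW ∘ₗ push g hg hUV
  pull_coset {U V : Level S} (g g' : G) (hg : g ∈ S) (hg' : g' ∈ S)
    (h : Carries g U.toSubgroup V.toSubgroup) (h' : Carries g' U.toSubgroup V.toSubgroup)
    (hc : ∃ a ∈ U.toSubgroup, ∃ b ∈ V.toSubgroup, g' = a * g * b) :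
    pull g hg h = pull g' hg' h'
  pull_one (U : Level S) :
    pull 1 S.one_mem (carries_one (le_refl U.toSubgroup)) = LinearMap.id
  pull_mul {U V W : Level S} (g h : G) (hg : g ∈ S) (hh : h ∈ S) (hgh : g * h ∈ S)
    (hUV : Carries g U.toSubgroup V.toSubgroup) (hVW : Carries h V.toSubgroup W.toSubgroup)
    (hUW : Carries (g * h) U.toSubgroup W.toSubgroup) :
    pull (g * h) hgh hUW = pull g hg hUV ∘ₗ pull h hh hVW
  pull_eq_push {U V : Level S} (g : G) (hg : g ∈ S) (hg' : g⁻¹⁻¹ ∈ S)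
    (h : Carries g U.toSubgroup V.toSubgroup) (h' : Carries g⁻¹ V.toSubgroup U.toSubgroup) :
    pull g hg h = push g⁻¹ hg' h'

attribute [instance] CohomologyFunctor.addCommGroup CohomologyFunctor.module

namespace CohomologyFunctor

variable {S : Submonoid G} {A : Type*} [CommRing A] (M : CohomologyFunctor S A)

/-- The pushforward `pr_⋆ : M(U) → M(V)`, for `U ⊆ V`. -/
def prPush {U V : Level S} (h : U.toSubgroup ≤ V.toSubgroup) : M.obj U →ₗ[A] M.obj V :=
  M.push 1 (one_inv_mem S) (carries_one h)

/-- The pullback `pr^⋆ : M(V) → M(U)`, for `U ⊆ V`. -/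
def prPull {U V : Level S} (h : U.toSubgroup ≤ V.toSubgroup) : M.obj V →ₗ[A] M.obj U :=
  M.pull 1 S.one_mem (carries_one h)

/-- The Cartesian property: for levels `U, U' ⊆ V`, and any system `R` of representatives of
`U \ V / U'`, we have `pr^⋆ ∘ pr_⋆ = ∑_{γ ∈ R} pr_⋆ ∘ [γ]^⋆` as maps `M(U') → M(U)`, where
the summand of `γ` factors through `M(U_γ)`, with `U_γ = γ U' γ⁻¹ ∩ U`. -/
def IsCartesian [IsTopologicalGroup G] : Prop :=
  ∀ (U U' V : Level S) (hU : U.toSubgroup ≤ V.toSubgroup) (hU' : U'.toSubgroup ≤ V.toSubgroup)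
    (R : Finset G) (hR : ∀ γ ∈ R, γ ∈ V.toSubgroup),
    (∀ v ∈ V.toSubgroup, ∃! γ, γ ∈ R ∧
      ∃ a ∈ U.toSubgroup, ∃ b ∈ U'.toSubgroup, v = a * γ * b) →
    ∀ x : M.obj U', M.prPull hU (M.prPush hU' x) =
      ∑ γ : R, M.prPush (U.interConj_le U' γ.1)
        (M.pull γ.1 (V.le _ (hR _ γ.2)) (U.carries_interConj U' γ.1) x)

/-- The Iwasawa completion `M_Iw(K)`: the inverse limit, under the pushforward maps, of the
modules `M(U)` over all levels `U` containing `K`. -/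
def Iw (K : Subgroup G) : Submodule A (∀ U : {U : Level S // K ≤ U.toSubgroup}, M.obj U.1) where
  carrier := {x | ∀ (U V : {U : Level S // K ≤ U.toSubgroup})
    (h : U.1.toSubgroup ≤ V.1.toSubgroup), M.prPush h (x U) = x V}
  add_mem' hx hy U V h := by simp [hx U V h, hy U V h]
  zero_mem' U V h := by simp
  smul_mem' a x hx U V h := by simp [hx U V h]

/-- The projection `M_Iw(K) → M(U)`, for a level `U` containing `K`. -/
def iwProj {K : Subgroup G} (U : Level S) (hU : K ≤ U.toSubgroup) : M.Iw K →ₗ[A] M.obj U :=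
  LinearMap.proj (⟨U, hU⟩ : {U : Level S // K ≤ U.toSubgroup}) ∘ₗ (M.Iw K).subtype

/-- `y = [g]_⋆ x` for the pushforward `[g]_⋆ : M_Iw(K) → M_Iw(K')`, where `g⁻¹ K g ⊆ K'`.  The
levels `U'` for which there is a `U` as below are all levels that contain `K'`, so that
`x` determines `y`. -/
def IsIwPush (g : G) (hg : g⁻¹ ∈ S) {K K' : Subgroup G} (x : M.Iw K) (y : M.Iw K') : Prop :=
  ∀ (U U' : Level S) (hU : K ≤ U.toSubgroup) (hU' : K' ≤ U'.toSubgroup)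
    (h : Carries g U.toSubgroup U'.toSubgroup),
    M.iwProj U' hU' y = M.push g hg h (M.iwProj U hU x)

/-- `y = [g]^⋆ x` for the finite pullback `[g]^⋆ : M_Iw(K) → M_Iw(K')`, where `K'' = g⁻¹ K' g`
is a subgroup of finite index in `K`: at each pair of levels `U ⊇ K` and `U' ⊇ K'` such that
`U'' = g⁻¹ U' g ⊆ U` satisfies `U'' ∩ K = K''` and `[U : U''] = [K : K'']`, the component
of `y` is the pullback of the component of `x`.  Such `U'` are cofinal among the levels that
contain `K'`, so that `x` determines `y`. -/
def IsIwPull (g : G) (hg : g ∈ S) {K K' : Subgroup G} (x : M.Iw K) (y : M.Iw K') : Prop :=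
  ∀ (U U' : Level S) (hU : K ≤ U.toSubgroup) (hU' : K' ≤ U'.toSubgroup)
    (h : Carries g U'.toSubgroup U.toSubgroup),
    U'.toSubgroup.map (MulAut.conj g⁻¹).toMonoidHom ⊓ K =
      K'.map (MulAut.conj g⁻¹).toMonoidHom →
    (U'.toSubgroup.map (MulAut.conj g⁻¹).toMonoidHom).relIndex U.toSubgroup =
      (K'.map (MulAut.conj g⁻¹).toMonoidHom).relIndex K →
    M.iwProj U' hU' y = M.pull g hg h (M.iwProj U hU x)

/-- The Hecke operator on `M(U)` attached to the double coset `[U τ⁻¹ U]`: with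
`U' = U ∩ τ U τ⁻¹`, the pullback `M(U) → M(U')` followed by `[τ]_⋆ : M(U') → M(U)`. -/
def hecke [IsTopologicalGroup G] (τ : G) (hτ : τ⁻¹ ∈ S) (U : Level S) : Module.End A (M.obj U) :=
  M.push τ hτ (U.carries_interConj U τ) ∘ₗ M.prPull (U.interConj_le U τ)

end CohomologyFunctor

/-- A pushforward map `ι_⋆ : M_H → M_G` along a homomorphism `ι : H → G`: a morphism of
cohomology functors for `(H, S ∩ H)` from `M_H` to `ι^! M_G`, where
`(ι^! M_G)(U) = M_{G, Iw}(ι(U))`. -/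
structure PushforwardMap {H : Type*} [Group H] [TopologicalSpace H] (ι : H →* G)
    {S : Submonoid G} {A : Type*} [CommRing A]
    (MH : CohomologyFunctor (S.comap ι) A) (MG : CohomologyFunctor S A) where
  app (U : Level (S.comap ι)) : MH.obj U →ₗ[A] MG.Iw (U.toSubgroup.map ι)
  push_compat {U V : Level (S.comap ι)} (h : H) (hh : h⁻¹ ∈ S.comap ι) (hh' : (ι h)⁻¹ ∈ S)
    (hUV : Carries h U.toSubgroup V.toSubgroup) (x : MH.obj U) :
    MG.IsIwPush (ι h) hh' (app U x) (app V (MH.push h hh hUV x))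
  pull_compat {U V : Level (S.comap ι)} (h : H) (hh : h ∈ S.comap ι)
    (hUV : Carries h U.toSubgroup V.toSubgroup) (x : MH.obj V) :
    MG.IsIwPull (ι h) hh (app V x) (app U (MH.pull h hh hUV x))

/-- The map `M_{H, Iw}(K) → M_G(U)` induced by a pushforward map, for `K ⊆ H` and a level `U`
of `G` containing `ι(K)`. -/
def PushforwardMap.toLevel [IsTopologicalGroup G] {H : Type*} [Group H] [TopologicalSpace H]
    {ι : H →* G} (hι : Topology.IsClosedEmbedding ι) {S : Submonoid G} {A : Type*} [CommRing A]
    {MH : CohomologyFunctor (S.comap ι) A} {MG : CohomologyFunctor S A}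
    (f : PushforwardMap ι MH MG) {K : Subgroup H} (U : Level S)
    (hKU : K ≤ U.toSubgroup.comap ι) : MH.Iw K →ₗ[A] MG.obj U :=
  MG.iwProj U (Subgroup.map_comap_le ι U.toSubgroup) ∘ₗ f.app (U.comap ι hι) ∘ₗ
    MH.iwProj (U.comap ι hι) hKU

end Cohomology

/-! ## Finite-slope parts -/

section FiniteSlope

variable {A : Type*} [CommRing A] {M N : Type*} [AddCommGroup M] [Module A M]
  [AddCommGroup N] [Module A N]

/-- The finite-slope part `A[𝒯, 𝒯⁻¹] ⊗_{A[𝒯]} M` of an `A`-module `M` with an operator `𝒯`. -/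
abbrev FiniteSlope (T : Module.End A M) : Type _ := A[T;T⁻¹] ⊗[A[X]] Module.AEval' T

/-- The element `𝒯ⁿ ⊗ m` of the finite-slope part. -/
def FiniteSlope.tmul (T : Module.End A M) (n : ℤ) (m : M) : FiniteSlope T :=
  LaurentPolynomial.T n ⊗ₜ[A[X]] Module.AEval'.of T m

/-- A linear map that commutes with the operators, as a map of `A[𝒯]`-modules. -/
def aevalMap {T : Module.End A M} {T' : Module.End A N} (f : M →ₗ[A] N)
    (hf : ∀ m, f (T m) = T' (f m)) : Module.AEval' T →ₗ[A[X]] Module.AEval' T' :=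
  LinearMap.ofAEval T ((Module.AEval'.of T').toLinearMap ∘ₗ f) fun m => by
    change Module.AEval'.of T' (f (T m)) = _
    rw [hf, ← Module.AEval'.X_smul_of]
    rfl

/-- The map on finite-slope parts induced by a linear map that commutes with the operators. -/
def FiniteSlope.map {T : Module.End A M} {T' : Module.End A N} (f : M →ₗ[A] N)
    (hf : ∀ m, f (T m) = T' (f m)) : FiniteSlope T →ₗ[A[T;T⁻¹]] FiniteSlope T' :=
  (aevalMap f hf).baseChange A[T;T⁻¹]

/-- The inverse limit of the finite-slope parts of a tower `⋯ → M₃ → M₂ → M₁` of modules with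
compatible operators. -/
def fsLimit {M : ℕ+ → Type*} [∀ r, AddCommGroup (M r)] [∀ r, Module A (M r)]
    (T : ∀ r, Module.End A (M r)) (f : ∀ r, M (r + 1) →ₗ[A] M r)
    (hf : ∀ r m, f r (T (r + 1) m) = T r (f r m)) :
    Submodule A[T;T⁻¹] (∀ r, FiniteSlope (T r)) where
  carrier := {x | ∀ r, FiniteSlope.map (f r) (hf r) (x (r + 1)) = x r}
  add_mem' hx hy r := by simp [hx r, hy r]
  zero_mem' r := by simp
  smul_mem' a x hx r := by simp [hx r]

end FiniteSlope

/-! ## Affine group schemes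

An affine group scheme over `k` is given by its coordinate ring, a commutative Hopf algebra. -/

section Points

variable (k : Type*) [CommRing k]

/-- The group of `R`-points of the affine group scheme with coordinate ring `O`: the algebra
homomorphisms `O → R` with the convolution product. -/
abbrev Points (O : Type*) [CommRing O] [HopfAlgebra k O] (R : Type*) [CommRing R] [Algebra k R] :
    Type _ := WithConv (O →ₐ[k] R)

variable {k} {O O' : Type*} [CommRing O] [HopfAlgebra k O] [CommRing O'] [HopfAlgebra k O']
variable {R R' : Type*} [CommRing R] [Algebra k R] [CommRing R'] [Algebra k R']

/-- The group structure on points: the inverse is composition with the antipode. -/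
instance : Group (Points k O R) where
  inv g := WithConv.toConv (g.ofConv.comp (HopfAlgebra.antipodeAlgHom k O))
  inv_mul_cancel g := by
    ext a
    have h : ∀ t : O ⊗[k] O, Algebra.TensorProduct.lift
        (g.ofConv.comp (HopfAlgebra.antipodeAlgHom k O)) g.ofConv (fun _ _ => .all ..) t =
        g.ofConv (LinearMap.mul' k O ((HopfAlgebra.antipode k (A := O)).rTensor O t)) := by
      intro t
      induction t with
      | zero => simp
      | tmul b c => simp
      | add s t hs ht => simp only [map_add, hs, ht]
    refine (AlgHom.convMul_apply (R := k) _ g a).trans ((h _).trans ?_)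
    rw [HopfAlgebra.mul_antipode_rTensor_comul_apply]
    change g.ofConv (algebraMap k O _) = algebraMap k R _
    simp

/-- Functoriality of the group of points in the ring. -/
def mapPts (O : Type*) [CommRing O] [HopfAlgebra k O] (f : R →ₐ[k] R') :
    Points k O R →* Points k O R' where
  toFun g := WithConv.toConv (f.comp g.ofConv)
  map_one' := by
    ext a
    change f (algebraMap k R _) = algebraMap k R' _
    simp
  map_mul' g h := by
    rw [AlgHom.comp_convMul_distrib]

/-- The map on points of the homomorphism of group schemes dual to `φ : O → O'`. -/
def precomp (R : Type*) [CommRing R] [Algebra k R] (φ : O →ₐc[k] O') :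
    Points k O' R →* Points k O R where
  toFun g := WithConv.toConv (g.ofConv.comp (φ : O →ₐ[k] O'))
  map_one' := by
    ext a
    change algebraMap k R (Coalgebra.counit (φ a)) = algebraMap k R (Coalgebra.counit a)
    simp
  map_mul' g h := by
    rw [AlgHom.convMul_comp_bialgHom_distrib]

/-- For a topological ring `R`, the set of `R`-points has the topology of pointwise convergence
(the usual topology, induced from `Rⁿ` by a choice of `n` generators of `O`, if `O` is of finite
type). -/
instance [TopologicalSpace R] : TopologicalSpace (Points k O R) :=
  TopologicalSpace.induced (fun g a => g.ofConv a) Pi.topologicalSpace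

theorem continuous_apply_point [TopologicalSpace R] (a : O) :
    Continuous fun g : Points k O R => g.ofConv a :=
  (continuous_apply a).comp continuous_induced_dom

theorem continuous_to_points [TopologicalSpace R] {X : Type*} [TopologicalSpace X]
    {f : X → Points k O R} (h : ∀ a, Continuous fun x => (f x).ofConv a) : Continuous f :=
  continuous_induced_rng.2 (continuous_pi h)

instance [TopologicalSpace R] [IsTopologicalRing R] : IsTopologicalGroup (Points k O R) where
  continuous_mul := by
    refine continuous_to_points fun a => ?_
    have : ∀ t : O ⊗[k] O, Continuous fun x : Points k O R × Points k O R =>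
        Algebra.TensorProduct.lift x.1.ofConv x.2.ofConv (fun _ _ => .all ..) t := by
      intro t
      induction t with
      | zero => simpa using continuous_const
      | tmul b c =>
        simp only [Algebra.TensorProduct.lift_tmul]
        exact ((continuous_apply_point b).comp continuous_fst).mul
          ((continuous_apply_point c).comp continuous_snd)
      | add s t hs ht =>
        simp only [map_add]
        exact hs.add ht
    simpa only [AlgHom.convMul_apply] using this (Coalgebra.comul a)
  continuous_inv := continuous_to_points fun a => continuous_apply_point (HopfAlgebra.antipode k a)

theorem continuous_mapPts [TopologicalSpace R] [TopologicalSpace R'] (f : R →ₐ[k] R')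
    (hf : Continuous f) : Continuous (mapPts O f) :=
  continuous_to_points fun a => hf.comp (continuous_apply_point a)

/-- A closed immersion of group schemes induces a closed embedding on points over a Hausdorff
topological ring. -/
theorem isClosedEmbedding_precomp [TopologicalSpace R] [T2Space R] (φ : O →ₐc[k] O')
    (hφ : Function.Surjective φ) : Topology.IsClosedEmbedding (precomp R φ) := by
  have hcont : Continuous (precomp R φ) :=
    continuous_to_points fun a => continuous_apply_point (φ a)
  refine ⟨⟨⟨le_antisymm hcont.le_induced ?_⟩, ?_⟩, ?_⟩
  · let t : TopologicalSpace (Points k O' R) :=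
      TopologicalSpace.induced (precomp R φ) inferInstance
    refine continuous_id_iff_le.1 (@continuous_to_points k _ O' _ _ R _ _ _ _ t id fun a => ?_)
    obtain ⟨b, rfl⟩ := hφ a
    have hd : @Continuous _ _ t _ (precomp R φ) := continuous_induced_dom
    exact (continuous_apply_point (k := k) (O := O) (R := R) b).comp hd
  · intro g h hgh
    ext a
    obtain ⟨b, rfl⟩ := hφ a
    exact congrArg (fun x : Points k O R => x.ofConv b) hgh
  · have : Set.range (precomp R φ) =
        ⋂ (a : O) (b : O) (_ : φ a = φ b), {g : Points k O R | g.ofConv a = g.ofConv b} := by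
      ext g
      simp only [Set.mem_range, Set.mem_iInter, Set.mem_ofPred_eq]
      constructor
      · rintro ⟨h, rfl⟩ a b hab
        exact congrArg h.ofConv hab
      · intro hg
        have hker : RingHom.ker (φ : O →ₐ[k] O').toRingHom ≤ RingHom.ker g.ofConv.toRingHom := by
          intro a ha
          have h0 : φ a = φ 0 := (show φ a = 0 from ha).trans (map_zero φ).symm
          exact (hg a 0 h0).trans (map_zero g.ofConv)
        refine ⟨WithConv.toConv (AlgHom.liftOfSurjective (φ : O →ₐ[k] O') hφ g.ofConv hker), ?_⟩
        ext a
        exact AlgHom.liftOfSurjective_apply (φ : O →ₐ[k] O') hφ g.ofConv hker a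
    rw [this]
    exact isClosed_iInter fun a => isClosed_iInter fun b => isClosed_iInter fun _ =>
      isClosed_eq (continuous_apply_point a) (continuous_apply_point b)

end Points

/-! ## Closed subgroup schemes and the dynamic description of parabolic subgroups -/

section Subgroups

variable {k : Type*} [CommRing k]

/-- A closed subgroup scheme of the affine group scheme with coordinate ring `O`: a Hopf ideal. -/
structure ClosedSubgroup (k : Type*) [CommRing k] (O : Type*) [CommRing O] [HopfAlgebra k O] where
  ideal : Ideal O
  isHopfIdeal : ideal.IsHopfIdeal k

attribute [instance] ClosedSubgroup.isHopfIdeal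

variable {O : Type*} [CommRing O] [HopfAlgebra k O]

/-- The subgroup of `R`-points of a closed subgroup scheme. -/
def ClosedSubgroup.points (Q : ClosedSubgroup k O) (R : Type*) [CommRing R] [Algebra k R] :
    Subgroup (Points k O R) :=
  (precomp R (Bialgebra.Quotient.mkBialgHom (R := k) Q.ideal)).range

theorem ClosedSubgroup.mem_points (Q : ClosedSubgroup k O) {R : Type*} [CommRing R] [Algebra k R]
    (g : Points k O R) : g ∈ Q.points R ↔ ∀ a ∈ Q.ideal, g.ofConv a = 0 := by
  constructor
  · rintro ⟨h, rfl⟩ a ha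
    change h.ofConv (Ideal.Quotient.mk Q.ideal a) = 0
    rw [Ideal.Quotient.eq_zero_iff_mem.2 ha, map_zero]
  · intro h
    refine ⟨WithConv.toConv (Ideal.Quotient.liftₐ Q.ideal g.ofConv h), ?_⟩
    ext a
    rfl

/-- The point `η(t)`, for a cocharacter `η : 𝔾ₘ → G` and a unit `t` of `R`; more generally for a
map of schemes `η : 𝔾ₘ → G`. -/
def loopAt (η : Points k O k[T;T⁻¹]) {R : Type*} [CommRing R] [Algebra k R] (t : Rˣ) :
    Points k O R :=
  mapPts O { LaurentPolynomial.eval₂ (algebraMap k R) t with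
    commutes' := fun c => LaurentPolynomial.eval₂_C (algebraMap k R) t c } η

/-- The inclusion `R → R[T, T⁻¹]`. -/
def constLaurent (k : Type*) [CommRing k] (R : Type*) [CommRing R] [Algebra k R] :
    R →ₐ[k] R[T;T⁻¹] :=
  IsScalarTower.toAlgHom k R R[T;T⁻¹]

/-- The inclusion `R[T] → R[T, T⁻¹]`. -/
def polyLaurent (k : Type*) [CommRing k] (R : Type*) [CommRing R] [Algebra k R] :
    R[X] →ₐ[k] R[T;T⁻¹] :=
  (Polynomial.toLaurentAlg : R[X] →ₐ[R] R[T;T⁻¹]).restrictScalars k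

/-- The evaluation `R[T] → R` at `T = 0`. -/
def evalZero (k : Type*) [CommRing k] (R : Type*) [CommRing R] [Algebra k R] : R[X] →ₐ[k] R :=
  (Polynomial.aeval (0 : R) : R[X] →ₐ[R] R).restrictScalars k

variable (η : Points k O k[T;T⁻¹]) (R : Type*) [CommRing R] [Algebra k R]

/-- The map `g ↦ η(T) g η(T)⁻¹` from `G(R)` to `G(R[T, T⁻¹])`. -/
def conjLoop : Points k O R →* Points k O R[T;T⁻¹] :=
  (MulAut.conj (loopAt η (unitOfInvertible (LaurentPolynomial.T 1 : R[T;T⁻¹])))).toMonoidHom.comp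
    (mapPts O (constLaurent k R))

/-- The `R`-points of `P_G(η)`: the `g` such that `lim_{t → 0} η(t) g η(t)⁻¹` exists, which
means that `η(T) g η(T)⁻¹` lies in `G(R[T])`. For a cocharacter `η` of a reductive group scheme
`G` this is a parabolic subgroup, with Levi factor `Z_G(η)` and unipotent radical `U_G(η)`. -/
def parabolic : Subgroup (Points k O R) :=
  (mapPts O (polyLaurent k R)).range.comap (conjLoop η R)

/-- The `R`-points of `U_G(η)`: the `g` such that `lim_{t → 0} η(t) g η(t)⁻¹ = 1`. -/
def unipotent : Subgroup (Points k O R) :=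
  ((mapPts O (evalZero k R)).ker.map (mapPts O (polyLaurent k R))).comap (conjLoop η R)

/-- The `R`-points of the centraliser `Z_G(η)`. -/
def levi : Subgroup (Points k O R) :=
  (conjLoop η R).eqLocus (mapPts O (constLaurent k R))

variable {R}

theorem loopAt_map {R' : Type*} [CommRing R'] [Algebra k R'] (f : R →ₐ[k] R') (t : Rˣ) :
    mapPts O f (loopAt η t) = loopAt η (Units.map (f : R →* R') t) := by
  ext a
  change f (LaurentPolynomial.eval₂ (algebraMap k R) t (η.ofConv a)) =
    LaurentPolynomial.eval₂ (algebraMap k R') (Units.map (f : R →* R') t) (η.ofConv a)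
  induction η.ofConv a using LaurentPolynomial.induction_on' with
  | add p q hp hq => simp only [map_add, hp, hq]
  | C_mul_T n c =>
    rw [map_mul, map_mul, map_mul, LaurentPolynomial.eval₂_C, LaurentPolynomial.eval₂_C,
      LaurentPolynomial.eval₂_T, LaurentPolynomial.eval₂_T, ← map_zpow, AlgHom.commutes]
    rfl

variable (O) in
/-- The tautological point in `G(O)`. -/
def univPt : Points k O O := WithConv.toConv (AlgHom.id k O)

/-- The ideal of `P_G(η)`: it is generated by the coefficients at the negative powers of `T` of
the functions `a(η(T) g η(T)⁻¹)`, where `a` runs over `O` and `g` is the tautological point. -/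
def parabolicIdeal : Ideal O :=
  Ideal.span {b | ∃ (a : O) (n : ℤ), n < 0 ∧
    b = ((conjLoop η O (univPt O)).ofConv a).coeff n}

theorem conjLoop_apply (g : Points k O R) (a : O) :
    (conjLoop η R g).ofConv a =
      AddMonoidAlgebra.mapAlgHom ℤ g.ofConv ((conjLoop η O (univPt O)).ofConv a) := by
  have h : mapPts O (AddMonoidAlgebra.mapAlgHom ℤ g.ofConv) (conjLoop η O (univPt O)) =
      conjLoop η R g := by
    have h1 : mapPts O (AddMonoidAlgebra.mapAlgHom ℤ g.ofConv)
        (loopAt η (unitOfInvertible (LaurentPolynomial.T 1 : O[T;T⁻¹]))) =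
        loopAt η (unitOfInvertible (LaurentPolynomial.T 1 : R[T;T⁻¹])) := by
      rw [loopAt_map]
      congr 1
      ext1
      change AddMonoidAlgebra.mapAlgHom ℤ g.ofConv (LaurentPolynomial.T 1) = _
      rw [LaurentPolynomial.T, AddMonoidAlgebra.mapAlgHom_single, map_one]
      rfl
    have h2 : mapPts O (AddMonoidAlgebra.mapAlgHom ℤ g.ofConv)
        (mapPts O (constLaurent k O) (univPt O)) = mapPts O (constLaurent k R) g := by
      ext1
      apply AlgHom.ext
      intro a
      change AddMonoidAlgebra.mapAlgHom ℤ g.ofConv (algebraMap O O[T;T⁻¹] a) =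
        algebraMap R R[T;T⁻¹] (g.ofConv a)
      rw [← LaurentPolynomial.C_eq_algebraMap, ← LaurentPolynomial.C_eq_algebraMap,
        ← LaurentPolynomial.single_eq_C, ← LaurentPolynomial.single_eq_C,
        AddMonoidAlgebra.mapAlgHom_single]
    simp only [conjLoop, MonoidHom.comp_apply, MulEquiv.toMonoidHom_eq_coe, MonoidHom.coe_coe,
      MulAut.conj_apply, map_mul, map_inv, h1, h2]
  rw [← h]
  rfl

/-- The points of the closed subscheme defined by `parabolicIdeal η` are the points of
`P_G(η)`. -/
theorem mem_parabolic_iff (g : Points k O R) :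
    g ∈ parabolic η R ↔ ∀ b ∈ parabolicIdeal η, g.ofConv b = 0 := by
  have hcoe : ∀ f : R[X], ∀ n : ℤ, n < 0 → (Polynomial.toLaurent f).coeff n = 0 := by
    intro f n hn
    by_contra hne
    have : n ∈ (Polynomial.toLaurent f).coeff.support := Finsupp.mem_support_iff.2 hne
    rw [LaurentPolynomial.support_coeff_toLaurent, Finset.mem_map] at this
    obtain ⟨m, -, rfl⟩ := this
    exact absurd hn (by simp)
  have key : (∀ b ∈ parabolicIdeal η, g.ofConv b = 0) ↔
      ∀ (a : O) (n : ℤ), n < 0 → ((conjLoop η R g).ofConv a).coeff n = 0 := by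
    constructor
    · intro h a n hn
      rw [conjLoop_apply, AddMonoidAlgebra.coeff_mapAlgHom]
      exact h _ (Ideal.subset_span ⟨a, n, hn, rfl⟩)
    · intro h b hb
      have hle : parabolicIdeal η ≤ RingHom.ker g.ofConv := by
        refine Ideal.span_le.2 ?_
        rintro _ ⟨a, n, hn, rfl⟩
        have := h a n hn
        rwa [conjLoop_apply, AddMonoidAlgebra.coeff_mapAlgHom] at this
      exact hle hb
  rw [key]
  constructor
  · rintro ⟨f, hf⟩ a n hn
    rw [← hf]
    exact hcoe (f.ofConv a) n hn
  · intro h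
    have htr : ∀ (f : R[T;T⁻¹]) (m : ℕ),
        (Polynomial.toLaurent (LaurentPolynomial.trunc f)).coeff (m : ℤ) = f.coeff (m : ℤ) := by
      intro f m
      induction f using LaurentPolynomial.induction_on' with
      | add p q hp hq =>
        rw [map_add, map_add, AddMonoidAlgebra.coeff_add, AddMonoidAlgebra.coeff_add,
          Finsupp.add_apply, Finsupp.add_apply, hp, hq]
      | C_mul_T n c =>
        rw [LaurentPolynomial.trunc_C_mul_T]
        split_ifs with hn
        · lift n to ℕ using hn
          rw [Int.toNat_natCast, ← Polynomial.C_mul_X_pow_eq_monomial,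
            Polynomial.toLaurent_C_mul_X_pow]
        · rw [← LaurentPolynomial.single_eq_C_mul_T, map_zero]
          have : n ≠ m := by omega
          simp [this, -LaurentPolynomial.single_eq_C_mul_T]
    have hr : ∀ a, (conjLoop η R g).ofConv a ∈ (polyLaurent k R).range := by
      intro a
      refine ⟨LaurentPolynomial.trunc ((conjLoop η R g).ofConv a), ?_⟩
      change Polynomial.toLaurent (LaurentPolynomial.trunc _) = _
      refine LaurentPolynomial.ext fun n => ?_
      by_cases hn : n < 0
      · rw [hcoe _ n hn, h a n hn]
      · obtain ⟨m, rfl⟩ := Int.eq_ofNat_of_zero_le (not_lt.1 hn)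
        exact htr _ m
    have hinj : Function.Injective (polyLaurent k R) := Polynomial.toLaurent_injective
    refine ⟨WithConv.toConv ((AlgEquiv.ofInjective _ hinj).symm.toAlgHom.comp
      ((conjLoop η R g).ofConv.codRestrict _ hr)), ?_⟩
    apply WithConv.ext
    apply AlgHom.ext
    intro a
    exact congrArg Subtype.val ((AlgEquiv.ofInjective _ hinj).apply_symm_apply
      ((conjLoop η R g).ofConv.codRestrict _ hr a))

end Subgroups

/-! ## Mirabolic subgroups -/

section Mirabolic

variable {k : Type*} [CommRing k] {O : Type*} [CommRing O] [HopfAlgebra k O]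

/-- The point of `G(k[T, T⁻¹])` given by a cocharacter, i.e. by a homomorphism of group schemes
`𝔾ₘ → G`, dual to a homomorphism of Hopf algebras `O → k[T, T⁻¹]`. -/
def loopOf (η : O →ₐc[k] k[T;T⁻¹]) : Points k O k[T;T⁻¹] :=
  WithConv.toConv (η : O →ₐ[k] k[T;T⁻¹])

/-- `L⁰` is a normal subgroup scheme of the Levi subgroup `Z_G(η)` (`R` runs over all
`k`-algebras; it suffices to consider those in the universe of the coordinate ring). -/
structure IsNormalInLevi {k O : Type} [CommRing k] [CommRing O] [HopfAlgebra k O]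
    (η : O →ₐc[k] k[T;T⁻¹]) (L0 : ClosedSubgroup k O) : Prop where
  le : ∀ (R : Type) [CommRing R] [Algebra k R], L0.points R ≤ levi (loopOf η) R
  normal : ∀ (R : Type) [CommRing R] [Algebra k R],
    ∀ l ∈ levi (loopOf η) R, ∀ x ∈ L0.points R, l * x * l⁻¹ ∈ L0.points R

/-- The `R`-points of `N · L⁰`, where `N = U_G(η)` (`N` is normalised by `L⁰ ⊆ Z_G(η)`, so that
the subgroup generated by `N` and `L⁰` consists of the products). -/
def mirabolic (η : Points k O k[T;T⁻¹]) (L0 : ClosedSubgroup k O) (R : Type*) [CommRing R]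
    [Algebra k R] : Subgroup (Points k O R) :=
  unipotent η R ⊔ L0.points R

/-- A mirabolic subgroup: `Q⁰ = N · L⁰`, for a parabolic subgroup `Q = P_G(μ)` with
Levi decomposition `Q = L · N`, `L = Z_G(μ)`, `N = U_G(μ)`, and a normal subgroup `L⁰` of `L`. -/
def IsMirabolic {k O : Type} [CommRing k] [CommRing O] [HopfAlgebra k O]
    (Q0 : ClosedSubgroup k O) : Prop :=
  ∃ (μ : O →ₐc[k] k[T;T⁻¹]) (L0 : ClosedSubgroup k O), IsNormalInLevi μ L0 ∧
    ∀ (R : Type) [CommRing R] [Algebra k R], Q0.points R = mirabolic (loopOf μ) L0 R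

end Mirabolic

/-! ## Reductive group schemes over `ℤ_[p]` -/

section Reductive

/-- Right translation by a `K`-point `g` on the coordinate ring `B` of an affine group over `K`:
`(ρ_g b)(x) = b(x g)`. -/
def rightTranslation {K B : Type*} [Field K] [CommRing B] [HopfAlgebra K B] (g : Points K B K) :
    B →ₗ[K] B :=
  (TensorProduct.rid K B).toLinearMap ∘ₗ (g.ofConv.toLinearMap.lTensor B) ∘ₗ Coalgebra.comul

/-- `g` is a unipotent element: right translation by `g` is locally unipotent. -/
def IsUnipotentElement {K B : Type*} [Field K] [CommRing B] [HopfAlgebra K B]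
    (g : Points K B K) : Prop :=
  ∀ b : B, ∃ n : ℕ, ((rightTranslation g - 1) ^ n) b = 0

/-- A smooth affine algebraic group over an algebraically closed field `K`, with coordinate ring
`B`, is connected reductive: it is connected (equivalently, `B` is a domain), and its only
connected (equivalently, irreducible) closed normal subgroup consisting of unipotent elements
is the trivial one. -/
structure IsConnectedReductive (K B : Type*) [Field K] [CommRing B] [HopfAlgebra K B] :
    Prop where
  isDomain : IsDomain B
  unipotentRadical : ∀ N : Subgroup (Points K B K), N.Normal →
    (∃ P : Ideal B, P.IsPrime ∧ ∀ g : Points K B K, g ∈ N ↔ ∀ b ∈ P, g.ofConv b = 0) →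
    (∀ g ∈ N, IsUnipotentElement g) → N = ⊥

/-- A reductive group scheme over `ℤ_[p]`, with coordinate ring `O`: it is smooth and affine, and
its geometric fibres are connected reductive groups. -/
class IsReductiveGroupScheme (p : ℕ) [Fact p.Prime] (O : Type) [CommRing O]
    [HopfAlgebra ℤ_[p] O] : Prop extends Algebra.Smooth ℤ_[p] O where
  geometricFibres : ∀ (K : Type) [Field K] [IsAlgClosed K] [Algebra ℤ_[p] K],
    IsConnectedReductive K (K ⊗[ℤ_[p]] O)

end Reductive

/-! ## The conditions (A) and (B) -/

section Orbit

variable {k OG OH : Type} [CommRing k] [CommRing OG] [HopfAlgebra k OG]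
  [CommRing OH] [HopfAlgebra k OH]

/-- The coordinate ring of `Q_H⁰ × Q̄_G`, where `Q̄_G = P_G(η⁻¹)`. -/
abbrev OrbitRing (QH0 : ClosedSubgroup k OH) (η : OG →ₐc[k] k[T;T⁻¹]) : Type :=
  (OH ⧸ QH0.ideal) ⊗[k] (OG ⧸ parabolicIdeal (loopOf η)⁻¹)

/-- The tautological point of `Q_H⁰`, as a point of `H` over `OrbitRing QH0 η`. -/
def orbitPtH (QH0 : ClosedSubgroup k OH) (η : OG →ₐc[k] k[T;T⁻¹]) :
    Points k OH (OrbitRing QH0 η) :=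
  WithConv.toConv ((Algebra.TensorProduct.includeLeft : OH ⧸ QH0.ideal →ₐ[k] OrbitRing QH0 η).comp
    (Ideal.Quotient.mkₐ k QH0.ideal))

/-- The tautological point of `Q̄_G`, as a point of `G` over `OrbitRing QH0 η`. -/
def orbitPtG (QH0 : ClosedSubgroup k OH) (η : OG →ₐc[k] k[T;T⁻¹]) :
    Points k OG (OrbitRing QH0 η) :=
  WithConv.toConv ((Algebra.TensorProduct.includeRight :
    OG ⧸ parabolicIdeal (loopOf η)⁻¹ →ₐ[k] OrbitRing QH0 η).comp
      (Ideal.Quotient.mkₐ k (parabolicIdeal (loopOf η)⁻¹)))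

/-- The homomorphism of coordinate rings dual to the morphism `Q_H⁰ × Q̄_G → G`,
`(h, q) ↦ ι(h) u q`. This morphism is the base change of the orbit map
`Q_H⁰ → G / Q̄_G`, `h ↦ h u Q̄_G`, along the `Q̄_G`-torsor `G → G / Q̄_G`. -/
def orbitHom (ι : OG →ₐc[k] OH) (QH0 : ClosedSubgroup k OH) (η : OG →ₐc[k] k[T;T⁻¹])
    (u : Points k OG k) : OG →ₐ[k] OrbitRing QH0 η :=
  WithConv.ofConv (precomp (OrbitRing QH0 η) ι (orbitPtH QH0 η) *
    mapPts OG (Algebra.ofId k (OrbitRing QH0 η)) u * orbitPtG QH0 η)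

/-- The `Q_H⁰`-orbit of (the image of) `u` in the flag scheme `F = G / Q̄_G` is open,
scheme-theoretically: its preimage in `G` is open, and the orbit map `Q_H⁰ → F` is smooth
(so that the orbit, as an étale subsheaf of `F`, is an open subscheme of `F`). Both are
stated after base change along the smooth surjection `G → F`. -/
structure HasOpenOrbit (ι : OG →ₐc[k] OH) (QH0 : ClosedSubgroup k OH)
    (η : OG →ₐc[k] k[T;T⁻¹]) (u : Points k OG k) : Prop where
  isOpen : IsOpen (Set.range (PrimeSpectrum.comap (orbitHom ι QH0 η u).toRingHom))
  smooth : (orbitHom ι QH0 η u).toRingHom.Smooth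

/-- The inclusion of subgroup schemes `u⁻¹ Q_H⁰ u ∩ Q̄_G ⊆ Q̄_G⁰`, where `Q̄_G = P_G(η⁻¹)` and
`Q̄_G⁰ = U_G(η⁻¹) · L_G⁰`. -/
def StabilizerLE (ι : OG →ₐc[k] OH) (QH0 : ClosedSubgroup k OH) (η : OG →ₐc[k] k[T;T⁻¹])
    (LG0 : ClosedSubgroup k OG) (u : Points k OG k) : Prop :=
  ∀ (R : Type) [CommRing R] [Algebra k R], ∀ h ∈ QH0.points R,
    (mapPts OG (Algebra.ofId k R) u)⁻¹ * precomp R ι h * mapPts OG (Algebra.ofId k R) u ∈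
      parabolic (loopOf η)⁻¹ R →
    (mapPts OG (Algebra.ofId k R) u)⁻¹ * precomp R ι h * mapPts OG (Algebra.ofId k R) u ∈
      mirabolic (loopOf η)⁻¹ LG0 R

end Orbit

/-! ## The level groups -/

section Levels

variable {p : ℕ} [Fact p.Prime] {O : Type} [CommRing O] [HopfAlgebra ℤ_[p] O]

variable (p O) in
/-- The inclusion `G(ℤ_p) → G(ℚ_p)`. -/
def toRat : Points ℤ_[p] O ℤ_[p] →* Points ℤ_[p] O ℚ_[p] :=
  mapPts O (Algebra.ofId ℤ_[p] ℚ_[p])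

variable (p O) in
/-- The reduction map `G(ℤ_p) → G(ℤ/pʳ)`. -/
def red (r : ℕ) : Points ℤ_[p] O ℤ_[p] →*
    Points ℤ_[p] O (ℤ_[p] ⧸ Ideal.span {(p : ℤ_[p]) ^ r}) :=
  mapPts O (Ideal.Quotient.mkₐ ℤ_[p] (Ideal.span {(p : ℤ_[p]) ^ r}))

/-- The subgroup `G(ℤ_p)` of `G(ℚ_p)`. -/
def intPts (p : ℕ) [Fact p.Prime] (O : Type) [CommRing O] [HopfAlgebra ℤ_[p] O] :
    Subgroup (Points ℤ_[p] O ℚ_[p]) := (toRat p O).range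

/-- The element `τ = η(p)` of `G(ℚ_p)`. -/
def tau (η : O →ₐc[ℤ_[p]] ℤ_[p][T;T⁻¹]) : Points ℤ_[p] O ℚ_[p] :=
  loopAt (loopOf η) (Units.mk0 (p : ℚ_[p]) (Nat.cast_ne_zero.2 (Fact.out : p.Prime).ne_zero))

/-- The group `U_r` of all `g ∈ G(ℤ_p)` such that `τ⁻ʳ g τʳ ∈ G(ℤ_p)` and such that
the reduction of `g` modulo `pʳ` lies in `Q̄_G⁰`. -/
def groupU (η : O →ₐc[ℤ_[p]] ℤ_[p][T;T⁻¹]) (L0 : ClosedSubgroup ℤ_[p] O) (r : ℕ) :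
    Subgroup (Points ℤ_[p] O ℚ_[p]) :=
  (((mirabolic (loopOf η)⁻¹ L0 (ℤ_[p] ⧸ Ideal.span {(p : ℤ_[p]) ^ r})).comap (red p O r)).map
    (toRat p O)) ⊓
  (intPts p O).comap (MulAut.conj (tau η ^ r)⁻¹).toMonoidHom

theorem groupU_le (η : O →ₐc[ℤ_[p]] ℤ_[p][T;T⁻¹]) (L0 : ClosedSubgroup ℤ_[p] O) (r : ℕ) :
    groupU η L0 r ≤ intPts p O := by
  rintro _ ⟨⟨g, -, rfl⟩, -⟩
  exact ⟨g, rfl⟩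

instance : CompactSpace (Points ℤ_[p] O ℤ_[p]) := by
  have hinj : Function.Injective fun (g : Points ℤ_[p] O ℤ_[p]) (a : O) => g.ofConv a := by
    intro g h hgh
    ext a
    exact congrFun hgh a
  refine Topology.IsClosedEmbedding.compactSpace
    (f := fun (g : Points ℤ_[p] O ℤ_[p]) (a : O) => g.ofConv a) ⟨⟨⟨rfl⟩, hinj⟩, ?_⟩
  have : Set.range (fun (g : Points ℤ_[p] O ℤ_[p]) (a : O) => g.ofConv a) =
      (⋂ c : ℤ_[p], {f | f (algebraMap ℤ_[p] O c) = c}) ∩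
      ((⋂ (a : O) (b : O), {f | f (a * b) = f a * f b}) ∩
        ⋂ (a : O) (b : O), {f | f (a + b) = f a + f b}) := by
    ext f
    simp only [Set.mem_range, Set.mem_inter_iff, Set.mem_iInter, Set.mem_ofPred_eq]
    constructor
    · rintro ⟨g, rfl⟩
      exact ⟨fun c => g.ofConv.commutes c, fun a b => map_mul _ a b, fun a b => map_add _ a b⟩
    · rintro ⟨hc, hm, ha⟩
      refine ⟨WithConv.toConv
        { toFun := f
          map_one' := by simpa using hc 1
          map_mul' := hm
          map_zero' := by simpa using hc 0
          map_add' := ha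
          commutes' := hc }, rfl⟩
  rw [this]
  refine IsClosed.inter (isClosed_iInter fun c => ?_) (IsClosed.inter
    (isClosed_iInter fun a => isClosed_iInter fun b => ?_)
    (isClosed_iInter fun a => isClosed_iInter fun b => ?_))
  · exact isClosed_eq (continuous_apply _) continuous_const
  · exact isClosed_eq (continuous_apply _) ((continuous_apply a).mul (continuous_apply b))
  · exact isClosed_eq (continuous_apply _) ((continuous_apply a).add (continuous_apply b))

theorem continuous_toRat : Continuous (toRat p O) :=
  continuous_mapPts _ (PadicInt.isOpenEmbedding_coe).continuous

theorem isCompact_intPts : IsCompact (intPts p O : Set (Points ℤ_[p] O ℚ_[p])) := by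
  rw [intPts, MonoidHom.coe_range]
  exact isCompact_range continuous_toRat

theorem isOpen_ker_red [Algebra.FiniteType ℤ_[p] O] (r : ℕ) :
    IsOpen (((red p O r).ker.map (toRat p O) : Subgroup _) : Set (Points ℤ_[p] O ℚ_[p])) := by
  obtain ⟨s, hs⟩ := (Algebra.FiniteType.out : (⊤ : Subalgebra ℤ_[p] O).FG)
  refine Subgroup.isOpen_of_mem_nhds _ (g := 1) (Filter.mem_of_superset
    (x := ⋂ a ∈ s, {g : Points ℤ_[p] O ℚ_[p] |
      ‖g.ofConv a - (1 : Points ℤ_[p] O ℚ_[p]).ofConv a‖ < (p : ℝ) ^ (-(r : ℤ))}) ?_ ?_)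
  · refine (isOpen_biInter_finset fun a _ => ?_).mem_nhds ?_
    · exact isOpen_lt (((continuous_apply_point a).sub continuous_const).norm) continuous_const
    · simp only [Set.mem_iInter, Set.mem_ofPred_eq, sub_self, norm_zero]
      intro a _
      exact zpow_pos (Nat.cast_pos.2 (Fact.out : p.Prime).pos) _
  · intro g hg
    simp only [Set.mem_iInter, Set.mem_ofPred_eq] at hg
    have h1 : ∀ a, (1 : Points ℤ_[p] O ℚ_[p]).ofConv a =
        (((1 : Points ℤ_[p] O ℤ_[p]).ofConv a : ℤ_[p]) : ℚ_[p]) := fun a => rfl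
    have hle : (p : ℝ) ^ (-(r : ℤ)) ≤ 1 :=
      zpow_le_one_of_nonpos₀ (Nat.one_le_cast.2 (Fact.out : p.Prime).pos) (by simp)
    have hint : ∀ a, g.ofConv a ∈ (Algebra.ofId ℤ_[p] ℚ_[p]).range := by
      have : (⊤ : Subalgebra ℤ_[p] O) ≤ (Algebra.ofId ℤ_[p] ℚ_[p]).range.comap g.ofConv := by
        rw [← hs]
        refine Algebra.adjoin_le fun a ha => ?_
        have h2 : ‖g.ofConv a - (1 : Points ℤ_[p] O ℚ_[p]).ofConv a‖ ≤ 1 :=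
          ((hg a ha).trans_le hle).le
        let y : ℤ_[p] := ⟨_, h2⟩
        refine ⟨y + (1 : Points ℤ_[p] O ℤ_[p]).ofConv a, ?_⟩
        change g.ofConv a - (1 : Points ℤ_[p] O ℚ_[p]).ofConv a +
          (((1 : Points ℤ_[p] O ℤ_[p]).ofConv a : ℤ_[p]) : ℚ_[p]) = g.ofConv a
        rw [h1, sub_add_cancel]
      exact fun a => this Algebra.mem_top
    have hinj : Function.Injective (Algebra.ofId ℤ_[p] ℚ_[p]) := Subtype.val_injective
    let g0 : Points ℤ_[p] O ℤ_[p] := WithConv.toConv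
      ((AlgEquiv.ofInjective _ hinj).symm.toAlgHom.comp (g.ofConv.codRestrict _ hint))
    have hg0 : ∀ a, ((g0.ofConv a : ℤ_[p]) : ℚ_[p]) = g.ofConv a := fun a =>
      congrArg Subtype.val ((AlgEquiv.ofInjective _ hinj).apply_symm_apply
        (g.ofConv.codRestrict _ hint a))
    refine ⟨g0, ?_, ?_⟩
    · rw [SetLike.mem_coe, MonoidHom.mem_ker]
      apply WithConv.ext
      refine AlgHom.ext_of_adjoin_eq_top hs fun a ha => ?_
      have h3 : g0.ofConv a - (1 : Points ℤ_[p] O ℤ_[p]).ofConv a ∈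
          Ideal.span {(p : ℤ_[p]) ^ r} := by
        rw [← PadicInt.norm_le_pow_iff_mem_span_pow, PadicInt.norm_def, PadicInt.coe_sub,
          hg0, ← h1]
        exact (hg a ha).le
      exact (Ideal.Quotient.eq.2 h3)
    · apply WithConv.ext
      apply AlgHom.ext
      exact hg0

theorem isOpen_intPts [Algebra.FiniteType ℤ_[p] O] :
    IsOpen (intPts p O : Set (Points ℤ_[p] O ℚ_[p])) := by
  refine Subgroup.isOpen_mono ?_ (isOpen_ker_red (p := p) (O := O) 0)
  rintro _ ⟨g, -, rfl⟩
  exact ⟨g, rfl⟩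

theorem isOpen_groupU [Algebra.FiniteType ℤ_[p] O] (η : O →ₐc[ℤ_[p]] ℤ_[p][T;T⁻¹])
    (L0 : ClosedSubgroup ℤ_[p] O) (r : ℕ) :
    IsOpen (groupU η L0 r : Set (Points ℤ_[p] O ℚ_[p])) := by
  rw [groupU, Subgroup.coe_inf]
  refine IsOpen.inter (Subgroup.isOpen_mono ?_ (isOpen_ker_red (p := p) (O := O) r)) ?_
  · refine Subgroup.map_mono fun g hg => ?_
    rw [Subgroup.mem_comap, (MonoidHom.mem_ker).1 hg]
    exact one_mem _
  · refine (isOpen_intPts (p := p) (O := O)).preimage ?_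
    change Continuous fun x => (tau η ^ r)⁻¹ * x * (tau η ^ r)⁻¹⁻¹
    fun_prop

variable [Algebra.FiniteType ℤ_[p] O] {S : Submonoid (Points ℤ_[p] O ℚ_[p])}

/-- `U_r` as an open compact subgroup of `G(ℚ_p)`. -/
def levelU (hS : ∀ g ∈ intPts p O, g ∈ S) (η : O →ₐc[ℤ_[p]] ℤ_[p][T;T⁻¹])
    (L0 : ClosedSubgroup ℤ_[p] O) (r : ℕ) : Level S where
  toSubgroup := groupU η L0 r
  isOpen := isOpen_groupU η L0 r
  isCompact := isCompact_intPts.of_isClosed_subset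
    (Subgroup.isClosed_of_isOpen _ (isOpen_groupU η L0 r)) (groupU_le η L0 r)
  le g hg := hS g (groupU_le η L0 r hg)

theorem conj_tau_mem (hS : ∀ g ∈ intPts p O, g ∈ S) (η : O →ₐc[ℤ_[p]] ℤ_[p][T;T⁻¹])
    (L0 : ClosedSubgroup ℤ_[p] O) (r : ℕ) :
    ∀ x ∈ (levelU hS η L0 r).toSubgroup, (tau η ^ r)⁻¹ * x * (tau η ^ r)⁻¹⁻¹ ∈ S :=
  fun _ hx => hS _ hx.2

theorem conj_intPt_mem (hS : ∀ g ∈ intPts p O, g ∈ S) (η : O →ₐc[ℤ_[p]] ℤ_[p][T;T⁻¹])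
    (L0 : ClosedSubgroup ℤ_[p] O) (r : ℕ) (u : Points ℤ_[p] O ℤ_[p]) :
    ∀ x ∈ (levelU hS η L0 r).toSubgroup, toRat p O u * x * (toRat p O u)⁻¹ ∈ S :=
  fun _ hx => hS _ (mul_mem (mul_mem ⟨u, rfl⟩ (groupU_le η L0 r hx)) (inv_mem ⟨u, rfl⟩))

/-- The level `V_r = τ⁻ʳ U_r τʳ`. -/
def levelV (hS : ∀ g ∈ intPts p O, g ∈ S) (η : O →ₐc[ℤ_[p]] ℤ_[p][T;T⁻¹])
    (L0 : ClosedSubgroup ℤ_[p] O) (r : ℕ) : Level S :=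
  (levelU hS η L0 r).conj (tau η ^ r)⁻¹ (conj_tau_mem hS η L0 r)

/-- The level `u U_r u⁻¹`, for `u ∈ G(ℤ_p)`. -/
def levelConjU (hS : ∀ g ∈ intPts p O, g ∈ S) (η : O →ₐc[ℤ_[p]] ℤ_[p][T;T⁻¹])
    (L0 : ClosedSubgroup ℤ_[p] O) (u : Points ℤ_[p] O ℤ_[p]) (r : ℕ) : Level S :=
  (levelU hS η L0 r).conj (toRat p O u) (conj_intPt_mem hS η L0 r u)

end Levels

/-! ## The construction -/

section Construction

variable {p : ℕ} [Fact p.Prime] {OG OH : Type} [CommRing OG] [HopfAlgebra ℤ_[p] OG]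
  [CommRing OH] [HopfAlgebra ℤ_[p] OH]

/-- The compact subgroup `Q_H⁰(ℤ_p)` of `H(ℚ_p)`. -/
def mirabolicPts (QH0 : ClosedSubgroup ℤ_[p] OH) : Subgroup (Points ℤ_[p] OH ℚ_[p]) :=
  (QH0.points ℤ_[p]).map (toRat p OH)

variable [Algebra.FiniteType ℤ_[p] OG] {S : Submonoid (Points ℤ_[p] OG ℚ_[p])}

/-- The compact subgroup `Q_H⁰(ℤ_p) ∩ u U_r u⁻¹` of `H(ℚ_p)`. -/
def mirabolicPtsLevel (ι : OG →ₐc[ℤ_[p]] OH) (QH0 : ClosedSubgroup ℤ_[p] OH)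
    (hS : ∀ g ∈ intPts p OG, g ∈ S) (η : OG →ₐc[ℤ_[p]] ℤ_[p][T;T⁻¹])
    (LG0 : ClosedSubgroup ℤ_[p] OG) (u : Points ℤ_[p] OG ℤ_[p]) (r : ℕ) :
    Subgroup (Points ℤ_[p] OH ℚ_[p]) :=
  mirabolicPts QH0 ⊓ (levelConjU hS η LG0 u r).toSubgroup.comap (precomp ℚ_[p] ι)

variable {A : Type*} [CommRing A] {MG : CohomologyFunctor S A}

/-- The map `[τʳ]_⋆ : M_G(U_r) → M_G(V_r)`. -/
def pushTau (MG : CohomologyFunctor S A) (hS : ∀ g ∈ intPts p OG, g ∈ S)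
    (η : OG →ₐc[ℤ_[p]] ℤ_[p][T;T⁻¹]) (hτ : (tau η)⁻¹ ∈ S) (LG0 : ClosedSubgroup ℤ_[p] OG)
    (r : ℕ) : MG.obj (levelU hS η LG0 r) →ₗ[A] MG.obj (levelV hS η LG0 r) :=
  MG.push (tau η ^ r) (by rw [← inv_pow]; exact pow_mem hτ r) (by
    have h := (levelU hS η LG0 r).carries_conj_inv (tau η ^ r)⁻¹ (conj_tau_mem hS η LG0 r)
    rwa [inv_inv] at h)

/-- The map `[u]_⋆ : M_G(u U_r u⁻¹) → M_G(U_r)`. -/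
def pushU (MG : CohomologyFunctor S A) (hS : ∀ g ∈ intPts p OG, g ∈ S)
    (η : OG →ₐc[ℤ_[p]] ℤ_[p][T;T⁻¹]) (LG0 : ClosedSubgroup ℤ_[p] OG)
    (u : Points ℤ_[p] OG ℤ_[p]) (r : ℕ) :
    MG.obj (levelConjU hS η LG0 u r) →ₗ[A] MG.obj (levelU hS η LG0 r) :=
  MG.push (toRat p OG u) (hS _ (inv_mem ⟨u, rfl⟩))
    ((levelU hS η LG0 r).carries_conj (toRat p OG u) (conj_intPt_mem hS η LG0 r u))

/-- The class `z_{G, r} ∈ M_G(U_r)`: the image of the restriction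
`z' ∈ M_{H, Iw}(Q_H⁰(ℤ_p) ∩ u U_r u⁻¹)` of `z_H` under `[u]_⋆`, i.e. under the pushforward
map to `M_G(u U_r u⁻¹)` followed by `[u]_⋆ : M_G(u U_r u⁻¹) → M_G(U_r)`. -/
def classZ {ι : OG →ₐc[ℤ_[p]] OH} (hι : Function.Surjective ι) (QH0 : ClosedSubgroup ℤ_[p] OH)
    (hS : ∀ g ∈ intPts p OG, g ∈ S) (η : OG →ₐc[ℤ_[p]] ℤ_[p][T;T⁻¹])
    (LG0 : ClosedSubgroup ℤ_[p] OG) (u : Points ℤ_[p] OG ℤ_[p])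
    {MH : CohomologyFunctor (S.comap (precomp ℚ_[p] ι)) A}
    (f : PushforwardMap (precomp ℚ_[p] ι) MH MG) (r : ℕ) :
    MH.Iw (mirabolicPtsLevel ι QH0 hS η LG0 u r) →ₗ[A] MG.obj (levelU hS η LG0 r) :=
  pushU MG hS η LG0 u r ∘ₗ
    f.toLevel (isClosedEmbedding_precomp ι hι) (levelConjU hS η LG0 u r) inf_le_right

/-- The class `ξ_{G, r} = [τʳ]_⋆ z_{G, r} ∈ M_G(V_r)`. -/
def classXi {ι : OG →ₐc[ℤ_[p]] OH} (hι : Function.Surjective ι) (QH0 : ClosedSubgroup ℤ_[p] OH)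
    (hS : ∀ g ∈ intPts p OG, g ∈ S) (η : OG →ₐc[ℤ_[p]] ℤ_[p][T;T⁻¹]) (hτ : (tau η)⁻¹ ∈ S)
    (LG0 : ClosedSubgroup ℤ_[p] OG) (u : Points ℤ_[p] OG ℤ_[p])
    {MH : CohomologyFunctor (S.comap (precomp ℚ_[p] ι)) A}
    (f : PushforwardMap (precomp ℚ_[p] ι) MH MG) (r : ℕ) :
    MH.Iw (mirabolicPtsLevel ι QH0 hS η LG0 u r) →ₗ[A] MG.obj (levelV hS η LG0 r) :=
  pushTau MG hS η hτ LG0 r ∘ₗ classZ hι QH0 hS η LG0 u f r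

end Construction

end NormRel

end

/-! Two facts carry the theorem: the norm relation pr_⋆ ξ_{r+1} = 𝒯 ξ_r, and the commutation of pr_⋆
with 𝒯. Given these, 𝒯^{-(r+1)} ⊗ ξ_{r+1} maps to 𝒯^{-(r+1)} ⊗ 𝒯 ξ_r = 𝒯^{-r} ⊗ ξ_r.

The norm relation is a base change argument. Put K = Q_H⁰(ℤ_p), W = u U_r u⁻¹, W' = u (U_r ∩ τ U_r
τ⁻¹) u⁻¹ and W'' = u U_{r+1} u⁻¹, so that W'' ⊆ W' ⊆ W. The element u τ^r carries W and W'
isomorphically to V_r and V_r ∩ τ V_r τ⁻¹, the two levels in the definition of 𝒯. By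
`prPush_push_eq_hecke_push` it is therefore enough that the class of z_H at W, pulled back to W',
equals the trace to W' of the class at W''. This is `PushforwardMap.prPull_toLevel`, and it needs
two group-theoretic facts: W = W' K, so that pullback from W to W' on G matches pullback on H; and K
∩ W' = K ∩ W'', so that W' and W'' see the same restriction of z_H.

The factorisation comes from (A). An element g of U_r reduces into Q̄_G modulo p^r, so the pair (1,
g mod p^r) solves h u q = u g modulo p^r. Smoothness of the orbit map lifts it to a solution over
ℤ_p with q in Q̄_G(ℤ_p), and such q stay integral under conjugation by powers of τ⁻¹. The equality
of intersections comes from (B): integrality of τ^{-(r+1)} g τ^{r+1} forces g modulo p^{r+1} into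
Q̄_G, and for g in u⁻¹ K u condition (B) over ℤ/p^{r+1} improves this to Q̄_G⁰.

Commutation of pr_⋆ with 𝒯 is again base change, from V_r = (V_r ∩ τ V_r τ⁻¹) V_{r+1} and V_{r+1} ∩
τ V_r τ⁻¹ ⊆ τ V_{r+1} τ⁻¹. The factorisation is of Iwahori type: an element of V_r reduces into
P_G(η) modulo p^r, hence lies in the big cell N_G(ℤ_p) Q̄_G(ℤ_p), and its N_G-factor lies in V_{r+1}
because conjugation by τ contracts N_G.

The tool for parabolic subgroups is the grading of the coordinate ring by the conjugation action of
a cocharacter λ. The groups P_G(λ), U_G(λ) and Z_G(λ) are cut out by conditions on weights, and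
conjugation by λ(p)^s multiplies weight n by p^{sn}, so integrality becomes a norm bound on each
weight. Points over ℤ_p are built by lifting from ℤ/p^n to ℤ/p^{n+1} and passing to the limit.

Restrictions of Iwasawa classes are computed on the cofinal levels K n, with n an open normal
subgroup of a fixed compact open group: there the Cartesian formula has a single summand. -/

namespace NormRel

/-! ### Indices, factorisations of groups, and base change with one double coset -/

section Cohomology

variable {G : Type*} [Group G]

/-- For `U, K ⊆ V` with `[K : U ∩ K]` finite, `[V : U] = [K : U ∩ K]` forces `V = U K`. -/
theorem exists_mul_of_relIndex_eq {U K V : Subgroup G} (hK : K ≤ V)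
    (h0 : U.relIndex K ≠ 0) (h : U.relIndex V = U.relIndex K) :
    ∀ v ∈ V, ∃ a ∈ U, ∃ b ∈ K, v = a * b := by
  intro v hv
  let φ : K ⧸ U.subgroupOf K ↪ V ⧸ U.subgroupOf V := Subgroup.quotientSubgroupOfEmbeddingOfLE U hK
  have h1 : Nat.card (V ⧸ U.subgroupOf V) = Nat.card (K ⧸ U.subgroupOf K) := h
  -- An infinite index has value 0, so without `h0` the equality of indices would say nothing.
  have hf : Finite (V ⧸ U.subgroupOf V) := Nat.finite_of_card_ne_zero (by rw [h1]; exact h0)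
  have hb : Function.Bijective φ := φ.injective.bijective_of_nat_card_le h1.le
  -- Left cosets of `U` would give V = K U; representing `v⁻¹` instead of `v` reverses the order of
  -- the factors.
  obtain ⟨q, hq⟩ := hb.2 (QuotientGroup.mk (⟨v⁻¹, inv_mem hv⟩ : V))
  obtain ⟨k, rfl⟩ := QuotientGroup.mk_surjective q
  have h2 : (QuotientGroup.mk (Subgroup.inclusion hK k) : V ⧸ U.subgroupOf V) =
      QuotientGroup.mk (⟨v⁻¹, inv_mem hv⟩ : V) := hq
  rw [QuotientGroup.eq, Subgroup.mem_subgroupOf] at h2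
  have h3 : (k : G)⁻¹ * v⁻¹ ∈ U := by simpa using h2
  exact ⟨v * k, by simpa using inv_mem h3, (k : G)⁻¹, inv_mem k.2, by simp⟩

/-- The converse passage: a factorisation V = U K makes K / (K ∩ U) → V / U surjective. It supplies
the index condition in `IsIwPull` wherever a factorisation is known. -/
theorem relIndex_eq_of_exists_mul {U K V : Subgroup G} (hK : K ≤ V)
    (h : ∀ v ∈ V, ∃ a ∈ U, ∃ b ∈ K, v = a * b) : U.relIndex V = U.relIndex K := by
  let φ : K ⧸ U.subgroupOf K ↪ V ⧸ U.subgroupOf V := Subgroup.quotientSubgroupOfEmbeddingOfLE U hK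
  refine (Nat.card_congr (Equiv.ofBijective φ ⟨φ.injective, fun q => ?_⟩)).symm
  obtain ⟨v, rfl⟩ := QuotientGroup.mk_surjective q
  obtain ⟨a, ha, b, hb, hab⟩ := h _ (inv_mem v.2)
  refine ⟨QuotientGroup.mk ⟨b⁻¹, inv_mem hb⟩, ?_⟩
  change (QuotientGroup.mk (Subgroup.inclusion hK ⟨b⁻¹, inv_mem hb⟩) : V ⧸ U.subgroupOf V) = _
  rw [QuotientGroup.eq, Subgroup.mem_subgroupOf]
  have h3 : (v : G) = b⁻¹ * a⁻¹ := by rw [← mul_inv_rev, ← hab, inv_inv]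
  simpa [h3] using ha

theorem map_conj_one_inv (U : Subgroup G) :
    U.map (MulAut.conj (1 : G)⁻¹).toMonoidHom = U := by
  ext x
  simp

theorem map_conj_one (U : Subgroup G) :
    U.map (MulAut.conj (1 : G)).toMonoidHom = U := by
  ext x
  simp

theorem mem_map_conj {U : Subgroup G} {g x : G} :
    x ∈ U.map (MulAut.conj g).toMonoidHom ↔ g⁻¹ * x * g ∈ U := by
  constructor
  · rintro ⟨y, hy, rfl⟩
    simpa [mul_assoc] using hy
  · intro hx
    exact ⟨_, hx, by simp [mul_assoc]⟩

variable [TopologicalSpace G] {S : Submonoid G}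

theorem Level.ext' {U V : Level S} (h : U.toSubgroup = V.toSubgroup) : U = V := by
  cases U; cases V; cases h; rfl

namespace CohomologyFunctor

variable {A : Type*} [CommRing A] (M : CohomologyFunctor S A)

theorem prPush_prPush {U V W : Level S} (h : U.toSubgroup ≤ V.toSubgroup)
    (h' : V.toSubgroup ≤ W.toSubgroup) (x : M.obj U) :
    M.prPush h' (M.prPush h x) = M.prPush (h.trans h') x := by
  have h'' := h.trans h'
  have h1 : (1 * 1 : G)⁻¹ ∈ S := by simp
  have h2 : Carries (1 * 1 : G) U.toSubgroup W.toSubgroup := by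
    rw [one_mul]; exact carries_one h''
  have h3 := LinearMap.congr_fun (M.push_mul (1 : G) 1 (one_inv_mem S) (one_inv_mem S) h1
    (carries_one h) (carries_one h') h2) x
  rw [M.push_coset (1 * 1) 1 h1 (one_inv_mem S) h2 (carries_one h'')
    ⟨1, one_mem _, 1, one_mem _, by simp⟩] at h3
  exact h3.symm

theorem prPull_prPull {U V W : Level S} (h : U.toSubgroup ≤ V.toSubgroup)
    (h' : V.toSubgroup ≤ W.toSubgroup) (x : M.obj W) :
    M.prPull h (M.prPull h' x) = M.prPull (h.trans h') x := by
  have h'' := h.trans h'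
  have h1 : (1 * 1 : G) ∈ S := by simp
  have h2 : Carries (1 * 1 : G) U.toSubgroup W.toSubgroup := by
    rw [one_mul]; exact carries_one h''
  have h3 := LinearMap.congr_fun (M.pull_mul (1 : G) 1 S.one_mem S.one_mem h1
    (carries_one h) (carries_one h') h2) x
  rw [M.pull_coset (1 * 1) 1 h1 S.one_mem h2 (carries_one h'')
    ⟨1, one_mem _, 1, one_mem _, by simp⟩] at h3
  exact h3.symm

/-- Composition of pushforwards, with a free choice of the representative of the composite. -/
theorem push_push {U V W : Level S} {g h k : G} (hk : g * h = k) (hg : g⁻¹ ∈ S) (hh : h⁻¹ ∈ S)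
    (hks : k⁻¹ ∈ S) (hUV : Carries g U.toSubgroup V.toSubgroup)
    (hVW : Carries h V.toSubgroup W.toSubgroup) (hUW : Carries k U.toSubgroup W.toSubgroup)
    (x : M.obj U) : M.push h hh hVW (M.push g hg hUV x) = M.push k hks hUW x := by
  subst hk
  exact (LinearMap.congr_fun (M.push_mul g h hg hh hks hUV hVW hUW) x).symm

theorem pull_pull {U V W : Level S} {g h k : G} (hk : g * h = k) (hg : g ∈ S) (hh : h ∈ S)
    (hks : k ∈ S) (hUV : Carries g U.toSubgroup V.toSubgroup)
    (hVW : Carries h V.toSubgroup W.toSubgroup) (hUW : Carries k U.toSubgroup W.toSubgroup)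
    (x : M.obj W) : M.pull g hg hUV (M.pull h hh hVW x) = M.pull k hks hUW x := by
  subst hk
  exact (LinearMap.congr_fun (M.pull_mul g h hg hh hks hUV hVW hUW) x).symm

/-- Base change in a Cartesian square: if `V = U U'`, then the Cartesian formula has a single
summand. -/
theorem IsCartesian.prPull_prPush [IsTopologicalGroup G] {M : CohomologyFunctor S A}
    (hM : M.IsCartesian) {U U' V W : Level S}
    (hU : U.toSubgroup ≤ V.toSubgroup) (hU' : U'.toSubgroup ≤ V.toSubgroup)
    (hWU : W.toSubgroup ≤ U.toSubgroup) (hWU' : W.toSubgroup ≤ U'.toSubgroup)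
    (hW : ∀ x ∈ U.toSubgroup, x ∈ U'.toSubgroup → x ∈ W.toSubgroup)
    (hV : ∀ v ∈ V.toSubgroup, ∃ a ∈ U.toSubgroup, ∃ b ∈ U'.toSubgroup, v = a * b)
    (x : M.obj U') :
    M.prPull hU (M.prPush hU' x) = M.prPush hWU (M.prPull hWU' x) := by
  -- `W` is an arbitrary presentation of U ∩ U', so it is first identified with the level of the
  -- summand γ = 1.
  have hWe : W = U.interConj U' 1 := by
    refine Level.ext' (le_antisymm (le_inf hWU ?_) ?_)
    · rw [map_conj_one]; exact hWU'
    · rintro y ⟨hy, hy'⟩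
      rw [map_conj_one] at hy'
      exact hW y hy hy'
  subst hWe
  have hR : ∀ γ ∈ ({1} : Finset G), γ ∈ V.toSubgroup := by simp
  have h := hM U U' V hU hU' {1} hR (fun v hv => by
    obtain ⟨a, ha, b, hb, rfl⟩ := hV v hv
    refine ⟨1, ⟨by simp, a, ha, b, hb, by simp⟩, ?_⟩
    rintro γ ⟨hγ, -⟩
    simpa using hγ) x
  rw [h]
  rw [Fintype.sum_unique]
  rfl

theorem Iw.prPush_eq {K : Subgroup G} (z : M.Iw K) {U V : Level S} (hU : K ≤ U.toSubgroup)
    (h : U.toSubgroup ≤ V.toSubgroup) :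
    M.prPush h (M.iwProj U hU z) = M.iwProj V (hU.trans h) z :=
  z.2 ⟨U, hU⟩ ⟨V, hU.trans h⟩ h

end CohomologyFunctor

/-! ### Cofinal levels `K n`, with `n` open and normalised by `Γ` -/

/-- An open subgroup of a level `Γ` that is normalised by `Γ`. -/
structure OpenNormal (Γ : Level S) where
  toSubgroup : Subgroup G
  le : toSubgroup ≤ Γ.toSubgroup
  isOpen : IsOpen (toSubgroup : Set G)
  normal : ∀ g ∈ Γ.toSubgroup, ∀ x ∈ toSubgroup, g * x * g⁻¹ ∈ toSubgroup

/-- An open subgroup of a compact group has finite index, so its normal core is a closed subgroup of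
finite index, hence open. -/
theorem OpenNormal.exists_le [IsTopologicalGroup G] (Γ : Level S) {W : Subgroup G}
    (hW : IsOpen (W : Set G)) : ∃ n : OpenNormal Γ, n.toSubgroup ≤ W := by
  have hc : CompactSpace Γ.toSubgroup := isCompact_iff_compactSpace.1 Γ.isCompact
  let X : Subgroup Γ.toSubgroup := W.subgroupOf Γ.toSubgroup
  have hX : IsOpen (X : Set Γ.toSubgroup) := hW.preimage continuous_subtype_val
  have : X.FiniteIndex := by
    have := X.quotient_finite_of_isOpen hX
    exact Subgroup.finiteIndex_of_finite_quotient
  have hN : IsOpen (X.normalCore : Set Γ.toSubgroup) :=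
    Subgroup.isOpen_of_isClosed_of_finiteIndex _
      (X.normalCore_isClosed (Subgroup.isClosed_of_isOpen X hX))
  refine ⟨⟨X.normalCore.map Γ.toSubgroup.subtype, ?_, ?_, ?_⟩, ?_⟩
  · rintro _ ⟨x, -, rfl⟩
    exact x.2
  · rw [Subgroup.coe_map]
    exact Γ.isOpen.isOpenMap_subtype_val _ hN
  · rintro g hg _ ⟨x, hx, rfl⟩
    exact ⟨_, X.normalCore_normal.conj_mem x hx ⟨g, hg⟩, rfl⟩
  · rintro _ ⟨x, hx, rfl⟩
    exact X.normalCore_le hx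

namespace OpenNormal

variable [IsTopologicalGroup G] {Γ : Level S} (n : OpenNormal Γ)

/-- The level `K n`, for a subgroup `K` of `Γ`. -/
def mulLevel (K : Subgroup G) (hK : K ≤ Γ.toSubgroup) : Level S :=
  have hle : ∀ x, (∃ k ∈ K, ∃ y ∈ n.toSubgroup, x = k * y) → x ∈ Γ.toSubgroup := by
    rintro _ ⟨k, hk, y, hy, rfl⟩
    exact mul_mem (hK hk) (n.le hy)
  let P : Subgroup G :=
    { carrier := {x | ∃ k ∈ K, ∃ y ∈ n.toSubgroup, x = k * y}
      one_mem' := ⟨1, one_mem _, 1, one_mem _, by simp⟩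
      mul_mem' := by
        rintro _ _ ⟨k, hk, y, hy, rfl⟩ ⟨l, hl, w, hw, rfl⟩
        refine ⟨k * l, mul_mem hk hl, l⁻¹ * y * l * w, mul_mem ?_ hw, by group⟩
        simpa using n.normal l⁻¹ (inv_mem (hK hl)) y hy
      inv_mem' := by
        rintro _ ⟨k, hk, y, hy, rfl⟩
        exact ⟨k⁻¹, inv_mem hk, k * y⁻¹ * k⁻¹, n.normal k (hK hk) _ (inv_mem hy), by group⟩ }
  have hP : IsOpen (P : Set G) := Subgroup.isOpen_mono (H₁ := n.toSubgroup)
    (fun y hy => ⟨1, one_mem _, y, hy, by simp⟩) n.isOpen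
  { toSubgroup := P
    isOpen := hP
    isCompact := Γ.isCompact.of_isClosed_subset (Subgroup.isClosed_of_isOpen P hP) hle
    le := fun x hx => Γ.le x (hle x hx) }

variable {K K' : Subgroup G} (hK : K ≤ Γ.toSubgroup) (hK' : K' ≤ Γ.toSubgroup)

theorem le_mulLevel : K ≤ (n.mulLevel K hK).toSubgroup :=
  fun k hk => ⟨k, hk, 1, one_mem _, by simp⟩

theorem mulLevel_le {U : Subgroup G} (h : K ≤ U) (hn : n.toSubgroup ≤ U) :
    (n.mulLevel K hK).toSubgroup ≤ U := by
  rintro _ ⟨k, hk, y, hy, rfl⟩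
  exact mul_mem (h hk) (hn hy)

theorem mulLevel_mono {m n : OpenNormal Γ} (h : K' ≤ K) (hmn : m.toSubgroup ≤ n.toSubgroup) :
    (m.mulLevel K' hK').toSubgroup ≤ (n.mulLevel K hK).toSubgroup := by
  rintro _ ⟨k, hk, y, hy, rfl⟩
  exact ⟨k, h hk, y, hmn hy, rfl⟩

end OpenNormal

/-! ### Pullback on Iwasawa completions -/

namespace CohomologyFunctor

variable [IsTopologicalGroup G] {A : Type*} [CommRing A] {M : CohomologyFunctor S A}
  {Γ : Level S} {K K' : Subgroup G}

/-- The pullback `M_Iw(K) → M(K' n)`, through `M(K n)`. -/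
noncomputable def iwPullAt (M : CohomologyFunctor S A) (hK : K ≤ Γ.toSubgroup) (hK' : K' ≤ K)
    (n : OpenNormal Γ) :
    M.Iw K →ₗ[A] M.obj (n.mulLevel K' (hK'.trans hK)) :=
  M.prPull (OpenNormal.mulLevel_mono hK (hK'.trans hK) hK' le_rfl) ∘ₗ
    M.iwProj (n.mulLevel K hK) (n.le_mulLevel hK)

/-- The component at `U` is the trace of the component at K n, and base change applies: U = U' · K n
by `hm`, while U' ∩ K n = K' n by `hi` and n ⊆ U'. So pullback at any admissible pair of levels is
computed by `iwPullAt`. -/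
theorem IsCartesian.prPull_iwProj (hM : M.IsCartesian) (hK : K ≤ Γ.toSubgroup) (hK' : K' ≤ K)
    {U U' : Level S} (hKU : K ≤ U.toSubgroup) (hKU' : K' ≤ U'.toSubgroup)
    (h : U'.toSubgroup ≤ U.toSubgroup) (hi : ∀ x ∈ K, x ∈ U'.toSubgroup → x ∈ K')
    (hm : ∀ u ∈ U.toSubgroup, ∃ a ∈ U'.toSubgroup, ∃ b ∈ K, u = a * b)
    (n : OpenNormal Γ) (hn : n.toSubgroup ≤ U'.toSubgroup) (z : M.Iw K) :
    M.prPull h (M.iwProj U hKU z) =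
      M.prPush (n.mulLevel_le (hK'.trans hK) hKU' hn) (M.iwPullAt hK hK' n z) := by
  rw [← Iw.prPush_eq M z (n.le_mulLevel hK) (n.mulLevel_le hK hKU (hn.trans h))]
  refine hM.prPull_prPush h _ _ _ ?_ ?_ _
  · rintro x hx ⟨k, hk, y, hy, rfl⟩
    refine ⟨k, hi k hk ?_, y, hy, rfl⟩
    simpa using mul_mem hx (inv_mem (hn hy))
  · intro v hv
    obtain ⟨a, ha, b, hb, rfl⟩ := hm v hv
    exact ⟨a, ha, b, n.le_mulLevel hK hb, rfl⟩

/-- The case U = K n, U' = K' n of the preceding lemma; the factorisation k y = (k y k⁻¹) k uses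
that `n` is normalised by K. It makes the definition of the pullback independent of the auxiliary
subgroup. -/
theorem IsCartesian.prPush_iwPullAt (hM : M.IsCartesian) (hK : K ≤ Γ.toSubgroup) (hK' : K' ≤ K)
    {m n : OpenNormal Γ} (hmn : m.toSubgroup ≤ n.toSubgroup)
    (hi : ∀ x ∈ K, x ∈ n.toSubgroup → x ∈ K') (z : M.Iw K) :
    M.prPush (OpenNormal.mulLevel_mono (hK'.trans hK) (hK'.trans hK) le_rfl hmn)
      (M.iwPullAt hK hK' m z) = M.iwPullAt hK hK' n z := by
  refine (hM.prPull_iwProj hK hK' (n.le_mulLevel hK) (n.le_mulLevel (hK'.trans hK))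
    (OpenNormal.mulLevel_mono hK (hK'.trans hK) hK' le_rfl) ?_ ?_ m ?_ z).symm
  · rintro x hx ⟨k, hk, y, hy, rfl⟩
    refine mul_mem hk (hi y ?_ hy)
    simpa using mul_mem (inv_mem (hK' hk)) hx
  · rintro _ ⟨k, hk, y, hy, rfl⟩
    refine ⟨k * y * k⁻¹, ?_, k, hk, by group⟩
    exact ⟨1, one_mem _, _, n.normal k (hK hk) y hy, by simp⟩
  · exact hmn.trans fun y hy => ⟨1, one_mem _, y, hy, by simp⟩

section

variable (M Γ) (hM : M.IsCartesian) (hK : K ≤ Γ.toSubgroup) {W : Subgroup G}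
  (hW : IsOpen (W : Set G))

theorem exists_openNormal_le_inf (Γ : Level S) {W U : Subgroup G} (hW : IsOpen (W : Set G))
    (hU : IsOpen (U : Set G)) :
    ∃ n : OpenNormal Γ, n.toSubgroup ≤ W ∧ n.toSubgroup ≤ U := by
  obtain ⟨n, hn⟩ := OpenNormal.exists_le Γ (W := W ⊓ U)
    (by rw [Subgroup.coe_inf]; exact hW.inter hU)
  exact ⟨n, hn.trans inf_le_left, hn.trans inf_le_right⟩

/-- The pullback `M_Iw(K) → M_Iw(K ∩ W)`, for an open subgroup `W`. -/
noncomputable def iwPull : M.Iw K →ₗ[A] M.Iw (K ⊓ W) :=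
  LinearMap.codRestrict _ (LinearMap.pi fun U =>
      M.prPush (OpenNormal.mulLevel_le _ (inf_le_left.trans hK) U.2
        (exists_openNormal_le_inf Γ hW U.1.isOpen).choose_spec.2) ∘ₗ
      M.iwPullAt hK inf_le_left (exists_openNormal_le_inf Γ hW U.1.isOpen).choose) (by
    intro z U V h
    -- The subgroups chosen for `U` and `V` are unrelated; both are compared with a common
    -- refinement.
    obtain ⟨n, hn⟩ := OpenNormal.exists_le Γ
      (W := (exists_openNormal_le_inf Γ hW U.1.isOpen).choose.toSubgroup ⊓
        (exists_openNormal_le_inf Γ hW V.1.isOpen).choose.toSubgroup)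
      (by rw [Subgroup.coe_inf]; exact (OpenNormal.isOpen _).inter (OpenNormal.isOpen _))
    simp only [LinearMap.pi_apply, LinearMap.comp_apply]
    rw [← hM.prPush_iwPullAt hK inf_le_left (hn.trans inf_le_left)
        fun x hx hx' => ⟨hx, (exists_openNormal_le_inf Γ hW U.1.isOpen).choose_spec.1 hx'⟩,
      ← hM.prPush_iwPullAt hK inf_le_left (hn.trans inf_le_right)
        fun x hx hx' => ⟨hx, (exists_openNormal_le_inf Γ hW V.1.isOpen).choose_spec.1 hx'⟩,
      prPush_prPush, prPush_prPush, prPush_prPush])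

/-- Frees `iwPull` from the choice in its definition: every `n` inside `W` and `U` computes the
component at `U`. -/
theorem iwProj_iwPull (U : Level S) (hU : K ⊓ W ≤ U.toSubgroup) (n : OpenNormal Γ)
    (hnW : n.toSubgroup ≤ W) (hnU : n.toSubgroup ≤ U.toSubgroup) (z : M.Iw K) :
    M.iwProj U hU (M.iwPull Γ hM hK hW z) =
      M.prPush (n.mulLevel_le (inf_le_left.trans hK) hU hnU) (M.iwPullAt hK inf_le_left n z) := by
  obtain ⟨m, hm⟩ := OpenNormal.exists_le Γ
      (W := (exists_openNormal_le_inf Γ hW U.isOpen).choose.toSubgroup ⊓ n.toSubgroup)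
      (by rw [Subgroup.coe_inf]; exact (OpenNormal.isOpen _).inter (OpenNormal.isOpen _))
  change M.prPush _ (M.iwPullAt hK inf_le_left
    (exists_openNormal_le_inf Γ hW U.isOpen).choose z) = _
  rw [← hM.prPush_iwPullAt hK inf_le_left (hm.trans inf_le_left)
        fun x hx hx' => ⟨hx, (exists_openNormal_le_inf Γ hW U.isOpen).choose_spec.1 hx'⟩,
      ← hM.prPush_iwPullAt hK inf_le_left (hm.trans inf_le_right)
        fun x hx hx' => ⟨hx, hnW hx'⟩,
      prPush_prPush, prPush_prPush]

/-- The pairs (K n, (K ∩ W) n) are admissible in `IsIwPull` and their second members are cofinal,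
which forces z'. Conversely, at an admissible pair the equality of finite indices gives U = U' K,
and the Cartesian property applies. -/
theorem isIwPull_one_iff (hKc : W.relIndex K ≠ 0) (z : M.Iw K) (z' : M.Iw (K ⊓ W)) :
    M.IsIwPull 1 S.one_mem z z' ↔ z' = M.iwPull Γ hM hK hW z := by
  have hc : W.relIndex K = (K ⊓ W).relIndex K := by
    rw [inf_comm, Subgroup.inf_relIndex_right]
  constructor
  · intro h
    refine Subtype.ext (funext fun U => ?_)
    obtain ⟨n, hnW, hnU⟩ := exists_openNormal_le_inf Γ hW U.1.isOpen
    have hK' : K ⊓ W ≤ Γ.toSubgroup := inf_le_left.trans hK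
    have hi : (n.mulLevel (K ⊓ W) hK').toSubgroup ⊓ K = K ⊓ W := by
      refine le_antisymm ?_ (le_inf (n.le_mulLevel hK') inf_le_left)
      rintro x ⟨⟨k, hk, y, hy, rfl⟩, hx⟩
      exact ⟨hx, mul_mem hk.2 (hnW hy)⟩
    have h1 := h (n.mulLevel K hK) (n.mulLevel (K ⊓ W) hK') (n.le_mulLevel hK)
      (n.le_mulLevel hK') (carries_one (OpenNormal.mulLevel_mono hK hK' inf_le_left le_rfl))
      (by rw [map_conj_one_inv, map_conj_one_inv, hi]) (by
        rw [map_conj_one_inv, map_conj_one_inv, relIndex_eq_of_exists_mul (n.le_mulLevel hK)]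
        · rw [← Subgroup.inf_relIndex_right, hi]
        · rintro _ ⟨k, hk, y, hy, rfl⟩
          refine ⟨k * y * k⁻¹, ?_, k, hk, by group⟩
          exact ⟨1, one_mem _, _, n.normal k (hK hk) y hy, by simp⟩)
    change M.iwProj U.1 U.2 z' = M.iwProj U.1 U.2 (M.iwPull Γ hM hK hW z)
    rw [iwProj_iwPull M Γ hM hK hW U.1 U.2 n hnW hnU,
      ← Iw.prPush_eq M z' (n.le_mulLevel hK') (n.mulLevel_le hK' U.2 hnU), h1]
    rfl
  · rintro rfl U U' hU hU' h h1 h2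
    rw [map_conj_one_inv, map_conj_one_inv] at h1 h2
    have hle : U'.toSubgroup ≤ U.toSubgroup := fun x hx => by simpa using h x hx
    obtain ⟨n, hnW, hnU⟩ := exists_openNormal_le_inf Γ hW U'.isOpen
    rw [iwProj_iwPull M Γ hM hK hW U' hU' n hnW hnU]
    refine (hM.prPull_iwProj hK inf_le_left hU hU' hle ?_ ?_ n hnU z).symm
    · intro x hx hx'
      rw [← h1]
      exact ⟨hx', hx⟩
    · have h3 : U'.toSubgroup.relIndex K = (K ⊓ W).relIndex K := by
        rw [← Subgroup.inf_relIndex_right, h1]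
      refine exists_mul_of_relIndex_eq hU ?_ ?_
      · rw [h3, ← hc]; exact hKc
      · rw [h3]; exact h2

/-- The restriction to `K ∩ W₂` is, at suitable levels, the pullback of the restriction to
`K ∩ W₁`. -/
theorem prPull_iwPull {W₁ W₂ : Subgroup G} (hW₁ : IsOpen (W₁ : Set G)) (hW₂ : IsOpen (W₂ : Set G))
    {X X' : Level S} (h : X'.toSubgroup ≤ X.toSubgroup) (hX : K ⊓ W₁ ≤ X.toSubgroup)
    (hX' : K ⊓ W₂ ≤ X'.toSubgroup) (h21 : K ⊓ W₂ ≤ K ⊓ W₁)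
    (hi : ∀ x ∈ K ⊓ W₁, x ∈ X'.toSubgroup → x ∈ K ⊓ W₂)
    (hm : ∀ u ∈ X.toSubgroup, ∃ a ∈ X'.toSubgroup, ∃ b ∈ K ⊓ W₁, u = a * b) (z : M.Iw K) :
    M.prPull h (M.iwProj X hX (M.iwPull Γ hM hK hW₁ z)) =
      M.iwProj X' hX' (M.iwPull Γ hM hK hW₂ z) := by
  obtain ⟨n, hn, hnX⟩ := exists_openNormal_le_inf Γ (W := W₁ ⊓ W₂)
    (by rw [Subgroup.coe_inf]; exact hW₁.inter hW₂) X'.isOpen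
  have hK1 : K ⊓ W₁ ≤ Γ.toSubgroup := inf_le_left.trans hK
  have hK2 : K ⊓ W₂ ≤ Γ.toSubgroup := inf_le_left.trans hK
  rw [iwProj_iwPull M Γ hM hK hW₁ X hX n (hn.trans inf_le_left) (hnX.trans h),
    iwProj_iwPull M Γ hM hK hW₂ X' hX' n (hn.trans inf_le_right) hnX]
  -- Base change for X = X' · (K ∩ W₁) n, where X' ∩ (K ∩ W₁) n = (K ∩ W₂) n because n ⊆ X'.
  rw [hM.prPull_prPush (W := n.mulLevel _ hK2) h _ (n.mulLevel_le hK2 hX' hnX)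
    (OpenNormal.mulLevel_mono hK1 hK2 h21 le_rfl)]
  · congr 1
    exact prPull_prPull M _ _ _
  · rintro x hx ⟨k, hk, y, hy, rfl⟩
    refine ⟨k, hi k hk ?_, y, hy, rfl⟩
    simpa using mul_mem hx (inv_mem (hnX hy))
  · intro v hv
    obtain ⟨a, ha, b, hb, rfl⟩ := hm v hv
    exact ⟨a, ha, b, n.le_mulLevel hK1 hb, rfl⟩

end

end CohomologyFunctor

end Cohomology

/-! ### Finite-slope parts and the map to their limit -/

section FiniteSlope

variable {A : Type*} [CommRing A] {M N : Type*} [AddCommGroup M] [Module A M]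
  [AddCommGroup N] [Module A N]

theorem FiniteSlope.tmul_add (T : Module.End A M) (n : ℤ) (m m' : M) :
    FiniteSlope.tmul T n (m + m') = FiniteSlope.tmul T n m + FiniteSlope.tmul T n m' := by
  simp [FiniteSlope.tmul, TensorProduct.tmul_add]

theorem FiniteSlope.tmul_smul (T : Module.End A M) (n : ℤ) (a : A) (m : M) :
    FiniteSlope.tmul T n (a • m) = a • FiniteSlope.tmul T n m := by
  have h : Module.AEval'.of T (a • m) = (Polynomial.C a : A[X]) • Module.AEval'.of T m := by
    rw [Module.AEval.C_smul, map_smul]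
  rw [FiniteSlope.tmul, FiniteSlope.tmul, h, ← TensorProduct.smul_tmul, TensorProduct.smul_tmul']
  congr 1
  rw [Algebra.smul_def, Algebra.smul_def]
  congr 1
  change Polynomial.toLaurent (Polynomial.C a) = _
  rw [Polynomial.toLaurent_C]
  rfl

/-- `X` acts on the module as the operator and on Laurent polynomials as multiplication by `T`, so
it can be moved across the tensor product. -/
theorem FiniteSlope.tmul_apply (T : Module.End A M) (n : ℤ) (m : M) :
    FiniteSlope.tmul T n (T m) = FiniteSlope.tmul T (n + 1) m := by
  have h : Module.AEval'.of T (T m) = (Polynomial.X : A[X]) • Module.AEval'.of T m :=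
    (Module.AEval'.X_smul_of T m).symm
  rw [FiniteSlope.tmul, FiniteSlope.tmul, h, ← TensorProduct.smul_tmul]
  congr 1
  rw [Algebra.smul_def, LaurentPolynomial.T_add, mul_comm]
  congr 1
  exact Polynomial.toLaurent_X

theorem FiniteSlope.map_tmul {T : Module.End A M} {T' : Module.End A N} (f : M →ₗ[A] N)
    (hf : ∀ m, f (T m) = T' (f m)) (n : ℤ) (m : M) :
    FiniteSlope.map f hf (FiniteSlope.tmul T n m) = FiniteSlope.tmul T' n (f m) := by
  simp only [FiniteSlope.map, FiniteSlope.tmul, LinearMap.baseChange_tmul]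
  rfl

/-- A system of maps `ξ_r` with `pr ξ_{r+1} = 𝒯 ξ_r` gives a map to the limit of the finite-slope
parts. -/
noncomputable def fsLimitLift {Z : Type*} [AddCommGroup Z] [Module A Z]
    {M : ℕ+ → Type*} [∀ r, AddCommGroup (M r)] [∀ r, Module A (M r)]
    (T : ∀ r, Module.End A (M r)) (f : ∀ r, M (r + 1) →ₗ[A] M r)
    (hf : ∀ r m, f r (T (r + 1) m) = T r (f r m)) (ξ : ∀ r, Z →ₗ[A] M r)
    (hξ : ∀ r z, f r (ξ (r + 1) z) = T r (ξ r z)) : Z →ₗ[A] fsLimit T f hf where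
  toFun z := ⟨fun r => FiniteSlope.tmul (T r) (-(r : ℤ)) (ξ r z), fun r => by
    -- The operator produced by `hξ` raises the exponent -(r+1) to -r.
    rw [FiniteSlope.map_tmul, hξ, FiniteSlope.tmul_apply]
    congr 1
    push_cast
    ring⟩
  map_add' x y := by
    ext r
    exact (congrArg _ (map_add (ξ r) x y)).trans (FiniteSlope.tmul_add _ _ _ _)
  map_smul' a x := by
    ext r
    exact (congrArg _ (map_smul (ξ r) a x)).trans (FiniteSlope.tmul_smul _ _ _ _)

end FiniteSlope

end NormRel

namespace NormRel

/-! ### The weight grading of the coordinate ring defined by a cocharacter -/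

section Weights

variable {k O : Type} [CommRing k] [CommRing O] [HopfAlgebra k O]

theorem one_apply {R : Type} [CommRing R] [Algebra k R] (a : O) :
    (1 : Points k O R).ofConv a = algebraMap k R (Coalgebra.counit a) := rfl

theorem mapPts_apply {R R' : Type} [CommRing R] [Algebra k R] [CommRing R'] [Algebra k R']
    (f : R →ₐ[k] R') (g : Points k O R) (a : O) : (mapPts O f g).ofConv a = f (g.ofConv a) := rfl

theorem mapPts_mapPts {R R' R'' : Type} [CommRing R] [Algebra k R] [CommRing R'] [Algebra k R']
    [CommRing R''] [Algebra k R''] (f : R →ₐ[k] R') (f' : R' →ₐ[k] R'') (g : Points k O R) :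
    mapPts O f' (mapPts O f g) = mapPts O (f'.comp f) g := rfl

theorem mapPts_id {R : Type} [CommRing R] [Algebra k R] (g : Points k O R) :
    mapPts O (AlgHom.id k R) g = g := rfl

/-- `lam` is a homomorphism from the multiplicative group. -/
def IsCocharacter (lam : Points k O k[T;T⁻¹]) : Prop :=
  ∀ (R : Type) [CommRing R] [Algebra k R] (s t : Rˣ),
    loopAt lam (s * t) = loopAt lam s * loopAt lam t

/-- The evaluation `R[T, T⁻¹] → R'`, `T ↦ t`, along a homomorphism `R → R'`. -/
noncomputable def evalLaurent {R R' : Type} [CommRing R] [Algebra k R] [CommRing R'] [Algebra k R']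
    (f : R →ₐ[k] R') (t : R'ˣ) : R[T;T⁻¹] →ₐ[k] R' :=
  { LaurentPolynomial.eval₂ (f : R →+* R') t with
    commutes' := fun c => by
      change LaurentPolynomial.eval₂ (f : R →+* R') t (algebraMap k R[T;T⁻¹] c) = _
      rw [LaurentPolynomial.algebraMap_apply, LaurentPolynomial.eval₂_C]
      exact f.commutes c }

theorem evalLaurent_C_mul_T {R R' : Type} [CommRing R] [Algebra k R] [CommRing R'] [Algebra k R']
    (f : R →ₐ[k] R') (t : R'ˣ) (r : R) (n : ℤ) :
    evalLaurent f t (LaurentPolynomial.C r * LaurentPolynomial.T n) = f r * (t ^ n : R'ˣ) :=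
  LaurentPolynomial.eval₂_C_mul_T _ _ _ _

theorem evalLaurent_T {R R' : Type} [CommRing R] [Algebra k R] [CommRing R'] [Algebra k R']
    (f : R →ₐ[k] R') (t : R'ˣ) (n : ℤ) :
    evalLaurent f t (LaurentPolynomial.T n) = (t ^ n : R'ˣ) :=
  LaurentPolynomial.eval₂_T _ _ _

theorem constLaurent_apply {R : Type} [CommRing R] [Algebra k R] (r : R) :
    constLaurent k R r = LaurentPolynomial.C r := rfl

theorem evalLaurent_comp_constLaurent {R R' : Type} [CommRing R] [Algebra k R] [CommRing R']
    [Algebra k R'] (f : R →ₐ[k] R') (t : R'ˣ) :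
    (evalLaurent f t).comp (constLaurent k R) = f :=
  AlgHom.ext fun r => LaurentPolynomial.eval₂_C (f : R →+* R') t r

theorem val_unitOfInvertible_T_zpow {R : Type} [CommRing R] (n : ℤ) :
    ((unitOfInvertible (LaurentPolynomial.T 1 : R[T;T⁻¹]) ^ n : R[T;T⁻¹]ˣ) : R[T;T⁻¹]) =
      LaurentPolynomial.T n := by
  cases n with
  | ofNat n =>
    rw [Int.ofNat_eq_natCast, zpow_natCast, Units.val_pow_eq_pow_val, val_unitOfInvertible,
      LaurentPolynomial.T_pow, mul_one]
  | negSucc n =>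
    rw [zpow_negSucc, ← inv_pow, Units.val_pow_eq_pow_val, val_inv_unitOfInvertible,
      LaurentPolynomial.invOf_T, LaurentPolynomial.T_pow]
    congr 1
    rw [Int.negSucc_eq]
    push_cast
    ring

theorem val_mul_zpow {R : Type} [CommRing R] (s t : Rˣ) (n : ℤ) :
    (((s * t) ^ n : Rˣ) : R) = (s ^ n : Rˣ) * (t ^ n : Rˣ) := by
  rw [mul_zpow, Units.val_mul]

/-- Both sides are images under η of points of 𝔾ₘ. There the claim holds because `T` is group-like:
the product of the points T ↦ s and T ↦ t is T ↦ st. -/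
theorem isCocharacter_loopOf (η : O →ₐc[k] k[T;T⁻¹]) : IsCocharacter (loopOf η) := by
  intro R _ _ s t
  have key : ∀ t : Rˣ, loopAt (loopOf η) t =
      precomp R η (WithConv.toConv (evalLaurent (Algebra.ofId k R) t)) := fun t => rfl
  rw [key, key, key, ← map_mul]
  congr 1
  apply WithConv.ext
  refine AlgHom.ext fun x => ?_
  refine (?_ : evalLaurent (Algebra.ofId k R) (s * t) x = _)
  induction x using LaurentPolynomial.induction_on' with
  | add p q hp hq =>
    rw [map_add, hp, hq]
    exact (map_add _ p q).symm
  | C_mul_T n c =>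
    rw [evalLaurent_C_mul_T, AlgHom.convMul_apply, ← LaurentPolynomial.single_eq_C_mul_T]
    simp [evalLaurent_C_mul_T, evalLaurent_T, mul_zpow, mul_left_comm]

theorem IsCocharacter.inv {lam : Points k O k[T;T⁻¹]} (h : IsCocharacter lam) :
    IsCocharacter lam⁻¹ := by
  intro R _ _ s t
  have key : ∀ t : Rˣ, loopAt lam⁻¹ t = (loopAt lam t)⁻¹ := fun t => map_inv (mapPts O _) lam
  rw [key, key, key, mul_comm s t, h, mul_inv_rev]

theorem loopAt_inv_left (lam : Points k O k[T;T⁻¹]) {R : Type} [CommRing R] [Algebra k R]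
    (t : Rˣ) : loopAt lam⁻¹ t = (loopAt lam t)⁻¹ := map_inv (mapPts O _) lam

theorem IsCocharacter.loopAt_one {lam : Points k O k[T;T⁻¹]} (h : IsCocharacter lam)
    {R : Type} [CommRing R] [Algebra k R] : loopAt lam (1 : Rˣ) = 1 := by
  have := h R 1 1
  rw [mul_one] at this
  exact left_eq_mul.1 this

theorem IsCocharacter.loopAt_inv {lam : Points k O k[T;T⁻¹]} (h : IsCocharacter lam)
    {R : Type} [CommRing R] [Algebra k R] (t : Rˣ) : loopAt lam t⁻¹ = (loopAt lam t)⁻¹ := by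
  have := h R t⁻¹ t
  rw [inv_mul_cancel, h.loopAt_one] at this
  exact eq_inv_of_mul_eq_one_left this.symm

theorem IsCocharacter.loopAt_pow {lam : Points k O k[T;T⁻¹]} (h : IsCocharacter lam)
    {R : Type} [CommRing R] [Algebra k R] (t : Rˣ) (n : ℕ) :
    loopAt lam (t ^ n) = loopAt lam t ^ n := by
  induction n with
  | zero => simp [h.loopAt_one]
  | succ n ih => rw [pow_succ, pow_succ, h, ih]

variable (lam : Points k O k[T;T⁻¹])

/-- Substituting t for the variable specialises the generic conjugation to conjugation by λ(t);
actual conjugates can thus be read off from Laurent coefficients. -/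
theorem mapPts_evalLaurent_conjLoop {R R' : Type} [CommRing R] [Algebra k R] [CommRing R']
    [Algebra k R'] (f : R →ₐ[k] R') (t : R'ˣ) (g : Points k O R) :
    mapPts O (evalLaurent f t) (conjLoop lam R g) =
      loopAt lam t * mapPts O f g * (loopAt lam t)⁻¹ := by
  have h1 : mapPts O (evalLaurent f t)
      (loopAt lam (unitOfInvertible (LaurentPolynomial.T 1 : R[T;T⁻¹]))) = loopAt lam t := by
    rw [loopAt_map]
    congr 1
    ext1
    change LaurentPolynomial.eval₂ (f : R →+* R') t (LaurentPolynomial.T 1) = _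
    rw [LaurentPolynomial.eval₂_T, zpow_one]
  have h2 : mapPts O (evalLaurent f t) (mapPts O (constLaurent k R) g) = mapPts O f g := by
    rw [mapPts_mapPts, evalLaurent_comp_constLaurent]
  simp only [conjLoop, MonoidHom.comp_apply, MulEquiv.toMonoidHom_eq_coe, MonoidHom.coe_coe,
      MulAut.conj_apply, map_mul, map_inv, h1, h2]

/-- The component of weight `n` of a function for the conjugation action through `lam`. -/
noncomputable def wt (n : ℤ) (a : O) : O := ((conjLoop lam O (univPt O)).ofConv a).coeff n

theorem coeff_conjLoop {R : Type} [CommRing R] [Algebra k R] (g : Points k O R) (a : O) (n : ℤ) :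
    ((conjLoop lam R g).ofConv a).coeff n = g.ofConv (wt lam n a) := by
  rw [conjLoop_apply, AddMonoidAlgebra.coeff_mapAlgHom]
  rfl

theorem coeff_C_mul_T {R : Type} [CommRing R] (r : R) (m n : ℤ) :
    (LaurentPolynomial.C r * LaurentPolynomial.T m : R[T;T⁻¹]).coeff n = if n = m then r else 0 := by
  rw [← LaurentPolynomial.single_eq_C_mul_T, AddMonoidAlgebra.coeff_single, Finsupp.single_apply]
  simp [eq_comm]

variable {lam}

/-- Conjugating by λ(T) and then by λ(S) is conjugating by λ(ST). Comparing coefficients of S^m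
shows that a weight component is itself homogeneous, so the components form a grading. -/
theorem IsCocharacter.conjLoop_univPt_wt (h : IsCocharacter lam) (m : ℤ) (a : O) :
    (conjLoop lam O (univPt O)).ofConv (wt lam m a) =
      LaurentPolynomial.C (wt lam m a) * LaurentPolynomial.T m := by
  set c := conjLoop lam O (univPt O) with hc
  -- Two independent variables: `T'` comes from the coefficient ring `B`, and `S` is the new
  -- variable over it.
  let B := O[T;T⁻¹]
  let S : B[T;T⁻¹]ˣ := unitOfInvertible (LaurentPolynomial.T 1 : B[T;T⁻¹])
  let T' : B[T;T⁻¹]ˣ := Units.map (constLaurent k B : B →* B[T;T⁻¹])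
    (unitOfInvertible (LaurentPolynomial.T 1 : B))
  let f : O →ₐ[k] B[T;T⁻¹] := (constLaurent k B).comp (constLaurent k O)
  have h1 : conjLoop lam B c = mapPts O (evalLaurent f (S * T')) c := by
    rw [hc, mapPts_evalLaurent_conjLoop, h]
    have h2 : mapPts O (constLaurent k B) c =
        loopAt lam T' * mapPts O f (univPt O) * (loopAt lam T')⁻¹ := by
      rw [hc, conjLoop]
      simp only [MonoidHom.comp_apply, MulEquiv.toMonoidHom_eq_coe, MonoidHom.coe_coe,
        MulAut.conj_apply, map_mul, map_inv, loopAt_map]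
      rfl
    rw [← hc]
    have h3 : conjLoop lam B c =
        loopAt lam S * mapPts O (constLaurent k B) c * (loopAt lam S)⁻¹ := rfl
    rw [h3, h2]
    group
  have h4 : ∀ p : O[T;T⁻¹], (evalLaurent f (S * T') p).coeff m =
      LaurentPolynomial.C (p.coeff m) * LaurentPolynomial.T m := by
    intro p
    induction p using LaurentPolynomial.induction_on' with
    | add p q hp hq =>
      rw [map_add, AddMonoidAlgebra.coeff_add, Finsupp.add_apply, hp, hq,
        AddMonoidAlgebra.coeff_add, Finsupp.add_apply, map_add, add_mul]
    | C_mul_T n r =>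
      have h5 : evalLaurent f (S * T') (LaurentPolynomial.C r * LaurentPolynomial.T n) =
          LaurentPolynomial.C (LaurentPolynomial.C r * LaurentPolynomial.T n) *
            LaurentPolynomial.T n := by
        rw [evalLaurent_C_mul_T]
        have hT : ((T' ^ n : B[T;T⁻¹]ˣ) : B[T;T⁻¹]) =
            LaurentPolynomial.C (LaurentPolynomial.T n : B) := by
          rw [← val_unitOfInvertible_T_zpow, ← map_zpow]
          rfl
        have hf : f r = LaurentPolynomial.C (LaurentPolynomial.C r) := rfl
        refine (congrArg₂ _ hf (val_mul_zpow S T' n)).trans ?_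
        rw [hT, val_unitOfInvertible_T_zpow, map_mul]
        ring
      rw [h5, coeff_C_mul_T, coeff_C_mul_T]
      split_ifs with h6
      · rw [h6]
      · simp
  have h7 := coeff_conjLoop lam c a m
  rw [h1, mapPts_apply, h4] at h7
  exact h7.symm

end Weights

end NormRel

namespace NormRel

/-! ### Parabolic, unipotent and Levi subgroups in terms of weights -/

section Weights

variable {k O : Type} [CommRing k] [CommRing O] [HopfAlgebra k O]
  {lam : Points k O k[T;T⁻¹]} {R : Type} [CommRing R] [Algebra k R]

theorem IsCocharacter.conjLoop_wt (h : IsCocharacter lam) (g : Points k O R) (m : ℤ) (a : O) :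
    (conjLoop lam R g).ofConv (wt lam m a) =
      LaurentPolynomial.C (g.ofConv (wt lam m a)) * LaurentPolynomial.T m := by
  rw [conjLoop_apply, h.conjLoop_univPt_wt, ← LaurentPolynomial.single_eq_C_mul_T,
    AddMonoidAlgebra.mapAlgHom_single, LaurentPolynomial.single_eq_C_mul_T]

theorem IsCocharacter.wt_wt (h : IsCocharacter lam) (m n : ℤ) (a : O) :
    wt lam n (wt lam m a) = if n = m then wt lam m a else 0 := by
  rw [wt, h.conjLoop_univPt_wt, coeff_C_mul_T]

/-- Conjugation by `lam(t)` multiplies functions of weight `n` by `tⁿ`. -/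
theorem IsCocharacter.conj_apply_wt (h : IsCocharacter lam) {R' : Type} [CommRing R']
    [Algebra k R'] (f : R →ₐ[k] R') (t : R'ˣ) (g : Points k O R) (n : ℤ) (a : O) :
    (loopAt lam t * mapPts O f g * (loopAt lam t)⁻¹).ofConv (wt lam n a) =
      f (g.ofConv (wt lam n a)) * (t ^ n : R'ˣ) := by
  rw [← mapPts_evalLaurent_conjLoop, mapPts_apply, h.conjLoop_wt, evalLaurent_C_mul_T]

theorem IsCocharacter.conj_apply_wt' (h : IsCocharacter lam) (t : Rˣ) (g : Points k O R) (n : ℤ)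
    (a : O) : (loopAt lam t * g * (loopAt lam t)⁻¹).ofConv (wt lam n a) =
      g.ofConv (wt lam n a) * (t ^ n : Rˣ) :=
  h.conj_apply_wt (AlgHom.id k R) t g n a

theorem evalLaurent_one_eq_sum (p : R[T;T⁻¹]) (s : Finset ℤ) (hs : p.coeff.support ⊆ s) :
    evalLaurent (AlgHom.id k R) 1 p = ∑ n ∈ s, p.coeff n := by
  have h1 : ∀ p : R[T;T⁻¹], evalLaurent (AlgHom.id k R) 1 p = p.coeff.sum fun _ r => r := by
    intro p
    induction p using LaurentPolynomial.induction_on' with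
    | add p q hp hq =>
      rw [map_add, hp, hq, AddMonoidAlgebra.coeff_add, Finsupp.sum_add_index' (by simp) (by simp)]
    | C_mul_T n r =>
      rw [evalLaurent_C_mul_T, ← LaurentPolynomial.single_eq_C_mul_T,
        AddMonoidAlgebra.coeff_single, Finsupp.sum_single_index rfl]
      simp
  rw [h1, Finsupp.sum_of_support_subset _ hs _ (by simp)]

/-- Every function is the sum of its components. -/
theorem IsCocharacter.exists_eq_sum_wt (h : IsCocharacter lam) (a : O) :
    ∃ s : Finset ℤ, (∀ n ∉ s, wt lam n a = 0) ∧ a = ∑ n ∈ s, wt lam n a := by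
  refine ⟨((conjLoop lam O (univPt O)).ofConv a).coeff.support, fun n hn => ?_, ?_⟩
  · simpa [wt] using hn
  · have h1 := mapPts_evalLaurent_conjLoop lam (AlgHom.id k O) 1 (univPt O)
    rw [h.loopAt_one, one_mul, inv_one, mul_one] at h1
    have h2 : a = evalLaurent (AlgHom.id k O) 1 ((conjLoop lam O (univPt O)).ofConv a) :=
      (congrArg (fun x : Points k O O => x.ofConv a) h1).symm
    exact h2.trans (evalLaurent_one_eq_sum _ _ (Finset.Subset.refl _))

theorem IsCocharacter.addHom_ext (h : IsCocharacter lam) {M : Type*} [AddCommMonoid M]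
    {f g : O →+ M} (hfg : ∀ n a, f (wt lam n a) = g (wt lam n a)) : f = g := by
  ext a
  obtain ⟨s, -, hs⟩ := h.exists_eq_sum_wt a
  rw [hs, map_sum, map_sum]
  exact Finset.sum_congr rfl fun n _ => hfg n a

theorem IsCocharacter.points_ext (h : IsCocharacter lam) {f g : Points k O R}
    (hfg : ∀ n a, f.ofConv (wt lam n a) = g.ofConv (wt lam n a)) : f = g := by
  have := h.addHom_ext (f := (f.ofConv : O →+ R)) (g := (g.ofConv : O →+ R)) hfg
  apply WithConv.ext
  exact AlgHom.ext fun a => DFunLike.congr_fun this a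

/-- The identity is fixed by conjugation, so its loop is constant and only weight 0 contributes. -/
theorem counit_wt (n : ℤ) (a : O) :
    (Coalgebra.counit (wt lam n a) : k) = if n = 0 then Coalgebra.counit a else 0 := by
  have h := coeff_conjLoop lam (1 : Points k O k) a n
  rw [map_one, one_apply, one_apply, Algebra.algebraMap_self, RingHom.id_apply,
    LaurentPolynomial.algebraMap_apply, LaurentPolynomial.C_apply] at h
  exact h.symm

theorem algebraMap_counit_wt (n : ℤ) (a : O) :
    algebraMap k R (Coalgebra.counit (wt lam n a)) =
      if n = 0 then algebraMap k R (Coalgebra.counit a) else 0 := by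
  rw [counit_wt]
  split_ifs <;> simp

theorem coeff_evalLaurent_inv_T (p : R[T;T⁻¹]) (n : ℤ) :
    (evalLaurent (constLaurent k R) (unitOfInvertible (LaurentPolynomial.T 1 : R[T;T⁻¹]))⁻¹
      p).coeff n = p.coeff (-n) := by
  induction p using LaurentPolynomial.induction_on' with
  | add p q hp hq =>
    rw [map_add, AddMonoidAlgebra.coeff_add, Finsupp.add_apply, hp, hq,
      AddMonoidAlgebra.coeff_add, Finsupp.add_apply]
  | C_mul_T m r =>
    rw [evalLaurent_C_mul_T, constLaurent_apply, inv_zpow', val_unitOfInvertible_T_zpow,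
      coeff_C_mul_T, coeff_C_mul_T]
    simp [neg_eq_iff_eq_neg]

theorem IsCocharacter.wt_inv (h : IsCocharacter lam) (n : ℤ) (a : O) :
    wt lam⁻¹ n a = wt lam (-n) a := by
  have h1 : conjLoop lam⁻¹ O (univPt O) = mapPts O (evalLaurent (constLaurent k O)
      (unitOfInvertible (LaurentPolynomial.T 1 : O[T;T⁻¹]))⁻¹) (conjLoop lam O (univPt O)) := by
    rw [mapPts_evalLaurent_conjLoop, h.loopAt_inv, ← loopAt_inv_left]
    rfl
  rw [wt, h1, mapPts_apply, coeff_evalLaurent_inv_T]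
  rfl

theorem mapPts_injective {R' : Type} [CommRing R'] [Algebra k R'] {f : R →ₐ[k] R'}
    (hf : Function.Injective f) : Function.Injective (mapPts O f) := by
  intro g g' h
  apply WithConv.ext
  exact AlgHom.ext fun a => hf (congrArg (fun x : Points k O R' => x.ofConv a) h)

theorem polyLaurent_injective : Function.Injective (polyLaurent k R) :=
  Polynomial.toLaurent_injective

theorem coeff_polyLaurent (p : R[X]) (n : ℕ) : (polyLaurent k R p).coeff (n : ℤ) = p.coeff n := by
  change (Polynomial.toLaurent p).coeff (n : ℤ) = p.coeff n
  rw [LaurentPolynomial.coeff_toLaurent]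
  exact Finsupp.mapDomain_apply Nat.cast_injective _ _

theorem coeff_polyLaurent_neg (p : R[X]) {n : ℤ} (hn : n < 0) :
    (polyLaurent k R p).coeff n = 0 := by
  change (Polynomial.toLaurent p).coeff n = 0
  rw [LaurentPolynomial.coeff_toLaurent]
  refine Finsupp.mapDomain_of_notMem_range _ _ ?_
  rintro ⟨m, rfl⟩
  exact absurd hn (by simp)

/-- This form of membership is visibly stable under base change, and over ℤ_p it can be tested
modulo all large powers of p. -/
theorem mem_parabolic_iff_wt {g : Points k O R} :
    g ∈ parabolic lam R ↔ ∀ n < 0, ∀ a, g.ofConv (wt lam n a) = 0 := by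
  rw [mem_parabolic_iff]
  constructor
  · intro h n hn a
    exact h _ (Ideal.subset_span ⟨a, n, hn, rfl⟩)
  · intro h
    have hle : parabolicIdeal lam ≤ RingHom.ker g.ofConv := by
      refine Ideal.span_le.2 ?_
      rintro _ ⟨a, n, hn, rfl⟩
      exact h n hn a
    exact fun b hb => hle hb

section Extension

variable {g : Points k O R} {y : Points k O R[X]} (hy : mapPts O (polyLaurent k R) y = conjLoop lam R g)
include hy

theorem coeff_extension (a : O) (n : ℕ) : (y.ofConv a).coeff n = g.ofConv (wt lam n a) := by
  rw [← coeff_conjLoop, ← hy, mapPts_apply, coeff_polyLaurent]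

theorem IsCocharacter.extension_wt (h : IsCocharacter lam) (n : ℕ) (a : O) :
    y.ofConv (wt lam n a) = Polynomial.C (g.ofConv (wt lam n a)) * Polynomial.X ^ n := by
  ext m
  rw [coeff_extension hy, h.wt_wt, Polynomial.coeff_C_mul_X_pow]
  simp only [Nat.cast_inj]
  split_ifs <;> simp

theorem IsCocharacter.extension_wt_neg (h : IsCocharacter lam) {n : ℤ} (hn : n < 0) (a : O) :
    y.ofConv (wt lam n a) = 0 := by
  ext m
  rw [coeff_extension hy, h.wt_wt, if_neg (by omega), map_zero, Polynomial.coeff_zero]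

end Extension

/-- The value at T = 0 of the polynomial loop is the weight 0 part of g, so the limit is 1 exactly
when that part agrees with the counit. -/
theorem mem_unipotent_iff_wt {g : Points k O R} :
    g ∈ unipotent lam R ↔ g ∈ parabolic lam R ∧
      ∀ a, g.ofConv (wt lam 0 a) = algebraMap k R (Coalgebra.counit a) := by
  have key : ∀ y : Points k O R[X], mapPts O (polyLaurent k R) y = conjLoop lam R g →
      ∀ a, (mapPts O (evalZero k R) y).ofConv a = g.ofConv (wt lam 0 a) := by
    intro y hy a
    have h1 := coeff_extension hy a 0
    rw [Nat.cast_zero] at h1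
    rw [mapPts_apply, ← h1]
    change Polynomial.aeval (0 : R) (y.ofConv a) = _
    rw [← Polynomial.coeff_zero_eq_aeval_zero]
  constructor
  · rintro ⟨y, hy, hyg⟩
    refine ⟨⟨y, hyg⟩, fun a => ?_⟩
    rw [← key y hyg, show mapPts O (evalZero k R) y = 1 from hy, one_apply]
  · rintro ⟨⟨y, hy⟩, h⟩
    refine ⟨y, ?_, hy⟩
    change mapPts O (evalZero k R) y = 1
    apply WithConv.ext
    refine AlgHom.ext fun a => ?_
    exact (key y hy a).trans (h a)

/-- Commuting with λ means that the loop is constant, which is tested on homogeneous functions. -/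
theorem IsCocharacter.mem_levi_iff_wt (h : IsCocharacter lam) {g : Points k O R} :
    g ∈ levi lam R ↔ ∀ n ≠ 0, ∀ a, g.ofConv (wt lam n a) = 0 := by
  change conjLoop lam R g = mapPts O (constLaurent k R) g ↔ _
  constructor
  · intro hg n hn a
    rw [← coeff_conjLoop, hg, mapPts_apply, constLaurent_apply, LaurentPolynomial.C_apply,
      if_neg hn]
  · intro hg
    refine h.points_ext fun n a => ?_
    rw [h.conjLoop_wt, mapPts_apply, constLaurent_apply]
    by_cases hn : n = 0
    · rw [hn, LaurentPolynomial.T_zero, mul_one]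
    · rw [hg n hn, map_zero, zero_mul]

theorem IsCocharacter.levi_le_parabolic (h : IsCocharacter lam) :
    levi lam R ≤ parabolic lam R := fun _ hg =>
  mem_parabolic_iff_wt.2 fun n hn => h.mem_levi_iff_wt.1 hg n hn.ne

theorem unipotent_le_parabolic : unipotent lam R ≤ parabolic lam R :=
  fun _ hg => (mem_unipotent_iff_wt.1 hg).1

theorem IsCocharacter.levi_inv (h : IsCocharacter lam) : levi lam⁻¹ R = levi lam R := by
  ext g
  rw [h.mem_levi_iff_wt, h.inv.mem_levi_iff_wt]
  simp only [h.wt_inv]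
  exact ⟨fun hg n hn a => by simpa using hg (-n) (by simpa using hn) a,
    fun hg n hn a => hg (-n) (by simpa using hn) a⟩

/-- The evaluation `R[T] → R` at `T = s`. -/
noncomputable def evalAt (k : Type) [CommRing k] {R : Type} [CommRing R] [Algebra k R] (s : R) :
    R[X] →ₐ[k] R := (Polynomial.aeval s : R[X] →ₐ[R] R).restrictScalars k

theorem evalAt_C_mul_X_pow (s r : R) (n : ℕ) :
    evalAt k s (Polynomial.C r * Polynomial.X ^ n) = r * s ^ n := by
  change Polynomial.aeval s _ = _
  simp

/-- `U_G(lam) · L⁰` is stable under the action of the multiplicative monoid. -/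
theorem IsCocharacter.evalAt_mem_mirabolic (h : IsCocharacter lam) {L0 : ClosedSubgroup k O}
    (hL : L0.points R ≤ levi lam R) (s : R) {g : Points k O R} {y : Points k O R[X]}
    (hy : mapPts O (polyLaurent k R) y = conjLoop lam R g) (hg : g ∈ mirabolic lam L0 R) :
    mapPts O (evalAt k s) y ∈ mirabolic lam L0 R := by
  -- The elements whose loop extends polynomially with value at T = s in the mirabolic form a
  -- subgroup, so only U_G(λ) and L⁰ need to be checked. On L⁰ the loop is constant. The extension
  -- is unique, so this one is `y`.
  let H : Subgroup (Points k O R) := (((mirabolic lam L0 R).comap (mapPts O (evalAt k s))).map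
    (mapPts O (polyLaurent k R))).comap (conjLoop lam R)
  have hinj : Function.Injective (mapPts O (polyLaurent k R)) :=
    mapPts_injective polyLaurent_injective
  have hH : mirabolic lam L0 R ≤ H := by
    refine sup_le ?_ ?_
    · intro n hn
      obtain ⟨⟨z, hz⟩, h0⟩ := mem_unipotent_iff_wt.1 hn
      refine ⟨z, Subgroup.mem_sup_left (mem_unipotent_iff_wt.2
        ⟨mem_parabolic_iff_wt.2 fun m hm a => ?_, fun a => ?_⟩), hz⟩
      · rw [mapPts_apply, h.extension_wt_neg hz hm, map_zero]
      · have h1 := h.extension_wt hz 0 a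
        rw [Nat.cast_zero] at h1
        rw [mapPts_apply, h1, evalAt_C_mul_X_pow, h0, pow_zero, mul_one]
    · intro l hl
      let cst : R →ₐ[k] R[X] := IsScalarTower.toAlgHom k R R[X]
      have h1 : (polyLaurent k R).comp cst = constLaurent k R :=
        AlgHom.ext fun r => Polynomial.toLaurent_C r
      have h2 : (evalAt k s).comp cst = AlgHom.id k R :=
        AlgHom.ext fun r => Polynomial.aeval_C s r
      refine ⟨mapPts O cst l, ?_, ?_⟩
      · change mapPts O (evalAt k s) (mapPts O cst l) ∈ mirabolic lam L0 R
        rw [mapPts_mapPts, h2, mapPts_id]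
        exact Subgroup.mem_sup_right hl
      · rw [mapPts_mapPts, h1]
        exact (hL hl).symm
  obtain ⟨z, hz, hzg⟩ := hH hg
  rw [hinj (hy.trans hzg.symm)]
  exact hz

section Functoriality

variable {R' : Type} [CommRing R'] [Algebra k R'] (f : R →ₐ[k] R')

theorem mapPts_mem_parabolic {g : Points k O R} (hg : g ∈ parabolic lam R) :
    mapPts O f g ∈ parabolic lam R' := mem_parabolic_iff_wt.2 fun n hn a => by
  rw [mapPts_apply, mem_parabolic_iff_wt.1 hg n hn, map_zero]

theorem mapPts_mem_unipotent {g : Points k O R} (hg : g ∈ unipotent lam R) :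
    mapPts O f g ∈ unipotent lam R' :=
  mem_unipotent_iff_wt.2 ⟨mapPts_mem_parabolic f (unipotent_le_parabolic hg), fun a => by
    rw [mapPts_apply, (mem_unipotent_iff_wt.1 hg).2, AlgHom.commutes]⟩

theorem mapPts_mem_points {L0 : ClosedSubgroup k O} {g : Points k O R} (hg : g ∈ L0.points R) :
    mapPts O f g ∈ L0.points R' := (L0.mem_points _).2 fun a ha => by
  rw [mapPts_apply, (L0.mem_points _).1 hg a ha, map_zero]

theorem mapPts_mem_mirabolic {L0 : ClosedSubgroup k O} {g : Points k O R}
    (hg : g ∈ mirabolic lam L0 R) : mapPts O f g ∈ mirabolic lam L0 R' := by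
  have : mirabolic lam L0 R ≤ (mirabolic lam L0 R').comap (mapPts O f) :=
    sup_le (fun n hn => Subgroup.mem_sup_left (mapPts_mem_unipotent f hn))
      (fun l hl => Subgroup.mem_sup_right (mapPts_mem_points f hl))
  exact this hg

theorem IsCocharacter.mirabolic_le_parabolic (h : IsCocharacter lam) {L0 : ClosedSubgroup k O}
    (hL : L0.points R ≤ levi lam R) : mirabolic lam L0 R ≤ parabolic lam R :=
  sup_le unipotent_le_parabolic (hL.trans h.levi_le_parabolic)

end Functoriality

/-- The Levi decomposition of `P_G(lam)`. -/
theorem IsCocharacter.exists_unipotent_mul_levi (h : IsCocharacter lam) {g : Points k O R}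
    (hg : g ∈ parabolic lam R) : ∃ n ∈ unipotent lam R, ∃ l ∈ levi lam R, g = n * l ∧
      ∀ a, l.ofConv a = g.ofConv (wt lam 0 a) := by
  obtain ⟨y, hy⟩ := hg
  have h0 : ∀ a, (mapPts O (evalZero k R) y).ofConv a = g.ofConv (wt lam 0 a) := by
    intro a
    have h1 := coeff_extension hy a 0
    rw [Nat.cast_zero] at h1
    rw [mapPts_apply, ← h1]
    change Polynomial.aeval (0 : R) (y.ofConv a) = _
    rw [← Polynomial.coeff_zero_eq_aeval_zero]
  -- The limit at T = 0 is the Levi factor; dividing by it leaves an element with limit 1.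
  set l := mapPts O (evalZero k R) y with hl
  have hlev : l ∈ levi lam R := h.mem_levi_iff_wt.2 fun n hn a => by
    rw [h0, h.wt_wt, if_neg hn.symm, map_zero]
  let cst : R →ₐ[k] R[X] := IsScalarTower.toAlgHom k R R[X]
  have h1 : (polyLaurent k R).comp cst = constLaurent k R :=
    AlgHom.ext fun r => Polynomial.toLaurent_C r
  have h2 : (evalZero k R).comp cst = AlgHom.id k R :=
    AlgHom.ext fun r => Polynomial.aeval_C 0 r
  refine ⟨g * l⁻¹, ⟨y * (mapPts O cst l)⁻¹, ?_, ?_⟩, l, hlev, by group, h0⟩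
  · change mapPts O (evalZero k R) (y * (mapPts O cst l)⁻¹) = 1
    rw [map_mul, map_inv, mapPts_mapPts, h2, mapPts_id, ← hl, mul_inv_cancel]
  · rw [map_mul, map_mul, map_inv, map_inv, mapPts_mapPts, h1, hy]
    congr 2
    exact hlev.symm

end Weights

end NormRel

namespace NormRel

/-! ### Infinitesimal lifting for parabolic subgroups and for the big cell -/

section SquareZero

variable {k O : Type} [CommRing k] [CommRing O] [HopfAlgebra k O]
  {lam : Points k O k[T;T⁻¹]} {R R' : Type} [CommRing R] [Algebra k R] [CommRing R'] [Algebra k R']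

theorem laurent_mul_eq_zero {p q : R[T;T⁻¹]} (h : ∀ m n, p.coeff m * q.coeff n = 0) :
    p * q = 0 := by
  rw [AddMonoidAlgebra.mul_def]
  refine Finset.sum_eq_zero fun m _ => Finset.sum_eq_zero fun n _ => ?_
  simp [h]

theorem coeff_sub_C {p : R[T;T⁻¹]} (r : R) (n : ℤ) :
    (p - LaurentPolynomial.C r).coeff n = p.coeff n - if n = 0 then r else 0 := by
  rw [AddMonoidAlgebra.coeff_sub, Finsupp.sub_apply, LaurentPolynomial.C_apply]

theorem coeff_C_mul (r : R) (p : R[T;T⁻¹]) (n : ℤ) :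
    (LaurentPolynomial.C r * p).coeff n = r * p.coeff n := by
  rw [← LaurentPolynomial.smul_eq_C_mul, AddMonoidAlgebra.coeff_smul_apply, smul_eq_mul]

theorem coeff_mul_T (p : R[T;T⁻¹]) (m n : ℤ) :
    (p * LaurentPolynomial.T m).coeff n = p.coeff (n - m) := by
  induction p using LaurentPolynomial.induction_on' with
  | add p q hp hq =>
    rw [add_mul, AddMonoidAlgebra.coeff_add, Finsupp.add_apply, hp, hq,
      AddMonoidAlgebra.coeff_add, Finsupp.add_apply]
  | C_mul_T l r =>
    rw [mul_assoc, ← LaurentPolynomial.T_add, coeff_C_mul_T, coeff_C_mul_T]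
    simp [sub_eq_iff_eq_add]

/-- The non-constant parts have coefficients in the square-zero kernel, so their product vanishes
and taking the constant coefficient is multiplicative. -/
theorem coeff_zero_mul_of_sqZero {f : R →ₐ[k] R'} (hI : ∀ x y, f x = 0 → f y = 0 → x * y = 0)
    {p q : R[T;T⁻¹]} (hp : ∀ n ≠ 0, f (p.coeff n) = 0) (hq : ∀ n ≠ 0, f (q.coeff n) = 0) :
    (p * q).coeff 0 = p.coeff 0 * q.coeff 0 := by
  have key : ∀ {p : R[T;T⁻¹]}, (∀ n ≠ 0, f (p.coeff n) = 0) →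
      ∀ n, f ((p - LaurentPolynomial.C (p.coeff 0)).coeff n) = 0 := by
    intro p hp n
    rw [coeff_sub_C]
    split_ifs with h
    · rw [h, sub_self, map_zero]
    · rw [sub_zero, hp n h]
  have h0 := laurent_mul_eq_zero fun m n => hI _ _ (key hp m) (key hq n)
  have h1 : p * q = LaurentPolynomial.C (p.coeff 0) * q + LaurentPolynomial.C (q.coeff 0) * p -
      LaurentPolynomial.C (p.coeff 0) * LaurentPolynomial.C (q.coeff 0) := by
    linear_combination h0
  rw [h1, ← map_mul, coeff_sub_C, AddMonoidAlgebra.coeff_add, Finsupp.add_apply, coeff_C_mul,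
    coeff_C_mul, if_pos rfl]
  ring

theorem exists_points_lift [Algebra.FormallySmooth k O] {B B' : Type} [CommRing B] [Algebra k B]
    [CommRing B'] [Algebra k B'] {f : B →ₐ[k] B'} (hf : Function.Surjective f)
    (hI : ∀ x y, f x = 0 → f y = 0 → x * y = 0) (g : O →ₐ[k] B') :
    ∃ g' : O →ₐ[k] B, f.comp g' = g := by
  have hn : IsNilpotent (RingHom.ker (f : B →+* B')) := by
    refine ⟨2, ?_⟩
    rw [pow_two, Ideal.zero_eq_bot, eq_bot_iff, Ideal.mul_le]
    exact fun x hx y hy => hI x y hx hy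
  exact ⟨_, Algebra.FormallySmooth.comp_liftOfSurjective g f hf hn⟩

theorem mapPts_mapAlgHom_loopAt_T (f : R →ₐ[k] R') :
    mapPts O (AddMonoidAlgebra.mapAlgHom ℤ f)
      (loopAt lam (unitOfInvertible (LaurentPolynomial.T 1 : R[T;T⁻¹]))) =
      loopAt lam (unitOfInvertible (LaurentPolynomial.T 1 : R'[T;T⁻¹])) := by
  rw [loopAt_map]
  congr 1
  ext1
  change AddMonoidAlgebra.mapAlgHom ℤ f (LaurentPolynomial.T 1) = _
  rw [LaurentPolynomial.T, AddMonoidAlgebra.mapAlgHom_single, map_one]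
  rfl

theorem mapAlgHom_comp_polyLaurent (f : R →ₐ[k] R') :
    (AddMonoidAlgebra.mapAlgHom ℤ f).comp (polyLaurent k R) =
      (polyLaurent k R').comp (Polynomial.mapAlgHom f) := by
  refine AlgHom.ext fun p => LaurentPolynomial.ext fun n => ?_
  change (AddMonoidAlgebra.mapAlgHom ℤ f (polyLaurent k R p)).coeff n =
    (polyLaurent k R' (Polynomial.mapAlgHom f p)).coeff n
  rw [AddMonoidAlgebra.coeff_mapAlgHom]
  by_cases hn : n < 0
  · rw [coeff_polyLaurent_neg p hn, coeff_polyLaurent_neg _ hn, map_zero]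
  · obtain ⟨m, rfl⟩ := Int.eq_ofNat_of_zero_le (not_lt.1 hn)
    rw [coeff_polyLaurent p m]
    refine Eq.trans ?_ (coeff_polyLaurent _ m).symm
    simp

/-- `P_G(lam)` satisfies the infinitesimal lifting criterion. -/
theorem IsCocharacter.exists_parabolic_lift [Algebra.FormallySmooth k O] (h : IsCocharacter lam)
    {f : R →ₐ[k] R'} (hf : Function.Surjective f) (hI : ∀ x y, f x = 0 → f y = 0 → x * y = 0)
    {g' : Points k O R'} (hg' : g' ∈ parabolic lam R') :
    ∃ g ∈ parabolic lam R, mapPts O f g = g' := by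
  obtain ⟨y', hy'⟩ := hg'
  obtain ⟨y, hy⟩ := exists_points_lift (f := Polynomial.mapAlgHom f) (O := O)
    (Polynomial.map_surjective _ hf) (by
      intro p q hp hq
      have h1 : ∀ {p : R[X]}, Polynomial.mapAlgHom f p = 0 → ∀ n, f (p.coeff n) = 0 := by
        intro p hp n
        rw [← Polynomial.coeff_mapAlgHom_apply, hp, Polynomial.coeff_zero]
      ext n
      rw [Polynomial.coeff_mul, Polynomial.coeff_zero]
      exact Finset.sum_eq_zero fun m _ => hI _ _ (h1 hp _) (h1 hq _)) y'.ofConv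
  set t := unitOfInvertible (LaurentPolynomial.T 1 : R[T;T⁻¹]) with ht
  -- Formal smoothness lifts the polynomial loop, but the lift need not be the loop of a point.
  -- Undoing the conjugation gives `θ`, constant only after reduction; its T⁰-coefficient is still
  -- an algebra homomorphism and is the required point.
  let θ : Points k O R[T;T⁻¹] := loopAt lam t⁻¹ *
    mapPts O (polyLaurent k R) (WithConv.toConv y) * (loopAt lam t⁻¹)⁻¹
  have hθ : mapPts O (AddMonoidAlgebra.mapAlgHom ℤ f) θ = mapPts O (constLaurent k R') g' := by
    have h1 : mapPts O (Polynomial.mapAlgHom f) (WithConv.toConv y) = y' := WithConv.ext hy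
    change mapPts O (AddMonoidAlgebra.mapAlgHom ℤ f) (loopAt lam t⁻¹ *
      mapPts O (polyLaurent k R) (WithConv.toConv y) * (loopAt lam t⁻¹)⁻¹) = _
    rw [map_mul, map_mul, map_inv, h.loopAt_inv, map_inv, ht, mapPts_mapAlgHom_loopAt_T,
      mapPts_mapPts, mapAlgHom_comp_polyLaurent, ← mapPts_mapPts, h1, hy', conjLoop]
    simp only [MonoidHom.comp_apply, MulEquiv.toMonoidHom_eq_coe, MonoidHom.coe_coe,
      MulAut.conj_apply]
    group
  have hθ' : ∀ a n, f ((θ.ofConv a).coeff n) = if n = 0 then g'.ofConv a else 0 := by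
    intro a n
    have h1 := congrArg (fun x : Points k O R'[T;T⁻¹] => (x.ofConv a).coeff n) hθ
    simp only [mapPts_apply, AddMonoidAlgebra.coeff_mapAlgHom, constLaurent_apply,
      LaurentPolynomial.C_apply] at h1
    exact h1
  have hθ0 : ∀ a n, n ≠ 0 → f ((θ.ofConv a).coeff n) = 0 := by
    intro a n hn
    rw [hθ', if_neg hn]
  let g : O →ₐ[k] R :=
    { toFun := fun a => (θ.ofConv a).coeff 0
      map_one' := by
        rw [map_one, AddMonoidAlgebra.one_def]
        simp
      map_mul' := fun a b => by
        rw [map_mul]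
        exact coeff_zero_mul_of_sqZero hI (hθ0 a) (hθ0 b)
      map_zero' := by simp
      map_add' := fun a b => by simp
      commutes' := fun c => by
        rw [AlgHom.commutes, LaurentPolynomial.algebraMap_apply, LaurentPolynomial.C_apply,
          if_pos rfl] }
  refine ⟨WithConv.toConv g, mem_parabolic_iff_wt.2 fun n hn a => ?_, ?_⟩
  -- On weight n, undoing the conjugation multiplies by T^{-n}, so this is the coefficient at n < 0
  -- of a polynomial.
  · change (θ.ofConv (wt lam n a)).coeff 0 = 0
    rw [h.conj_apply_wt', inv_zpow', ht, val_unitOfInvertible_T_zpow, coeff_mul_T, mapPts_apply]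
    exact coeff_polyLaurent_neg _ (by omega)
  · apply WithConv.ext
    refine AlgHom.ext fun a => ?_
    exact (hθ' a 0).trans (if_pos rfl)

theorem IsCocharacter.exists_unipotent_lift [Algebra.FormallySmooth k O] (h : IsCocharacter lam)
    {f : R →ₐ[k] R'} (hf : Function.Surjective f) (hI : ∀ x y, f x = 0 → f y = 0 → x * y = 0)
    {g' : Points k O R'} (hg' : g' ∈ unipotent lam R') :
    ∃ g ∈ unipotent lam R, mapPts O f g = g' := by
  obtain ⟨g, hg, rfl⟩ := h.exists_parabolic_lift hf hI (unipotent_le_parabolic hg')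
  -- The Levi factor of a parabolic lift reduces to 1, because its values are the weight 0 part of a
  -- lift of the unipotent g'; so it can be dropped.
  obtain ⟨n, hn, l, -, rfl, hl⟩ := h.exists_unipotent_mul_levi hg
  refine ⟨n, hn, ?_⟩
  have h1 : mapPts O f l = 1 := by
    apply WithConv.ext
    refine AlgHom.ext fun a => ?_
    exact (congrArg f (hl a)).trans ((mem_unipotent_iff_wt.1 hg').2 a)
  rw [map_mul, h1, mul_one]

/-- Multiplication of points infinitesimally near the identity. -/
theorem mul_apply_of_sqZero {f : R →ₐ[k] R'} (hI : ∀ x y, f x = 0 → f y = 0 → x * y = 0)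
    {x y : Points k O R} (hx : mapPts O f x = 1) (hy : mapPts O f y = 1) (a : O) :
    (x * y).ofConv a + algebraMap k R (Coalgebra.counit a) = x.ofConv a + y.ofConv a := by
  have key : ∀ {x : Points k O R}, mapPts O f x = 1 → ∀ a,
      f (x.ofConv a - (1 : Points k O R).ofConv a) = 0 := by
    intro x hx a
    rw [map_sub, ← mapPts_apply, hx, one_apply, one_apply, AlgHom.commutes, sub_self]
  have h1 : ∀ t : O ⊗[k] O,
      Algebra.TensorProduct.lift x.ofConv y.ofConv (fun _ _ => .all ..) t +
      Algebra.TensorProduct.lift (1 : Points k O R).ofConv (1 : Points k O R).ofConv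
        (fun _ _ => .all ..) t =
      Algebra.TensorProduct.lift x.ofConv (1 : Points k O R).ofConv (fun _ _ => .all ..) t +
      Algebra.TensorProduct.lift (1 : Points k O R).ofConv y.ofConv (fun _ _ => .all ..) t := by
    intro t
    induction t with
    | zero => simp
    | tmul b c =>
      simp only [Algebra.TensorProduct.lift_tmul]
      linear_combination hI _ _ (key hx b) (key hy c)
    | add s t hs ht =>
      simp only [map_add]
      linear_combination hs + ht
  have h2 := h1 (Coalgebra.comul a)
  simp only [← AlgHom.convMul_apply] at h2
  change (x * y).ofConv a + (1 * 1 : Points k O R).ofConv a =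
    (x * 1 : Points k O R).ofConv a + (1 * y : Points k O R).ofConv a at h2
  simpa only [one_mul, mul_one, one_apply] using h2

/-- The sum of the coefficients at the positive powers of `T`. -/
noncomputable def posSum (p : R[T;T⁻¹]) : R :=
  Finsupp.linearCombination R (fun n : ℤ => if 0 < n then (1 : R) else 0) p.coeff

theorem posSum_add (p q : R[T;T⁻¹]) : posSum (p + q) = posSum p + posSum q := by
  simp [posSum]

theorem posSum_sub (p q : R[T;T⁻¹]) : posSum (p - q) = posSum p - posSum q := by
  simp [posSum]

theorem posSum_C_mul (r : R) (p : R[T;T⁻¹]) :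
    posSum (LaurentPolynomial.C r * p) = r * posSum p := by
  rw [← LaurentPolynomial.smul_eq_C_mul]
  simp [posSum]

theorem posSum_T (n : ℤ) :
    posSum (LaurentPolynomial.T n : R[T;T⁻¹]) = if 0 < n then 1 else 0 := by
  rw [posSum, LaurentPolynomial.T, AddMonoidAlgebra.coeff_single,
    Finsupp.linearCombination_single, one_smul]

theorem posSum_C (r : R) : posSum (LaurentPolynomial.C r) = 0 := by
  rw [← mul_one (LaurentPolynomial.C r), posSum_C_mul, ← LaurentPolynomial.T_zero, posSum_T]
  simp

theorem map_posSum_eq_zero {f : R →ₐ[k] R'} {p : R[T;T⁻¹]} (hp : ∀ n, f (p.coeff n) = 0) :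
    f (posSum p) = 0 := by
  rw [posSum, Finsupp.linearCombination_apply, Finsupp.sum, map_sum]
  refine Finset.sum_eq_zero fun n _ => ?_
  rw [smul_eq_mul, map_mul, hp, zero_mul]

/-- Points infinitesimally near the identity decompose as `U_G(lam) · P_G(lam⁻¹)`. -/
theorem IsCocharacter.exists_unipotent_inv_mul_mem (h : IsCocharacter lam)
    {f : R →ₐ[k] R'} (hI : ∀ x y, f x = 0 → f y = 0 → x * y = 0)
    {x : Points k O R} (hx : mapPts O f x = 1) :
    ∃ n ∈ unipotent lam R, mapPts O f n = 1 ∧ n⁻¹ * x ∈ parabolic lam⁻¹ R := by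
  let ε : O → R := fun a => algebraMap k R (Coalgebra.counit a)
  have hεm : ∀ a b, ε (a * b) = ε a * ε b := fun a b => by simp [ε]
  have hεa : ∀ a b, ε (a + b) = ε a + ε b := fun a b => by simp [ε]
  have hfε : ∀ a, f (ε a) = algebraMap k R' (Coalgebra.counit a) := fun a => AlgHom.commutes _ _
  let θ := conjLoop lam R x
  -- `i` is an ε-derivation with coefficients in the square-zero kernel, graded by weight. Its part
  -- of positive weight is again an ε-derivation, so ε + posSum ∘ i is a point: the N-component of
  -- x.
  let i : O → R[T;T⁻¹] := fun a => θ.ofConv a - LaurentPolynomial.C (ε a)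
  have hi : ∀ a n, f ((i a).coeff n) = 0 := by
    intro a n
    have h1 : f ((θ.ofConv a).coeff n) = if n = 0 then f (ε a) else 0 := by
      rw [coeff_conjLoop, ← mapPts_apply, hx, one_apply, algebraMap_counit_wt, hfε]
    rw [coeff_sub_C, map_sub, h1]
    split_ifs <;> simp
  have him : ∀ a b, i (a * b) =
      LaurentPolynomial.C (ε a) * i b + LaurentPolynomial.C (ε b) * i a := by
    intro a b
    have h0 := laurent_mul_eq_zero fun m n => hI _ _ (hi a m) (hi b n)
    simp only [i, map_mul, hεm] at h0 ⊢
    linear_combination h0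
  have hia : ∀ a b, i (a + b) = i a + i b := by
    intro a b
    simp only [i, map_add, hεa]
    ring
  have hρ : ∀ a, f (posSum (i a)) = 0 := fun a => map_posSum_eq_zero (hi a)
  have hic : ∀ c : k, i (algebraMap k O c) = 0 := by
    intro c
    simp only [i, ε, AlgHom.commutes, Bialgebra.counit_algebraMap,
      LaurentPolynomial.algebraMap_apply, sub_self]
  have hp0 : posSum (0 : R[T;T⁻¹]) = 0 := by simp [posSum]
  let n : O →ₐ[k] R :=
    { toFun := fun a => ε a + posSum (i a)
      map_one' := by
        have := hic 1
        rw [map_one] at this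
        rw [this, hp0]
        simp [ε]
      map_mul' := fun a b => by
        rw [him, posSum_add, posSum_C_mul, posSum_C_mul, hεm]
        linear_combination - hI _ _ (hρ a) (hρ b)
      map_zero' := by
        have := hic 0
        rw [map_zero] at this
        rw [this, hp0]
        simp [ε]
      map_add' := fun a b => by
        rw [hia, posSum_add, hεa]
        ring
      commutes' := fun c => by
        rw [hic, hp0]
        simp [ε] }
  have hn : ∀ m a, n (wt lam m a) = ε (wt lam m a) + if 0 < m then x.ofConv (wt lam m a) else 0 := by
    intro m a
    change ε _ + posSum (i _) = _
    simp only [i, θ]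
    rw [h.conjLoop_wt, posSum_sub, posSum_C_mul, posSum_T, posSum_C, sub_zero]
    simp
  have hn1 : mapPts O f (WithConv.toConv n) = 1 := by
    apply WithConv.ext
    refine AlgHom.ext fun a => ?_
    change f (ε a + posSum (i a)) = algebraMap k R' (Coalgebra.counit a)
    rw [map_add, hρ, hfε, add_zero]
  refine ⟨WithConv.toConv n, mem_unipotent_iff_wt.2 ⟨mem_parabolic_iff_wt.2 fun m hm a => ?_,
    fun a => ?_⟩, hn1, mem_parabolic_iff_wt.2 fun m hm a => ?_⟩
  · change n _ = 0
    rw [hn, if_neg (by omega), add_zero]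
    simp only [ε]
    rw [algebraMap_counit_wt, if_neg hm.ne]
  · change n _ = _
    rw [hn, if_neg (by omega), add_zero]
    simp only [ε]
    rw [algebraMap_counit_wt, if_pos rfl]
  · rw [h.wt_inv]
    set b := wt lam (-m) a with hb
    have hn1' : mapPts O f (WithConv.toConv n)⁻¹ = 1 := by rw [map_inv, hn1, inv_one]
    -- Near the identity the group law is addition. Hence (n⁻¹ x)(b) = x(b) - n(b), and this
    -- vanishes on the positive weight -m, where n was defined to agree with x.
    have e1 := mul_apply_of_sqZero hI hn1' hx b
    have e2 := mul_apply_of_sqZero hI hn1 hn1' b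
    rw [mul_inv_cancel, one_apply] at e2
    have e3 : (WithConv.toConv n : Points k O R).ofConv b =
        ε b + if 0 < -m then x.ofConv b else 0 := hn (-m) a
    rw [if_pos (by omega)] at e3
    have e4 : ε b = 0 := by
      simp only [ε, hb]
      rw [algebraMap_counit_wt, if_neg (by omega)]
    rw [show algebraMap k R (Coalgebra.counit b) = ε b from rfl, e4] at e1 e2
    rw [e4] at e3
    linear_combination e1 - e2 - e3

/-- The multiplication `U_G(lam) × P_G(lam⁻¹) → G` satisfies the infinitesimal lifting
criterion for smoothness. -/
theorem IsCocharacter.exists_unipotent_mul_parabolic_lift [Algebra.FormallySmooth k O]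
    (h : IsCocharacter lam) {f : R →ₐ[k] R'} (hf : Function.Surjective f)
    (hI : ∀ x y, f x = 0 → f y = 0 → x * y = 0) {v : Points k O R} {n' q' : Points k O R'}
    (hn' : n' ∈ unipotent lam R') (hq' : q' ∈ parabolic lam⁻¹ R')
    (hv : n' * q' = mapPts O f v) :
    ∃ n ∈ unipotent lam R, ∃ q ∈ parabolic lam⁻¹ R, n * q = v ∧ mapPts O f n = n' ∧
      mapPts O f q = q' := by
  obtain ⟨n₀, hn₀, rfl⟩ := h.exists_unipotent_lift hf hI hn'
  obtain ⟨q₀, hq₀, rfl⟩ := h.inv.exists_parabolic_lift hf hI hq'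
  -- The factors are lifted independently; the error is infinitesimally near 1, is decomposed by the
  -- preceding lemma, and is absorbed into the two factors.
  have hx : mapPts O f (n₀⁻¹ * v * q₀⁻¹) = 1 := by
    rw [map_mul, map_mul, ← hv, map_inv, map_inv]
    group
  obtain ⟨n, hn, hn1, hq⟩ := h.exists_unipotent_inv_mul_mem hI hx
  refine ⟨n₀ * n, mul_mem hn₀ hn, n⁻¹ * (n₀⁻¹ * v * q₀⁻¹) * q₀, mul_mem hq hq₀, by group,
    by rw [map_mul, hn1, mul_one], ?_⟩
  rw [map_mul, map_mul, hx, map_inv, hn1]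
  group

end SquareZero

/-! ### Successive approximation of homomorphisms to `ℤ_[p]` -/

section Limit

variable {p : ℕ} [Fact p.Prime]

/-- The quotient `ℤ/pⁿ`. -/
abbrev PadicQuot (p : ℕ) [Fact p.Prime] (n : ℕ) : Type := ℤ_[p] ⧸ Ideal.span {(p : ℤ_[p]) ^ n}

theorem span_pow_le {m n : ℕ} (h : m ≤ n) :
    Ideal.span {(p : ℤ_[p]) ^ n} ≤ Ideal.span {(p : ℤ_[p]) ^ m} :=
  Ideal.span_singleton_le_span_singleton.2 (pow_dvd_pow _ h)

/-- The reduction `ℤ/pⁿ → ℤ/pᵐ`. -/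
noncomputable def padicQuotMap {m n : ℕ} (h : m ≤ n) : PadicQuot p n →ₐ[ℤ_[p]] PadicQuot p m :=
  Ideal.Quotient.factorₐ ℤ_[p] (span_pow_le h)

/-- The reduction `ℤ_p → ℤ/pⁿ`. -/
noncomputable def padicMk (p : ℕ) [Fact p.Prime] (n : ℕ) : ℤ_[p] →ₐ[ℤ_[p]] PadicQuot p n :=
  Ideal.Quotient.mkₐ ℤ_[p] (Ideal.span {(p : ℤ_[p]) ^ n})

theorem padicQuotMap_padicMk {m n : ℕ} (h : m ≤ n) (z : ℤ_[p]) :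
    padicQuotMap h (padicMk p n z) = padicMk p m z := rfl

theorem padicMk_surjective (n : ℕ) : Function.Surjective (padicMk p n) :=
  Ideal.Quotient.mk_surjective

theorem padicMk_eq_zero {n : ℕ} {z : ℤ_[p]} :
    padicMk p n z = 0 ↔ z ∈ Ideal.span {(p : ℤ_[p]) ^ n} := Ideal.Quotient.eq_zero_iff_mem

theorem padicQuotMap_surjective {m n : ℕ} (h : m ≤ n) :
    Function.Surjective (padicQuotMap (p := p) h) := fun x => by
  obtain ⟨z, rfl⟩ := padicMk_surjective m x
  exact ⟨padicMk p n z, rfl⟩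

/-- The square of the kernel vanishes because 2n ≥ n + 1. This requires n ≥ 1 and is the source of
the condition r ≥ 1. -/
theorem padicQuotMap_sqZero {n : ℕ} (hn : 1 ≤ n) (x y : PadicQuot p (n + 1))
    (hx : padicQuotMap (n.le_add_right 1) x = 0) (hy : padicQuotMap (n.le_add_right 1) y = 0) :
    x * y = 0 := by
  obtain ⟨x, rfl⟩ := padicMk_surjective _ x
  obtain ⟨y, rfl⟩ := padicMk_surjective _ y
  have hx' : padicMk p n x = 0 := hx
  have hy' : padicMk p n y = 0 := hy
  rw [padicMk_eq_zero, Ideal.mem_span_singleton] at hx' hy'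
  rw [← map_mul, padicMk_eq_zero, Ideal.mem_span_singleton]
  exact (pow_dvd_pow _ (by omega)).trans (pow_add (p : ℤ_[p]) n n ▸ mul_dvd_mul hx' hy')

instance : IsAdicComplete (Ideal.span {(p : ℤ_[p])}) ℤ_[p] := by
  rw [← PadicInt.maximalIdeal_eq_span_p]
  infer_instance

/-- Successive approximation of `ℤ_p`-points. -/
theorem exists_padic_lift {C : Type} [CommRing C] [Algebra ℤ_[p] C] (r : ℕ)
    (P : ∀ n, (C →ₐ[ℤ_[p]] PadicQuot p n) → Prop)
    (hP : ∀ n, r ≤ n → ∀ x, P n x → ∃ y, P (n + 1) y ∧ (padicQuotMap (n.le_add_right 1)).comp y = x)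
    (x : C →ₐ[ℤ_[p]] PadicQuot p r) (hx : P r x) :
    ∃ X : C →ₐ[ℤ_[p]] ℤ_[p], (padicMk p r).comp X = x ∧
      ∀ n, r ≤ n → P n ((padicMk p n).comp X) := by
  choose nxt hn1 hn2 using hP
  let s' : ∀ i : ℕ, {x : C →ₐ[ℤ_[p]] PadicQuot p (r + i) // P (r + i) x} :=
    fun i => Nat.rec (motive := fun i => {x : C →ₐ[ℤ_[p]] PadicQuot p (r + i) // P (r + i) x})
      ⟨x, hx⟩ (fun i y => ⟨nxt (r + i) (by omega) y.1 y.2, hn1 (r + i) (by omega) y.1 y.2⟩) i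
  obtain ⟨s, hs0, hsP, hs⟩ : ∃ s : ∀ i : ℕ, C →ₐ[ℤ_[p]] PadicQuot p (r + i), s 0 = x ∧
      (∀ i, P (r + i) (s i)) ∧
      ∀ i, (padicQuotMap ((r + i).le_add_right 1)).comp (s (i + 1)) = s i :=
    ⟨fun i => (s' i).1, rfl, fun i => (s' i).2,
      fun i => hn2 (r + i) (by omega) (s' i).1 (s' i).2⟩
  have hs' : ∀ i j (h : i ≤ j), (padicQuotMap (Nat.add_le_add_left h r)).comp (s j) = s i := by
    intro i j h
    induction j, h using Nat.le_induction with
    | base =>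
      refine AlgHom.ext fun c => ?_
      obtain ⟨z, hz⟩ := padicMk_surjective _ (s i c)
      rw [AlgHom.comp_apply, ← hz, padicQuotMap_padicMk]
    | succ j h ih =>
      refine AlgHom.ext fun c => ?_
      rw [← ih, ← hs j]
      obtain ⟨z, hz⟩ := padicMk_surjective _ (s (j + 1) c)
      rw [AlgHom.comp_apply, AlgHom.comp_apply, AlgHom.comp_apply, ← hz, padicQuotMap_padicMk]
      erw [padicQuotMap_padicMk]
  -- The sequence starts at p^r: `s n` is known modulo p^{r+n}, more than the completeness statement
  -- for p^n asks for.
  have hle : ∀ n, Ideal.span {(p : ℤ_[p]) ^ (r + n)} ≤ Ideal.span {(p : ℤ_[p])} ^ n := fun n => by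
    rw [Ideal.span_singleton_pow]
    exact span_pow_le (by omega)
  have hfac : ∀ n z, Ideal.Quotient.factorₐ ℤ_[p] (hle n) (padicMk p (r + n) z) =
      Ideal.Quotient.mk (Ideal.span {(p : ℤ_[p])} ^ n) z := fun _ _ => rfl
  have hfac' : ∀ {m n : ℕ} (h : m ≤ n) (z : ℤ_[p]),
      Ideal.Quotient.factorₐ ℤ_[p] (Ideal.pow_le_pow_right (I := Ideal.span {(p : ℤ_[p])}) h)
        (Ideal.Quotient.mk (Ideal.span {(p : ℤ_[p])} ^ n) z) =
      Ideal.Quotient.mk (Ideal.span {(p : ℤ_[p])} ^ m) z := fun _ _ => rfl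
  let f : ∀ n, C →ₐ[ℤ_[p]] ℤ_[p] ⧸ Ideal.span {(p : ℤ_[p])} ^ n :=
    fun n => (Ideal.Quotient.factorₐ ℤ_[p] (hle n)).comp (s n)
  have hf : ∀ {m n : ℕ} (h : m ≤ n),
      (Ideal.Quotient.factorₐ ℤ_[p] (Ideal.pow_le_pow_right h)).comp (f n) = f m := by
    intro m n h
    refine AlgHom.ext fun c => ?_
    simp only [f]
    rw [← hs' m n h]
    obtain ⟨z, hz⟩ := padicMk_surjective _ (s n c)
    rw [AlgHom.comp_apply, AlgHom.comp_apply, AlgHom.comp_apply, AlgHom.comp_apply, ← hz, hfac, hfac' h,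
      padicQuotMap_padicMk, hfac]
  let X := IsAdicComplete.liftAlgHom (Ideal.span {(p : ℤ_[p])}) f hf
  have hX : ∀ i, (padicMk p (r + i)).comp X = s i := by
    intro i
    refine AlgHom.ext fun c => ?_
    have h1 : Ideal.Quotient.mk (Ideal.span {(p : ℤ_[p])} ^ (r + i)) (X c) = f (r + i) c :=
      IsAdicComplete.mk_liftAlgHom _ _ hf _ _
    -- Because of this shift, the limit modulo p^{r+i} is read off from `s (r + i)`, whose reduction
    -- is `s i`.
    rw [← hs' i (r + i) (by omega)]
    obtain ⟨z, hz⟩ := padicMk_surjective _ (s (r + i) c)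
    simp only [f] at h1
    rw [AlgHom.comp_apply, ← hz, hfac] at h1
    have h2 := Ideal.Quotient.eq.1 h1
    rw [Ideal.span_singleton_pow] at h2
    rw [AlgHom.comp_apply, AlgHom.comp_apply, ← hz, padicQuotMap_padicMk, ← sub_eq_zero, ← map_sub,
      padicMk_eq_zero]
    exact h2
  refine ⟨X, (hX 0).trans hs0, fun n hn => ?_⟩
  obtain ⟨i, rfl⟩ := Nat.exists_eq_add_of_le hn
  rw [hX]
  exact hsP i

theorem eq_zero_of_forall_padicMk (r : ℕ) {z : ℤ_[p]} (h : ∀ n, r ≤ n → padicMk p n z = 0) :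
    z = 0 := by
  by_contra hz
  obtain ⟨n, hn⟩ : ∃ n : ℕ, (p : ℝ) ^ (-n : ℤ) < ‖z‖ := by
    obtain ⟨n, hn⟩ := PadicInt.exists_pow_neg_lt p (norm_pos_iff.2 hz)
    exact ⟨n, hn⟩
  have h1 := h (max r n) (le_max_left _ _)
  have h2 := span_pow_le (le_max_right r n) (padicMk_eq_zero.1 h1)
  rw [← PadicInt.norm_le_pow_iff_mem_span_pow] at h2
  exact absurd h2 (not_le.2 hn)

end Limit

end NormRel

namespace NormRel

/-! ### Integral points: the big cell and conjugation by `lam(p)` -/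

section PadicPoints

variable {p : ℕ} [Fact p.Prime] {O : Type} [CommRing O] [HopfAlgebra ℤ_[p] O]
  {lam : Points ℤ_[p] O ℤ_[p][T;T⁻¹]}

theorem points_ext_of_padicMk (r : ℕ) {x y : Points ℤ_[p] O ℤ_[p]}
    (h : ∀ n, r ≤ n → mapPts O (padicMk p n) x = mapPts O (padicMk p n) y) : x = y := by
  apply WithConv.ext
  refine AlgHom.ext fun a => sub_eq_zero.1 (eq_zero_of_forall_padicMk r fun n hn => ?_)
  rw [map_sub, sub_eq_zero]
  exact congrArg (fun x : Points ℤ_[p] O (PadicQuot p n) => x.ofConv a) (h n hn)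

theorem mem_parabolic_of_padicMk (r : ℕ) {x : Points ℤ_[p] O ℤ_[p]}
    (h : ∀ n, r ≤ n → mapPts O (padicMk p n) x ∈ parabolic lam (PadicQuot p n)) :
    x ∈ parabolic lam ℤ_[p] :=
  mem_parabolic_iff_wt.2 fun m hm a => eq_zero_of_forall_padicMk r fun n hn =>
    mem_parabolic_iff_wt.1 (h n hn) m hm a

theorem mem_unipotent_of_padicMk (r : ℕ) {x : Points ℤ_[p] O ℤ_[p]}
    (h : ∀ n, r ≤ n → mapPts O (padicMk p n) x ∈ unipotent lam (PadicQuot p n)) :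
    x ∈ unipotent lam ℤ_[p] := by
  refine mem_unipotent_iff_wt.2 ⟨mem_parabolic_of_padicMk r fun n hn =>
    unipotent_le_parabolic (h n hn), fun a => sub_eq_zero.1
      (eq_zero_of_forall_padicMk r fun n hn => ?_)⟩
  rw [map_sub, sub_eq_zero, AlgHom.commutes]
  exact (mem_unipotent_iff_wt.1 (h n hn)).2 a

/-! ### Points of G × G as homomorphisms from one ring, so that both factors are approximated
together -/

section Pairs

variable {k : Type} [CommRing k] {O : Type} [CommRing O] [HopfAlgebra k O]
  {R R' : Type} [CommRing R] [Algebra k R] [CommRing R'] [Algebra k R']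

/-- The first component of a point of `G × G`. -/
noncomputable def fstPt (x : O ⊗[k] O →ₐ[k] R) : Points k O R :=
  WithConv.toConv (x.comp Algebra.TensorProduct.includeLeft)

/-- The second component of a point of `G × G`. -/
noncomputable def sndPt (x : O ⊗[k] O →ₐ[k] R) : Points k O R :=
  WithConv.toConv (x.comp Algebra.TensorProduct.includeRight)

/-- The point of `G × G` with given components. -/
noncomputable def pairPt (g h : Points k O R) : O ⊗[k] O →ₐ[k] R :=
  Algebra.TensorProduct.lift g.ofConv h.ofConv (fun _ _ => .all ..)

theorem fstPt_pairPt (g h : Points k O R) : fstPt (pairPt g h) = g := by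
  apply WithConv.ext
  refine AlgHom.ext fun a => ?_
  simp [fstPt, pairPt]

theorem sndPt_pairPt (g h : Points k O R) : sndPt (pairPt g h) = h := by
  apply WithConv.ext
  refine AlgHom.ext fun a => ?_
  simp [sndPt, pairPt]

theorem fstPt_comp (f : R →ₐ[k] R') (x : O ⊗[k] O →ₐ[k] R) :
    fstPt (f.comp x) = mapPts O f (fstPt x) := rfl

theorem sndPt_comp (f : R →ₐ[k] R') (x : O ⊗[k] O →ₐ[k] R) :
    sndPt (f.comp x) = mapPts O f (sndPt x) := rfl

theorem pairPt_ext {x y : O ⊗[k] O →ₐ[k] R} (h₁ : fstPt x = fstPt y) (h₂ : sndPt x = sndPt y) :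
    x = y :=
  Algebra.TensorProduct.ext (congrArg WithConv.ofConv h₁) (congrArg WithConv.ofConv h₂)

/-- `x` is a point of `U_G(lam) × P_G(lam⁻¹)` with product `v`. -/
def IsBigCellPair (lam : Points k O k[T;T⁻¹]) (v : Points k O R) (x : O ⊗[k] O →ₐ[k] R) : Prop :=
  fstPt x ∈ unipotent lam R ∧ sndPt x ∈ parabolic lam⁻¹ R ∧ fstPt x * sndPt x = v

theorem isBigCellPair_pairPt {lam : Points k O k[T;T⁻¹]} {v n q : Points k O R}
    (hn : n ∈ unipotent lam R) (hq : q ∈ parabolic lam⁻¹ R) (h : n * q = v) :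
    IsBigCellPair lam v (pairPt n q) := by
  rw [IsBigCellPair, fstPt_pairPt, sndPt_pairPt]
  exact ⟨hn, hq, h⟩

theorem comp_pairPt_eq {f : R →ₐ[k] R'} {n q : Points k O R} {x : O ⊗[k] O →ₐ[k] R'}
    (hn : mapPts O f n = fstPt x) (hq : mapPts O f q = sndPt x) : f.comp (pairPt n q) = x :=
  pairPt_ext (by rw [fstPt_comp, fstPt_pairPt, hn]) (by rw [sndPt_comp, sndPt_pairPt, hq])

end Pairs

theorem IsCocharacter.exists_lift_padicQuot [Algebra.FormallySmooth ℤ_[p] O] (h : IsCocharacter lam) {n : ℕ}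
    (hn : 1 ≤ n) (v : Points ℤ_[p] O ℤ_[p]) {x y : Points ℤ_[p] O (PadicQuot p n)}
    (hx : x ∈ unipotent lam _) (hy : y ∈ parabolic lam⁻¹ _) (hv : x * y = mapPts O (padicMk p n) v) :
    ∃ x' ∈ unipotent lam (PadicQuot p (n + 1)), ∃ y' ∈ parabolic lam⁻¹ (PadicQuot p (n + 1)),
      x' * y' = mapPts O (padicMk p (n + 1)) v ∧ mapPts O (padicQuotMap (n.le_add_right 1)) x' = x ∧
      mapPts O (padicQuotMap (n.le_add_right 1)) y' = y := by
  have hv' : x * y = mapPts O (padicQuotMap (n.le_add_right 1)) (mapPts O (padicMk p (n + 1)) v) := hv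
  have hs := padicQuotMap_sqZero (p := p) hn
  have hj := (padicQuotMap_surjective (p := p) (n.le_add_right 1))
  exact h.exists_unipotent_mul_parabolic_lift hj hs hx hy hv'

/-- Points of `G(ℤ_p)` that reduce to `P_G(lam)` lie in the big cell `U_G(lam) · P_G(lam⁻¹)`. -/
theorem IsCocharacter.exists_unipotent_mul_parabolic [Algebra.FormallySmooth ℤ_[p] O]
    (h : IsCocharacter lam) {r : ℕ} (hr : 1 ≤ r) {v : Points ℤ_[p] O ℤ_[p]}
    (hv : mapPts O (padicMk p r) v ∈ parabolic lam (PadicQuot p r)) :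
    ∃ n ∈ unipotent lam ℤ_[p], ∃ q ∈ parabolic lam⁻¹ ℤ_[p], v = n * q := by
  -- Modulo p^r the Levi decomposition is already a big-cell decomposition, since the Levi subgroup
  -- lies in P_G(λ⁻¹). It starts the approximation.
  obtain ⟨n₀, hn₀, l₀, hl₀, hnl, -⟩ := h.exists_unipotent_mul_levi hv
  let P : ∀ n, (O ⊗[ℤ_[p]] O →ₐ[ℤ_[p]] PadicQuot p n) → Prop := fun n x =>
    IsBigCellPair lam (mapPts O (padicMk p n) v) x
  have hP : ∀ n, r ≤ n → ∀ x, P n x →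
      ∃ y, P (n + 1) y ∧ (padicQuotMap (n.le_add_right 1)).comp y = x := by
    rintro n hn x ⟨h1, h2, h3⟩
    obtain ⟨n', hn', q', hq', e1, e2, e3⟩ := h.exists_lift_padicQuot (hr.trans hn) v h1 h2 h3
    exact ⟨pairPt n' q', isBigCellPair_pairPt hn' hq' e1, comp_pairPt_eq e2 e3⟩
  have hP0 : P r (pairPt n₀ l₀) := isBigCellPair_pairPt hn₀
    (h.inv.levi_le_parabolic (by rwa [h.levi_inv])) hnl.symm
  obtain ⟨X, -, hX⟩ := exists_padic_lift r P hP _ hP0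
  refine ⟨fstPt X, mem_unipotent_of_padicMk r fun n hn => (hX n hn).1, sndPt X,
    mem_parabolic_of_padicMk r fun n hn => (hX n hn).2.1,
    (points_ext_of_padicMk r fun n hn => ?_).symm⟩
  rw [map_mul]
  exact (hX n hn).2.2

variable (p) in
/-- The uniformiser `p` as a unit of `ℚ_p`. -/
noncomputable def padicUnit : ℚ_[p]ˣ :=
  Units.mk0 (p : ℚ_[p]) (Nat.cast_ne_zero.2 (Fact.out : p.Prime).ne_zero)

theorem toRat_apply (g : Points ℤ_[p] O ℤ_[p]) (a : O) :
    (toRat p O g).ofConv a = ((g.ofConv a : ℤ_[p]) : ℚ_[p]) := rfl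

theorem toRat_injective : Function.Injective (toRat p O) :=
  mapPts_injective (Subtype.val_injective : Function.Injective (Algebra.ofId ℤ_[p] ℚ_[p]))

theorem mem_intPts_iff {g : Points ℤ_[p] O ℚ_[p]} :
    g ∈ intPts p O ↔ ∀ a, ‖g.ofConv a‖ ≤ 1 := by
  constructor
  · rintro ⟨g, rfl⟩ a
    exact (g.ofConv a).2
  · intro h
    have hint : ∀ a, g.ofConv a ∈ (Algebra.ofId ℤ_[p] ℚ_[p]).range := fun a => ⟨⟨_, h a⟩, rfl⟩
    have hinj : Function.Injective (Algebra.ofId ℤ_[p] ℚ_[p]) := Subtype.val_injective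
    refine ⟨WithConv.toConv ((AlgEquiv.ofInjective _ hinj).symm.toAlgHom.comp
      (g.ofConv.codRestrict _ hint)), ?_⟩
    apply WithConv.ext
    exact AlgHom.ext fun a => congrArg Subtype.val
      ((AlgEquiv.ofInjective _ hinj).apply_symm_apply (g.ofConv.codRestrict _ hint a))

theorem IsCocharacter.mem_intPts_iff_wt (h : IsCocharacter lam) {g : Points ℤ_[p] O ℚ_[p]} :
    g ∈ intPts p O ↔ ∀ n a, ‖g.ofConv (wt lam n a)‖ ≤ 1 := by
  rw [mem_intPts_iff]
  refine ⟨fun hg n a => hg _, fun hg a => ?_⟩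
  obtain ⟨s, -, hs⟩ := h.exists_eq_sum_wt a
  rw [hs, map_sum]
  exact IsUltrametricDist.norm_sum_le_of_forall_le_of_nonneg zero_le_one fun n _ => hg n a

theorem IsCocharacter.conj_pow_apply (h : IsCocharacter lam) (g : Points ℤ_[p] O ℚ_[p]) (s : ℕ)
    (n : ℤ) (a : O) :
    (loopAt lam (padicUnit p) ^ s * g * (loopAt lam (padicUnit p) ^ s)⁻¹).ofConv (wt lam n a) =
      g.ofConv (wt lam n a) * (p : ℚ_[p]) ^ ((s : ℤ) * n) := by
  rw [← h.loopAt_pow, h.conj_apply_wt', ← zpow_natCast, ← zpow_mul]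
  simp [padicUnit]

theorem padic_one_lt : (1 : ℝ) < p := Nat.one_lt_cast.2 (Fact.out : p.Prime).one_lt

/-- Conjugation multiplies weight n by p^{sn}, so integrality of the conjugate becomes one norm
bound for each weight. -/
theorem IsCocharacter.conj_pow_mem_intPts_iff (h : IsCocharacter lam)
    {g : Points ℤ_[p] O ℚ_[p]} {s : ℕ} :
    loopAt lam (padicUnit p) ^ s * g * (loopAt lam (padicUnit p) ^ s)⁻¹ ∈ intPts p O ↔
      ∀ n a, ‖g.ofConv (wt lam n a)‖ ≤ (p : ℝ) ^ ((s : ℤ) * n) := by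
  have hp : (0 : ℝ) < p := zero_lt_one.trans padic_one_lt
  rw [h.mem_intPts_iff_wt]
  refine forall_congr' fun n => forall_congr' fun a => ?_
  rw [h.conj_pow_apply, norm_mul, Padic.norm_p_zpow, zpow_neg, ← div_eq_mul_inv,
    div_le_one (zpow_pos hp _)]

/-- On weights n ≥ 0 integrality of g suffices; on n ≤ 0 the bound for t is weaker than the bound
for s. -/
theorem IsCocharacter.conj_pow_mem_intPts_of_le (h : IsCocharacter lam)
    {g : Points ℤ_[p] O ℚ_[p]} {s t : ℕ} (hts : t ≤ s) (hg : g ∈ intPts p O)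
    (hs : loopAt lam (padicUnit p) ^ s * g * (loopAt lam (padicUnit p) ^ s)⁻¹ ∈ intPts p O) :
    loopAt lam (padicUnit p) ^ t * g * (loopAt lam (padicUnit p) ^ t)⁻¹ ∈ intPts p O := by
  rw [h.conj_pow_mem_intPts_iff] at hs ⊢
  rw [h.mem_intPts_iff_wt] at hg
  intro n a
  have hts' : (t : ℤ) ≤ s := by exact_mod_cast hts
  rcases le_total 0 n with hn | hn
  · exact (hg n a).trans (one_le_zpow₀ padic_one_lt.le (by positivity))
  · exact (hs n a).trans (zpow_le_zpow_right₀ padic_one_lt.le (by nlinarith))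

theorem IsCocharacter.conj_pow_mem_intPts_of_mem_parabolic (h : IsCocharacter lam)
    {q : Points ℤ_[p] O ℤ_[p]} (hq : q ∈ parabolic lam ℤ_[p]) (s : ℕ) :
    loopAt lam (padicUnit p) ^ s * toRat p O q * (loopAt lam (padicUnit p) ^ s)⁻¹ ∈
      intPts p O := by
  rw [h.conj_pow_mem_intPts_iff]
  intro n a
  rw [toRat_apply]
  rcases lt_or_ge n 0 with hn | hn
  · rw [mem_parabolic_iff_wt.1 hq n hn a]
    simp only [PadicInt.coe_zero, norm_zero]
    positivity
  · exact (q.ofConv _).2.trans (one_le_zpow₀ padic_one_lt.le (by positivity))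

theorem padicMk_eq_zero_of_norm_le {z : ℤ_[p]} {s : ℕ} {m : ℤ} (hm : m ≤ -s)
    (hz : ‖(z : ℚ_[p])‖ ≤ (p : ℝ) ^ m) : padicMk p s z = 0 := by
  rw [padicMk_eq_zero, ← PadicInt.norm_le_pow_iff_mem_span_pow, PadicInt.norm_def]
  exact hz.trans (zpow_le_zpow_right₀ padic_one_lt.le hm)

/-- For n ≤ -1 the bound p^{sn} is at most p^{-s}, so all negative weights vanish modulo p^s. -/
theorem IsCocharacter.red_mem_parabolic (h : IsCocharacter lam) {g : Points ℤ_[p] O ℤ_[p]}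
    {s : ℕ} (hg : loopAt lam (padicUnit p) ^ s * toRat p O g * (loopAt lam (padicUnit p) ^ s)⁻¹ ∈
      intPts p O) : mapPts O (padicMk p s) g ∈ parabolic lam (PadicQuot p s) := by
  rw [h.conj_pow_mem_intPts_iff] at hg
  refine mem_parabolic_iff_wt.2 fun n hn a => ?_
  rw [mapPts_apply]
  exact padicMk_eq_zero_of_norm_le (m := (s : ℤ) * n) (by nlinarith) (hg n a)

theorem IsCocharacter.apply_wt_of_toRat_eq (h : IsCocharacter lam) {g g' : Points ℤ_[p] O ℤ_[p]}
    {s : ℕ} (hg : toRat p O g' =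
      loopAt lam (padicUnit p) ^ s * toRat p O g * (loopAt lam (padicUnit p) ^ s)⁻¹) (n : ℤ)
    (a : O) : ((g'.ofConv (wt lam n a) : ℤ_[p]) : ℚ_[p]) =
      ((g.ofConv (wt lam n a) : ℤ_[p]) : ℚ_[p]) * (p : ℚ_[p]) ^ ((s : ℤ) * n) := by
  rw [← toRat_apply, hg, h.conj_pow_apply, toRat_apply]

theorem IsCocharacter.apply_wt_of_toRat_eq_nat (h : IsCocharacter lam)
    {g g' : Points ℤ_[p] O ℤ_[p]} {s : ℕ} (hg : toRat p O g' =
      loopAt lam (padicUnit p) ^ s * toRat p O g * (loopAt lam (padicUnit p) ^ s)⁻¹) (n : ℕ)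
    (a : O) : g'.ofConv (wt lam n a) = g.ofConv (wt lam n a) * (p : ℤ_[p]) ^ (s * n) := by
  refine Subtype.val_injective ((h.apply_wt_of_toRat_eq hg n a).trans ?_)
  push_cast
  congr 1
  rw [← zpow_natCast]
  push_cast
  rfl

/-- Conjugation by `lam(p)` contracts `U_G(lam)` to the identity. -/
theorem IsCocharacter.exists_conj_unipotent (h : IsCocharacter lam) {n : Points ℤ_[p] O ℤ_[p]}
    (hn : n ∈ unipotent lam ℤ_[p]) (s : ℕ) : ∃ m, toRat p O m =
      loopAt lam (padicUnit p) ^ s * toRat p O n * (loopAt lam (padicUnit p) ^ s)⁻¹ ∧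
      mapPts O (padicMk p s) m = 1 := by
  obtain ⟨m, hm⟩ := h.conj_pow_mem_intPts_of_mem_parabolic (unipotent_le_parabolic hn) s
  refine ⟨m, hm, h.points_ext fun i a => ?_⟩
  rw [mapPts_apply, one_apply, algebraMap_counit_wt]
  rcases lt_trichotomy i 0 with hi | rfl | hi
  · have h1 := h.apply_wt_of_toRat_eq hm i a
    rw [mem_parabolic_iff_wt.1 (unipotent_le_parabolic hn) i hi a, PadicInt.coe_zero,
      zero_mul] at h1
    rw [if_neg hi.ne, (Subtype.val_injective h1 : m.ofConv (wt lam i a) = 0), map_zero]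
  · have h1 := h.apply_wt_of_toRat_eq_nat hm 0 a
    rw [Nat.cast_zero, mul_zero, pow_zero, mul_one, (mem_unipotent_iff_wt.1 hn).2] at h1
    rw [if_pos rfl, h1, AlgHom.commutes]
  · obtain ⟨j, rfl⟩ := Int.eq_ofNat_of_zero_le hi.le
    have hj : 1 ≤ j := by exact_mod_cast hi
    rw [h.apply_wt_of_toRat_eq_nat hm j a, if_neg hi.ne', padicMk_eq_zero,
      Ideal.mem_span_singleton]
    exact (pow_dvd_pow _ (Nat.le_mul_of_pos_right s hj)).mul_left _

/-- If `lam(p)^(r+1) g lam(p)^(-r-1)` is integral, then the conjugate of `g` by `lam(p)` lies in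
`U_G(lam) · L⁰` modulo `p^r` if `g` does. -/
theorem IsCocharacter.red_conj_mem_mirabolic (h : IsCocharacter lam)
    {L0 : ClosedSubgroup ℤ_[p] O} {r : ℕ} (hL : L0.points (PadicQuot p r) ≤ levi lam _)
    {g g' : Points ℤ_[p] O ℤ_[p]}
    (hg' : toRat p O g' = loopAt lam (padicUnit p) * toRat p O g * (loopAt lam (padicUnit p))⁻¹)
    (hg : loopAt lam (padicUnit p) ^ (r + 1) * toRat p O g *
      (loopAt lam (padicUnit p) ^ (r + 1))⁻¹ ∈ intPts p O)
    (hm : mapPts O (padicMk p r) g ∈ mirabolic lam L0 (PadicQuot p r)) :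
    mapPts O (padicMk p r) g' ∈ mirabolic lam L0 (PadicQuot p r) := by
  obtain ⟨y, hy⟩ := h.mirabolic_le_parabolic hL hm
  have hg1 : toRat p O g' = loopAt lam (padicUnit p) ^ 1 * toRat p O g *
      (loopAt lam (padicUnit p) ^ 1)⁻¹ := by rw [pow_one, hg']
  -- Modulo p^r, conjugation by λ(p) is the value at T = p of the polynomial loop. On weights n < 0
  -- both sides vanish: the norm is at most p^{(r+1)n} · p^{-n} = p^{rn}, which is where the
  -- exponent r + 1 is needed.
  convert h.evalAt_mem_mirabolic hL (padicMk p r (p : ℤ_[p])) hy hm using 1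
  refine h.points_ext fun n a => ?_
  rw [mapPts_apply, mapPts_apply]
  rcases lt_or_ge n 0 with hn | hn
  · rw [h.extension_wt_neg hy hn, map_zero]
    refine padicMk_eq_zero_of_norm_le (m := (r : ℤ) * n) (by nlinarith) ?_
    rw [h.apply_wt_of_toRat_eq hg1, norm_mul, Padic.norm_p_zpow]
    rw [h.conj_pow_mem_intPts_iff] at hg
    have hp : (0 : ℝ) < p := zero_lt_one.trans padic_one_lt
    refine (mul_le_mul_of_nonneg_right (hg n a) (zpow_nonneg hp.le _)).trans (le_of_eq ?_)
    rw [← zpow_add₀ hp.ne']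
    congr 1
    push_cast
    ring
  · obtain ⟨m, rfl⟩ := Int.eq_ofNat_of_zero_le hn
    rw [h.extension_wt hy, h.apply_wt_of_toRat_eq_nat hg1, evalAt_C_mul_X_pow, map_mul, map_pow,
      one_mul, mapPts_apply]

end PadicPoints

/-! ### The groups `U_r` and `V_r` -/

section Levels

variable {p : ℕ} [Fact p.Prime] {O : Type} [CommRing O] [HopfAlgebra ℤ_[p] O]
  {η : O →ₐc[ℤ_[p]] ℤ_[p][T;T⁻¹]} {L0 : ClosedSubgroup ℤ_[p] O}

theorem tau_eq (η : O →ₐc[ℤ_[p]] ℤ_[p][T;T⁻¹]) : tau η = loopAt (loopOf η) (padicUnit p) := rfl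

theorem loopAt_loopOf_inv (η : O →ₐc[ℤ_[p]] ℤ_[p][T;T⁻¹]) :
    loopAt (loopOf η)⁻¹ (padicUnit p) = (tau η)⁻¹ := loopAt_inv_left _ _

theorem isCocharacter_inv (η : O →ₐc[ℤ_[p]] ℤ_[p][T;T⁻¹]) : IsCocharacter (loopOf η)⁻¹ :=
  (isCocharacter_loopOf η).inv

theorem IsNormalInLevi.le_inv (hL : IsNormalInLevi η L0) (R : Type) [CommRing R]
    [Algebra ℤ_[p] R] : L0.points R ≤ levi (loopOf η)⁻¹ R := by
  rw [(isCocharacter_loopOf η).levi_inv]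
  exact hL.le R

theorem mem_groupU_iff {r : ℕ} {g : Points ℤ_[p] O ℚ_[p]} :
    g ∈ groupU η L0 r ↔ (∃ g₀, toRat p O g₀ = g ∧
      mapPts O (padicMk p r) g₀ ∈ mirabolic (loopOf η)⁻¹ L0 (PadicQuot p r)) ∧
      (tau η)⁻¹ ^ r * g * ((tau η)⁻¹ ^ r)⁻¹ ∈ intPts p O := by
  rw [inv_pow]
  constructor
  · rintro ⟨⟨g₀, h1, rfl⟩, h2⟩
    exact ⟨⟨g₀, rfl, h1⟩, h2⟩
  · rintro ⟨⟨g₀, rfl, h1⟩, h2⟩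
    exact ⟨⟨g₀, h1, rfl⟩, h2⟩

theorem toRat_mem_groupU_iff {r : ℕ} {g : Points ℤ_[p] O ℤ_[p]} :
    toRat p O g ∈ groupU η L0 r ↔
      mapPts O (padicMk p r) g ∈ mirabolic (loopOf η)⁻¹ L0 (PadicQuot p r) ∧
      (tau η)⁻¹ ^ r * toRat p O g * ((tau η)⁻¹ ^ r)⁻¹ ∈ intPts p O := by
  rw [mem_groupU_iff]
  refine and_congr_left fun _ => ⟨?_, fun h => ⟨g, rfl, h⟩⟩
  rintro ⟨g₀, h1, h2⟩
  rwa [← toRat_injective h1]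

/-- The mirabolic condition modulo p^r is inherited by the conjugate, by `red_conj_mem_mirabolic`.
So for g in U_r, membership in τ U_r τ⁻¹ is purely a question of integrality. -/
theorem conj_tau_mem_groupU (hL : IsNormalInLevi η L0) {r : ℕ} {g : Points ℤ_[p] O ℚ_[p]}
    (hg : g ∈ groupU η L0 r)
    (hg' : (tau η)⁻¹ ^ (r + 1) * g * ((tau η)⁻¹ ^ (r + 1))⁻¹ ∈ intPts p O) :
    (tau η)⁻¹ * g * tau η ∈ groupU η L0 r := by
  have h := isCocharacter_inv η
  obtain ⟨⟨g₀, rfl, hm⟩, -⟩ := mem_groupU_iff.1 hg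
  have h1 := h.conj_pow_mem_intPts_of_le (g := toRat p O g₀) (s := r + 1) (t := 1) (by omega)
    ⟨g₀, rfl⟩ (by rwa [loopAt_loopOf_inv])
  rw [loopAt_loopOf_inv, pow_one, inv_inv] at h1
  obtain ⟨g₁, hg₁⟩ := h1
  rw [← hg₁, toRat_mem_groupU_iff]
  refine ⟨h.red_conj_mem_mirabolic (hL.le_inv _) ?_ ?_ hm, ?_⟩
  · rw [loopAt_loopOf_inv, inv_inv, hg₁]
  · rwa [loopAt_loopOf_inv]
  · rw [hg₁]
    convert hg' using 1
    rw [pow_succ]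
    group

theorem groupU_succ_le (η : O →ₐc[ℤ_[p]] ℤ_[p][T;T⁻¹]) (L0 : ClosedSubgroup ℤ_[p] O) (r : ℕ) :
    groupU η L0 (r + 1) ≤ groupU η L0 r := by
  intro g hg
  obtain ⟨⟨g₀, rfl, hm⟩, hi⟩ := mem_groupU_iff.1 hg
  refine toRat_mem_groupU_iff.2 ⟨mapPts_mem_mirabolic (padicQuotMap (r.le_add_right 1)) hm, ?_⟩
  have h1 := (isCocharacter_inv η).conj_pow_mem_intPts_of_le (g := toRat p O g₀) (s := r + 1)
    (t := r) (by omega) ⟨g₀, rfl⟩ (by rwa [loopAt_loopOf_inv])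
  rwa [loopAt_loopOf_inv] at h1

/-- Gives U_{r+1} ⊆ U_r ∩ τ U_r τ⁻¹. The right side controls the mirabolic condition only modulo
p^r, so the inclusion can be strict; condition (B) removes the difference on Q_H⁰. -/
theorem conj_tau_mem_groupU_of_succ (hL : IsNormalInLevi η L0) {r : ℕ}
    {g : Points ℤ_[p] O ℚ_[p]} (hg : g ∈ groupU η L0 (r + 1)) :
    (tau η)⁻¹ * g * tau η ∈ groupU η L0 r :=
  conj_tau_mem_groupU hL (groupU_succ_le η L0 r hg) (mem_groupU_iff.1 hg).2

theorem conj_pow_succ_mem_intPts {r : ℕ} {g : Points ℤ_[p] O ℚ_[p]}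
    (hg : (tau η)⁻¹ * g * tau η ∈ groupU η L0 r) :
    (tau η)⁻¹ ^ (r + 1) * g * ((tau η)⁻¹ ^ (r + 1))⁻¹ ∈ intPts p O := by
  convert (mem_groupU_iff.1 hg).2 using 1
  rw [pow_succ]
  group

variable [Algebra.FiniteType ℤ_[p] O] {S : Submonoid (Points ℤ_[p] O ℚ_[p])}
  (hS : ∀ g ∈ intPts p O, g ∈ S)

theorem mem_levelV {r : ℕ} {v : Points ℤ_[p] O ℚ_[p]} :
    v ∈ (levelV hS η L0 r).toSubgroup ↔ tau η ^ r * v * (tau η ^ r)⁻¹ ∈ groupU η L0 r := by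
  refine (mem_map_conj (U := (levelU hS η L0 r).toSubgroup) (g := (tau η ^ r)⁻¹)).trans ?_
  rw [inv_inv]
  rfl

theorem levelV_succ_le (hL : IsNormalInLevi η L0) (r : ℕ) :
    (levelV hS η L0 (r + 1)).toSubgroup ≤ (levelV hS η L0 r).toSubgroup := by
  intro v hv
  rw [mem_levelV] at hv ⊢
  convert conj_tau_mem_groupU_of_succ hL hv using 1
  rw [pow_succ']
  group

theorem mem_levelV_interConj {r : ℕ} {v : Points ℤ_[p] O ℚ_[p]} :
    v ∈ ((levelV hS η L0 r).interConj (levelV hS η L0 r) (tau η)).toSubgroup ↔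
      v ∈ (levelV hS η L0 r).toSubgroup ∧
        (tau η)⁻¹ * v * tau η ∈ (levelV hS η L0 r).toSubgroup :=
  and_congr_right fun _ => mem_map_conj

/-- The element τ⁻¹ v τ lies in V_r, hence is integral, and this integrality is all that
`conj_tau_mem_groupU` needs at level r + 1. With the factorisation below, it makes the base change
square for 𝒯 Cartesian. -/
theorem mem_levelV_interConj_succ (hL : IsNormalInLevi η L0) {r : ℕ} {v : Points ℤ_[p] O ℚ_[p]}
    (hv : v ∈ (levelV hS η L0 (r + 1)).toSubgroup)
    (hv' : v ∈ ((levelV hS η L0 r).interConj (levelV hS η L0 r) (tau η)).toSubgroup) :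
    v ∈ ((levelV hS η L0 (r + 1)).interConj (levelV hS η L0 (r + 1)) (tau η)).toSubgroup := by
  rw [mem_levelV_interConj] at hv' ⊢
  refine ⟨hv, ?_⟩
  have h1 := (mem_groupU_iff.1 ((mem_levelV hS).1 hv'.2)).2
  rw [mem_levelV] at hv ⊢
  convert conj_tau_mem_groupU hL hv ?_ using 1
  · group
  · convert h1 using 1
    simp only [inv_pow]
    have : (tau η ^ (r + 1 + 1))⁻¹ = (tau η)⁻¹ * (tau η ^ (r + 1))⁻¹ := by
      rw [pow_succ (tau η) (r + 1), mul_inv_rev]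
    rw [this]
    group

/-- `V_r = (V_r ∩ τ V_r τ⁻¹) V_{r+1}`. -/
theorem exists_mul_of_mem_levelV [Algebra.FormallySmooth ℤ_[p] O] (hL : IsNormalInLevi η L0)
    {r : ℕ} (hr : 1 ≤ r) {v : Points ℤ_[p] O ℚ_[p]} (hv : v ∈ (levelV hS η L0 r).toSubgroup) :
    ∃ a ∈ ((levelV hS η L0 r).interConj (levelV hS η L0 r) (tau η)).toSubgroup,
      ∃ b ∈ (levelV hS η L0 (r + 1)).toSubgroup, v = a * b := by
  -- The big cell gives the factors in the order N_G · Q̄_G, opposite to the one wanted, so it is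
  -- applied to the inverse.
  suffices H : ∀ v ∈ (levelV hS η L0 r).toSubgroup, ∃ b ∈ (levelV hS η L0 (r + 1)).toSubgroup,
      ∃ a ∈ ((levelV hS η L0 r).interConj (levelV hS η L0 r) (tau η)).toSubgroup,
      v = b * a by
    obtain ⟨b, hb, a, ha, hab⟩ := H _ (inv_mem hv)
    exact ⟨a⁻¹, inv_mem ha, b⁻¹, inv_mem hb, by rw [← mul_inv_rev, ← hab, inv_inv]⟩
  intro v hv
  have h := isCocharacter_loopOf η
  have hv' := (mem_levelV hS).1 hv
  obtain ⟨v₀, rfl⟩ : v ∈ intPts p O := by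
    have := (mem_groupU_iff.1 hv').2
    convert this using 1
    rw [inv_pow]
    group
  -- Both v and τ^r v τ^{-r} are integral, so v reduces into Q_G = P_G(η), not its opposite.
  have h1 : mapPts O (padicMk p r) v₀ ∈ parabolic (loopOf η) (PadicQuot p r) :=
    h.red_mem_parabolic (groupU_le η L0 r hv')
  obtain ⟨n, hn, q, hq, rfl⟩ := h.exists_unipotent_mul_parabolic hr h1
  -- Conjugation by τ^{r+1} makes n congruent to 1 modulo p^{r+1}, so the mirabolic condition for
  -- U_{r+1} is trivially satisfied.
  have hnV : toRat p O n ∈ (levelV hS η L0 (r + 1)).toSubgroup := by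
    obtain ⟨m, hm, hm1⟩ := h.exists_conj_unipotent hn (r + 1)
    rw [mem_levelV, tau_eq, ← hm, toRat_mem_groupU_iff, hm1]
    refine ⟨one_mem _, ?_⟩
    rw [hm, ← tau_eq, inv_pow]
    refine ⟨n, ?_⟩
    group
  refine ⟨_, hnV, toRat p O q, (mem_levelV_interConj hS).2 ⟨?_, ?_⟩, map_mul _ _ _⟩
  · rw [map_mul] at hv
    exact (Subgroup.mul_mem_cancel_left _ (levelV_succ_le hS hL r hnV)).1 hv
  · have hqV : toRat p O q ∈ (levelV hS η L0 r).toSubgroup := by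
      rw [map_mul] at hv
      exact (Subgroup.mul_mem_cancel_left _ (levelV_succ_le hS hL r hnV)).1 hv
    rw [mem_levelV] at hqV ⊢
    -- Since q lies in P_G(η⁻¹), its conjugate τ⁻¹ q τ is integral, which is the missing condition
    -- for τ V_r τ⁻¹.
    have h2 := (isCocharacter_inv η).conj_pow_mem_intPts_of_mem_parabolic hq 1
    rw [loopAt_loopOf_inv] at h2
    convert conj_tau_mem_groupU hL hqV ?_ using 1
    · group
    · convert h2 using 1
      simp only [inv_pow, pow_one]
      have : (tau η ^ (r + 1))⁻¹ = (tau η)⁻¹ * (tau η ^ r)⁻¹ := by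
        rw [pow_succ (tau η) r, mul_inv_rev]
      rw [this]
      group

end Levels

end NormRel

/-! ### The orbit map on points -/

namespace NormRel

/-- Relative lifting becomes absolute once B and B' are A-algebras through b and f ∘ b: `hx` says
that x is A-linear, and A-linearity of the lift is the first required identity. -/
theorem exists_lift_of_formallySmooth {k A C B B' : Type} [CommRing k] [CommRing A] [Algebra k A]
    [CommRing C] [Algebra k C] [CommRing B] [Algebra k B] [CommRing B'] [Algebra k B']
    (φ : A →ₐ[k] C) (hφ : φ.toRingHom.Smooth) (b : A →ₐ[k] B) {f : B →ₐ[k] B'}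
    (hf : Function.Surjective f) (hI : ∀ x y, f x = 0 → f y = 0 → x * y = 0) (x : C →ₐ[k] B')
    (hx : x.comp φ = f.comp b) : ∃ y : C →ₐ[k] B, y.comp φ = b ∧ f.comp y = x := by
  let iC : Algebra A C := φ.toRingHom.toAlgebra
  let iB : Algebra A B := b.toRingHom.toAlgebra
  let iB' : Algebra A B' := (f.comp b).toRingHom.toAlgebra
  have hsm : Algebra.Smooth A C := hφ
  have hn : IsNilpotent (RingHom.ker (f : B →+* B')) := by
    refine ⟨2, ?_⟩
    rw [pow_two, Ideal.zero_eq_bot, eq_bot_iff, Ideal.mul_le]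
    exact fun x hx y hy => hI x y hx hy
  let f' : B →ₐ[A] B' := { f.toRingHom with commutes' := fun a => rfl }
  let x' : C →ₐ[A] B' := { x.toRingHom with commutes' := fun a => DFunLike.congr_fun hx a }
  let y' := Algebra.FormallySmooth.liftOfSurjective x' f' hf hn
  have hy' : ∀ c, f' (y' c) = x' c := Algebra.FormallySmooth.liftOfSurjective_apply x' f' hf hn
  have hyφ : ∀ a, y' (φ a) = b a := fun a => y'.commutes a
  refine ⟨{ y'.toRingHom with commutes' := fun c => ?_ }, AlgHom.ext hyφ, AlgHom.ext hy'⟩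
  have h1 := hyφ (algebraMap k A c)
  rw [AlgHom.commutes, AlgHom.commutes] at h1
  exact h1

section Orbit

variable {k OG OH : Type} [CommRing k] [CommRing OG] [HopfAlgebra k OG]
  [CommRing OH] [HopfAlgebra k OH] {R R' : Type} [CommRing R] [Algebra k R]
  [CommRing R'] [Algebra k R']

theorem mapPts_precomp (f : R →ₐ[k] R') (ι : OG →ₐc[k] OH) (h : Points k OH R) :
    mapPts OG f (precomp R ι h) = precomp R' ι (mapPts OH f h) := rfl

theorem mapPts_ofId (f : R →ₐ[k] R') (u : Points k OG k) :
    mapPts OG f (mapPts OG (Algebra.ofId k R) u) = mapPts OG (Algebra.ofId k R') u := by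
  have h : f.comp (Algebra.ofId k R) = Algebra.ofId k R' := AlgHom.ext fun c => f.commutes c
  rw [mapPts_mapPts, h]

variable (ι : OG →ₐc[k] OH) (QH0 : ClosedSubgroup k OH) (η : OG →ₐc[k] k[T;T⁻¹])
  (u : Points k OG k)

/-- A homomorphism from the orbit ring is a pair (h, q); this evaluates the orbit morphism on it as
h u q. -/
theorem mapPts_orbitHom (x : OrbitRing QH0 η →ₐ[k] R) :
    WithConv.toConv (x.comp (orbitHom ι QH0 η u)) =
      precomp R ι (mapPts OH x (orbitPtH QH0 η)) * mapPts OG (Algebra.ofId k R) u *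
        mapPts OG x (orbitPtG QH0 η) := by
  have h1 : WithConv.toConv (x.comp (orbitHom ι QH0 η u)) =
      mapPts OG x (precomp (OrbitRing QH0 η) ι (orbitPtH QH0 η) *
        mapPts OG (Algebra.ofId k (OrbitRing QH0 η)) u * orbitPtG QH0 η) := rfl
  rw [h1, map_mul, map_mul, mapPts_ofId, mapPts_precomp]

theorem mapPts_orbitPtH_mem (x : OrbitRing QH0 η →ₐ[k] R) :
    mapPts OH x (orbitPtH QH0 η) ∈ QH0.points R := by
  refine (QH0.mem_points _).2 fun a ha => ?_
  change x.comp (Algebra.TensorProduct.includeLeft : OH ⧸ QH0.ideal →ₐ[k] OrbitRing QH0 η)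
    (Ideal.Quotient.mk QH0.ideal a) = 0
  rw [Ideal.Quotient.eq_zero_iff_mem.2 ha, map_zero]

theorem mapPts_orbitPtG_mem (x : OrbitRing QH0 η →ₐ[k] R) :
    mapPts OG x (orbitPtG QH0 η) ∈ parabolic (loopOf η)⁻¹ R := by
  refine (mem_parabolic_iff _ _).2 fun a ha => ?_
  change x.comp (Algebra.TensorProduct.includeRight :
    OG ⧸ parabolicIdeal (loopOf η)⁻¹ →ₐ[k] OrbitRing QH0 η)
    (Ideal.Quotient.mk (parabolicIdeal (loopOf η)⁻¹) a) = 0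
  rw [Ideal.Quotient.eq_zero_iff_mem.2 ha, map_zero]

theorem exists_orbitRing_hom {h : Points k OH R} (hh : h ∈ QH0.points R) {q : Points k OG R}
    (hq : q ∈ parabolic (loopOf η)⁻¹ R) : ∃ x : OrbitRing QH0 η →ₐ[k] R,
      mapPts OH x (orbitPtH QH0 η) = h ∧ mapPts OG x (orbitPtG QH0 η) = q := by
  let f₁ : OH ⧸ QH0.ideal →ₐ[k] R :=
    Ideal.Quotient.liftₐ QH0.ideal h.ofConv ((QH0.mem_points h).1 hh)
  let f₂ : OG ⧸ parabolicIdeal (loopOf η)⁻¹ →ₐ[k] R :=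
    Ideal.Quotient.liftₐ (parabolicIdeal (loopOf η)⁻¹) q.ofConv ((mem_parabolic_iff _ q).1 hq)
  have hc : ∀ x y, Commute (f₁ x) (f₂ y) := fun _ _ => .all ..
  refine ⟨Algebra.TensorProduct.lift f₁ f₂ hc, ?_, ?_⟩
  · apply WithConv.ext
    exact AlgHom.ext fun a => DFunLike.congr_fun
      (Algebra.TensorProduct.lift_comp_includeLeft f₁ f₂ hc) (Ideal.Quotient.mk QH0.ideal a)
  · apply WithConv.ext
    exact AlgHom.ext fun a => DFunLike.congr_fun
      (Algebra.TensorProduct.lift_comp_includeRight f₁ f₂ hc)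
      (Ideal.Quotient.mk (parabolicIdeal (loopOf η)⁻¹) a)

end Orbit

/-! ### Consequences of (A) and (B) for `U_r` -/

section PadicOrbit

variable {p : ℕ} [Fact p.Prime] {OG OH : Type} [CommRing OG] [HopfAlgebra ℤ_[p] OG]
  [CommRing OH] [HopfAlgebra ℤ_[p] OH] {ι : OG →ₐc[ℤ_[p]] OH} {QH0 : ClosedSubgroup ℤ_[p] OH}
  {η : OG →ₐc[ℤ_[p]] ℤ_[p][T;T⁻¹]} {LG0 : ClosedSubgroup ℤ_[p] OG} {u : Points ℤ_[p] OG ℤ_[p]}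

/-- One step of Hensel lifting in the fibre of the orbit morphism over w, along a square-zero
reduction. -/
theorem exists_orbit_lift_step (hA : (orbitHom ι QH0 η u).toRingHom.Smooth)
    (w : Points ℤ_[p] OG ℤ_[p]) {n : ℕ} (hn : 1 ≤ n)
    (x : OrbitRing QH0 η →ₐ[ℤ_[p]] PadicQuot p n)
    (hx : x.comp (orbitHom ι QH0 η u) = (padicMk p n).comp w.ofConv) :
    ∃ y : OrbitRing QH0 η →ₐ[ℤ_[p]] PadicQuot p (n + 1),
      y.comp (orbitHom ι QH0 η u) = (padicMk p (n + 1)).comp w.ofConv ∧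
      (padicQuotMap (n.le_add_right 1)).comp y = x := by
  have hs := padicQuotMap_sqZero (p := p) hn
  have hj := padicQuotMap_surjective (p := p) (n.le_add_right 1)
  have hx' : x.comp (orbitHom ι QH0 η u) =
      (padicQuotMap (n.le_add_right 1)).comp ((padicMk p (n + 1)).comp w.ofConv) := hx
  exact exists_lift_of_formallySmooth (orbitHom ι QH0 η u) hA _ hj hs x hx'

/-- The orbit map lifts points congruent to the base point. -/
theorem exists_orbit_eq (hA : HasOpenOrbit ι QH0 η u) {r : ℕ} (hr : 1 ≤ r)
    {g : Points ℤ_[p] OG ℤ_[p]}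
    (hg : mapPts OG (padicMk p r) g ∈ parabolic (loopOf η)⁻¹ (PadicQuot p r)) :
    ∃ h ∈ QH0.points ℤ_[p], ∃ q ∈ parabolic (loopOf η)⁻¹ ℤ_[p],
      mapPts OG (padicMk p r) q = mapPts OG (padicMk p r) g ∧ precomp ℤ_[p] ι h * u * q = u * g := by
  -- The initial solution is the pair (1, g mod p^r), a point of Q_H⁰ × Q̄_G mapping to u g.
  obtain ⟨x, hx1, hx2⟩ := exists_orbitRing_hom QH0 η (one_mem (QH0.points (PadicQuot p r))) hg
  let P : ∀ n, (OrbitRing QH0 η →ₐ[ℤ_[p]] PadicQuot p n) → Prop := fun n x =>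
    x.comp (orbitHom ι QH0 η u) = (padicMk p n).comp (u * g).ofConv
  have hP0 : P r x := by
    refine congrArg WithConv.ofConv ((mapPts_orbitHom ι QH0 η u x).trans ?_)
    rw [hx1, hx2, map_one, one_mul]
    exact (map_mul (mapPts OG (padicMk p r)) u g).symm
  obtain ⟨X, hX, hXP⟩ := exists_padic_lift r P
    (fun n hn x hx => exists_orbit_lift_step hA.smooth (u * g) (hr.trans hn) x hx) x hP0
  refine ⟨_, mapPts_orbitPtH_mem QH0 η X, _, mapPts_orbitPtG_mem QH0 η X, ?_, ?_⟩
  · rw [mapPts_mapPts, hX, hx2]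
  · have h1 := mapPts_orbitHom ι QH0 η u X
    have h2 : mapPts OG (Algebra.ofId ℤ_[p] ℤ_[p]) u = u := rfl
    rw [h2] at h1
    rw [← h1]
    exact points_ext_of_padicMk r fun n hn => WithConv.ext (hXP n hn)

theorem toRat_precomp (h : Points ℤ_[p] OH ℤ_[p]) :
    toRat p OG (precomp ℤ_[p] ι h) = precomp ℚ_[p] ι (toRat p OH h) := rfl

/-- The stabiliser condition: elements of `u⁻¹ Q_H⁰(ℤ_p) u` whose conjugates are integral lie
in `U_s`. -/
theorem conj_mem_groupU (hB : StabilizerLE ι QH0 η LG0 u) {h : Points ℤ_[p] OH ℚ_[p]}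
    (hh : h ∈ mirabolicPts QH0) {s : ℕ}
    (hs : (tau η)⁻¹ ^ s * ((toRat p OG u)⁻¹ * precomp ℚ_[p] ι h * toRat p OG u) *
      ((tau η)⁻¹ ^ s)⁻¹ ∈ intPts p OG) :
    (toRat p OG u)⁻¹ * precomp ℚ_[p] ι h * toRat p OG u ∈ groupU η LG0 s := by
  obtain ⟨h₀, hh₀, rfl⟩ := hh
  rw [← toRat_precomp, ← map_inv, ← map_mul, ← map_mul] at hs ⊢
  refine toRat_mem_groupU_iff.2 ⟨?_, hs⟩
  -- Integrality of the conjugate puts the reduction modulo p^s in Q̄_G; condition (B) over ℤ/p^s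
  -- then puts it in Q̄_G⁰.
  have h1 := (isCocharacter_inv η).red_mem_parabolic
    (g := u⁻¹ * precomp ℤ_[p] ι h₀ * u) (s := s) (by rwa [loopAt_loopOf_inv])
  have h2 := hB (PadicQuot p s) (mapPts OH (padicMk p s) h₀) (mapPts_mem_points _ hh₀)
  have h3 : mapPts OG (Algebra.ofId ℤ_[p] (PadicQuot p s)) u = mapPts OG (padicMk p s) u := rfl
  rw [h3, ← mapPts_precomp, ← map_inv, ← map_mul, ← map_mul] at h2
  exact h2 h1

/-- `U_r` is generated by `u⁻¹ Q_H⁰(ℤ_p) u ∩ U_r` and `U_r ∩ τ U_r τ⁻¹`. -/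
theorem exists_mul_of_mem_groupU (hL : IsNormalInLevi η LG0) (hA : HasOpenOrbit ι QH0 η u)
    {r : ℕ} (hr : 1 ≤ r) {g : Points ℤ_[p] OG ℚ_[p]} (hg : g ∈ groupU η LG0 r) :
    ∃ h ∈ mirabolicPts QH0, ∃ q ∈ groupU η LG0 r, (tau η)⁻¹ * q * tau η ∈ groupU η LG0 r ∧
      g = (toRat p OG u)⁻¹ * precomp ℚ_[p] ι h * toRat p OG u * q := by
  obtain ⟨⟨g₀, rfl, hm⟩, hi⟩ := mem_groupU_iff.1 hg
  have hc := isCocharacter_inv η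
  obtain ⟨h, hh, q, hq, hqg, he⟩ := exists_orbit_eq hA hr
    (hc.mirabolic_le_parabolic (hL.le_inv _) hm)
  -- As q is a ℤ_p-point of Q̄_G, all these conjugates are integral. The mirabolic condition passes
  -- from g to q because they agree modulo p^r.
  have hint : ∀ s, (tau η)⁻¹ ^ s * toRat p OG q * ((tau η)⁻¹ ^ s)⁻¹ ∈ intPts p OG := by
    intro s
    have := hc.conj_pow_mem_intPts_of_mem_parabolic hq s
    rwa [loopAt_loopOf_inv] at this
  have hqU : toRat p OG q ∈ groupU η LG0 r :=
    toRat_mem_groupU_iff.2 ⟨by rwa [hqg], hint r⟩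
  refine ⟨toRat p OH h, ⟨h, hh, rfl⟩, _, hqU, conj_tau_mem_groupU hL hqU (hint _), ?_⟩
  rw [← toRat_precomp, ← map_inv, ← map_mul, ← map_mul, ← map_mul]
  congr 1
  rw [mul_assoc, mul_assoc, ← mul_assoc (precomp ℤ_[p] ι h), he, inv_mul_cancel_left]

end PadicOrbit

end NormRel

namespace NormRel

/-! ### Base change for the Hecke operator and for the pushforward map -/

section Cohomology

variable {G : Type*} [Group G] [TopologicalSpace G] {S : Submonoid G} {A : Type*} [CommRing A]

theorem relIndex_ne_zero_of_isOpen [IsTopologicalGroup G] (Γ : Level S) {K W : Subgroup G}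
    (hK : K ≤ Γ.toSubgroup) (hW : IsOpen (W : Set G)) : W.relIndex K ≠ 0 := by
  have hc : CompactSpace Γ.toSubgroup := isCompact_iff_compactSpace.1 Γ.isCompact
  have hf : Finite (Γ.toSubgroup ⧸ W.subgroupOf Γ.toSubgroup) :=
    Subgroup.quotient_finite_of_isOpen _ (hW.preimage continuous_subtype_val)
  have hf' : Finite (K ⧸ W.subgroupOf K) :=
    Finite.of_injective _ (Subgroup.quotientSubgroupOfEmbeddingOfLE W hK).injective
  exact Nat.card_pos.ne'

namespace CohomologyFunctor

variable (M : CohomologyFunctor S A)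

/-- Pushforwards along isomorphisms commute with restrictions. -/
theorem prPull_push {W V W' V' : Level S} {g : G} (hg : g⁻¹ ∈ S)
    (hWV : Carries g W.toSubgroup V.toSubgroup) (hVW : Carries g⁻¹ V.toSubgroup W.toSubgroup)
    (hWV' : Carries g W'.toSubgroup V'.toSubgroup) (hVW' : Carries g⁻¹ V'.toSubgroup W'.toSubgroup)
    (hW : W'.toSubgroup ≤ W.toSubgroup) (hV : V'.toSubgroup ≤ V.toSubgroup) (x : M.obj W) :
    M.prPull hV (M.push g hg hWV x) = M.push g hg hWV' (M.prPull hW x) := by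
  -- A pushforward along an isomorphism is the pullback along g⁻¹, so both sides become the same
  -- composite pullback.
  have key : ∀ {W V : Level S} (h : Carries g W.toSubgroup V.toSubgroup)
      (h' : Carries g⁻¹ V.toSubgroup W.toSubgroup), M.push g hg h = M.pull g⁻¹ hg h' := by
    intro W V h h'
    have hg' : g⁻¹⁻¹⁻¹ ∈ S := by rwa [inv_inv]
    have h'' : Carries g⁻¹⁻¹ W.toSubgroup V.toSubgroup := by rwa [inv_inv]
    rw [M.pull_eq_push g⁻¹ hg hg' h' h'']
    exact M.push_coset _ _ _ _ _ _ ⟨1, one_mem _, 1, one_mem _, by simp⟩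
  rw [key hWV hVW, key hWV' hVW']
  have hc : Carries g⁻¹ V'.toSubgroup W.toSubgroup := fun y hy => hW (hVW' y hy)
  rw [prPull, prPull, M.pull_pull (one_mul g⁻¹) _ _ hg _ _ hc, M.pull_pull (mul_one g⁻¹) _ _ hg _ _ hc]

/-- If `x` and `x''` are classes at levels `W'' ⊆ W' ⊆ W` with `pr^⋆ x = pr_⋆ x''` in `M(W')`, and
`g` carries `W` and `W'` isomorphically to `V` and `V ∩ τ V τ⁻¹`, then
`pr_⋆ [g τ]_⋆ x'' = [τ]_⋆ pr^⋆ [g]_⋆ x`. -/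
theorem prPush_push_eq_hecke_push [IsTopologicalGroup G] {g τ k : G} (hg : g⁻¹ ∈ S) (hτ : τ⁻¹ ∈ S)
    (hk : k⁻¹ ∈ S) (hkg : g * τ = k) {V V₁ W W' W'' : Level S}
    (hV : V₁.toSubgroup ≤ V.toSubgroup)
    (hWV : Carries g W.toSubgroup V.toSubgroup) (hVW : Carries g⁻¹ V.toSubgroup W.toSubgroup)
    (hWV' : Carries g W'.toSubgroup (V.interConj V τ).toSubgroup)
    (hVW' : Carries g⁻¹ (V.interConj V τ).toSubgroup W'.toSubgroup)
    (hW' : W'.toSubgroup ≤ W.toSubgroup) (hW'' : W''.toSubgroup ≤ W'.toSubgroup)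
    (hc : Carries k W''.toSubgroup V₁.toSubgroup) {x : M.obj W} {x'' : M.obj W''}
    (h : M.prPull hW' x = M.prPush hW'' x'') :
    M.prPush hV (M.push k hk hc x'') = M.hecke τ hτ V (M.push g hg hWV x) := by
  have hc' : Carries k W''.toSubgroup V.toSubgroup := fun y hy => hV (hc y hy)
  have hc2 : Carries g W''.toSubgroup (V.interConj V τ).toSubgroup :=
    fun y hy => hWV' y (hW'' hy)
  simp only [hecke, LinearMap.comp_apply]
  rw [M.prPull_push hg hWV hVW hWV' hVW' hW' (V.interConj_le V τ), h, prPush, prPush,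
    M.push_push (mul_one k) _ _ hk _ _ hc', M.push_push (one_mul g) _ _ hg _ _ hc2,
    M.push_push hkg _ _ hk _ _ hc']

theorem isIwPull_congr {g g' : G} (e : g = g') (hg : g ∈ S) (hg' : g' ∈ S) {K K' : Subgroup G}
    {x : M.Iw K} {y : M.Iw K'} (h : M.IsIwPull g hg x y) : M.IsIwPull g' hg' x y := by
  subst e
  exact h

theorem isIwPush_congr {g g' : G} (e : g = g') (hg : g⁻¹ ∈ S) (hg' : g'⁻¹ ∈ S) {K K' : Subgroup G}
    {x : M.Iw K} {y : M.Iw K'} (h : M.IsIwPush g hg x y) : M.IsIwPush g' hg' x y := by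
  subst e
  exact h

/-- `[τ]_⋆ pr^⋆` commutes with the trace from `V⁺` to `V`, if
`V = (V ∩ τ V τ⁻¹) V⁺` and `V⁺ ∩ τ V τ⁻¹ ⊆ τ V⁺ τ⁻¹`. -/
theorem IsCartesian.prPush_hecke [IsTopologicalGroup G] {M : CohomologyFunctor S A}
    (hM : M.IsCartesian) {τ : G} (hτ : τ⁻¹ ∈ S) {V V' : Level S}
    (h : V'.toSubgroup ≤ V.toSubgroup)
    (hi : ∀ v ∈ V'.toSubgroup, v ∈ (V.interConj V τ).toSubgroup →
      v ∈ (V'.interConj V' τ).toSubgroup)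
    (hm : ∀ v ∈ V.toSubgroup, ∃ a ∈ (V.interConj V τ).toSubgroup, ∃ b ∈ V'.toSubgroup, v = a * b)
    (x : M.obj V') : M.prPush h (M.hecke τ hτ V' x) = M.hecke τ hτ V (M.prPush h x) := by
  have hle : (V'.interConj V' τ).toSubgroup ≤ (V.interConj V τ).toSubgroup :=
    le_inf ((V'.interConj_le V' τ).trans h) (inf_le_right.trans (Subgroup.map_mono h))
  have h1 : Carries τ (V'.interConj V' τ).toSubgroup V.toSubgroup :=
    fun y hy => h (V'.carries_interConj V' τ y hy)
  simp only [hecke, LinearMap.comp_apply]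
  -- By `hi`, the intersection of V ∩ τ V τ⁻¹ with V' is V' ∩ τ V' τ⁻¹, the level that defines the
  -- Hecke operator at V'.
  rw [hM.prPull_prPush (V.interConj_le V τ) h hle (V'.interConj_le V' τ)
    (fun v hv hv' => hi v hv' hv) hm, prPush, prPush,
    M.push_push (mul_one τ) _ _ hτ _ _ h1, M.push_push (one_mul τ) _ _ hτ _ _ h1]

end CohomologyFunctor

variable {H : Type*} [Group H] [TopologicalSpace H] {ι : H →* G}
  {MH : CohomologyFunctor (S.comap ι) A} {MG : CohomologyFunctor S A}

theorem PushforwardMap.iwProj_app_prPush (f : PushforwardMap ι MH MG) {U V : Level (S.comap ι)}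
    (h : U.toSubgroup ≤ V.toSubgroup) {W W' : Level S} (hW : U.toSubgroup.map ι ≤ W.toSubgroup)
    (hW' : V.toSubgroup.map ι ≤ W'.toSubgroup) (hWW' : W.toSubgroup ≤ W'.toSubgroup)
    (x : MH.obj U) : MG.iwProj W' hW' (f.app V (MH.prPush h x)) =
      MG.prPush hWW' (MG.iwProj W hW (f.app U x)) :=
  MG.isIwPush_congr (map_one ι) (by simp) (by simp)
    (f.push_compat 1 (by simp) (by simp) (carries_one h) x) W W' hW hW' (carries_one hWW')

theorem PushforwardMap.iwProj_app_prPull (f : PushforwardMap ι MH MG) {U V : Level (S.comap ι)}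
    (h : U.toSubgroup ≤ V.toSubgroup) {W W' : Level S} (hW : V.toSubgroup.map ι ≤ W.toSubgroup)
    (hW' : U.toSubgroup.map ι ≤ W'.toSubgroup) (hWW' : W'.toSubgroup ≤ W.toSubgroup)
    (hi : W'.toSubgroup ⊓ V.toSubgroup.map ι = U.toSubgroup.map ι)
    (hm : ∀ w ∈ W.toSubgroup, ∃ a ∈ W'.toSubgroup, ∃ b ∈ V.toSubgroup.map ι, w = a * b)
    (x : MH.obj V) : MG.iwProj W' hW' (f.app U (MH.prPull h x)) =
      MG.prPull hWW' (MG.iwProj W hW (f.app V x)) :=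
  MG.isIwPull_congr (map_one ι) (by simp) (by simp)
    (f.pull_compat 1 (one_mem _) (carries_one h) x) W W' hW hW' (carries_one hWW')
    (by rw [map_conj_one_inv, map_conj_one_inv, hi])
    (by rw [map_conj_one_inv, map_conj_one_inv, relIndex_eq_of_exists_mul hW hm,
      ← Subgroup.inf_relIndex_right, hi])

/-- Compatibility of the classes at levels `W'' ⊆ W' ⊆ W` with `K ∩ W'' = K ∩ W'` and
`W = W' K`. -/
theorem PushforwardMap.prPull_toLevel [IsTopologicalGroup G] [IsTopologicalGroup H]
    (hι : Topology.IsClosedEmbedding ι) (f : PushforwardMap ι MH MG) (hM : MH.IsCartesian)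
    (Γ : Level (S.comap ι)) {K : Subgroup H} (hK : K ≤ Γ.toSubgroup) {W W' W'' : Level S}
    (hW' : W'.toSubgroup ≤ W.toSubgroup) (hW'' : W''.toSubgroup ≤ W'.toSubgroup)
    (hi : ∀ x ∈ K, ι x ∈ W'.toSubgroup → ι x ∈ W''.toSubgroup)
    (hm : ∀ w ∈ W.toSubgroup, ∃ a ∈ W'.toSubgroup, ∃ b ∈ K, w = a * ι b) (z : MH.Iw K) :
    MG.prPull hW' (f.toLevel hι W inf_le_right (MH.iwPull Γ hM hK (W.comap ι hι).isOpen z)) =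
      MG.prPush hW''
        (f.toLevel hι W'' inf_le_right (MH.iwPull Γ hM hK (W''.comap ι hι).isOpen z)) := by
  have h1 : (W'.comap ι hι).toSubgroup ≤ (W.comap ι hι).toSubgroup := Subgroup.comap_mono hW'
  have h2 : (W''.comap ι hι).toSubgroup ≤ (W'.comap ι hι).toSubgroup := Subgroup.comap_mono hW''
  have hmem : ∀ {w a b}, w ∈ W.toSubgroup → a ∈ W'.toSubgroup → w = a * ι b →
      b ∈ W.toSubgroup.comap ι := by
    rintro w a b hw ha rfl
    exact (Subgroup.mul_mem_cancel_left _ (hW' ha)).1 hw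
  have hK2 : K ⊓ (W''.comap ι hι).toSubgroup ≤ (W'.comap ι hι).toSubgroup := inf_le_right.trans h2
  -- Both sides are the image of one class on H: the component at H ∩ W' of the restriction of z to
  -- K ∩ W''. The left side reaches it by pullback from H ∩ W (`e1`, `e3`, using W = W' K), the
  -- right side by trace from H ∩ W'' (`e2`, `e4`).
  have e1 := f.iwProj_app_prPull h1 (W := W) (W' := W') (Subgroup.map_comap_le _ _)
    (Subgroup.map_comap_le _ _) hW' (by
      refine le_antisymm ?_ (le_inf (Subgroup.map_comap_le _ _) (Subgroup.map_mono h1))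
      rintro _ ⟨hx, y, -, rfl⟩
      exact ⟨y, hx, rfl⟩) (by
      intro w hw
      obtain ⟨a, ha, b, hb, hab⟩ := hm w hw
      exact ⟨a, ha, ι b, ⟨b, hmem hw ha hab, rfl⟩, hab⟩)
    (MH.iwProj (W.comap ι hι) inf_le_right (MH.iwPull Γ hM hK (W.comap ι hι).isOpen z))
  have e2 := f.iwProj_app_prPush h2 (W := W'') (W' := W') (Subgroup.map_comap_le _ _)
    (Subgroup.map_comap_le _ _) hW''
    (MH.iwProj (W''.comap ι hι) inf_le_right (MH.iwPull Γ hM hK (W''.comap ι hι).isOpen z))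
  have e3 := CohomologyFunctor.prPull_iwPull MH Γ hM hK (W.comap ι hι).isOpen
    (W''.comap ι hι).isOpen h1 inf_le_right hK2
    (le_inf inf_le_left (inf_le_right.trans (h2.trans h1)))
    (fun x hx hx' => ⟨hx.1, hi x hx.1 hx'⟩) (by
      intro x hx
      obtain ⟨a, ha, b, hb, hab⟩ := hm (ι x) hx
      refine ⟨x * b⁻¹, ?_, b, ⟨hb, hmem hx ha hab⟩, by simp⟩
      change ι (x * b⁻¹) ∈ W'.toSubgroup
      rwa [map_mul, hab, map_inv, mul_inv_cancel_right]) z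
  have e4 := CohomologyFunctor.Iw.prPush_eq MH
    (MH.iwPull Γ hM hK (W''.comap ι hι).isOpen z) (U := W''.comap ι hι) inf_le_right h2
  exact e1.symm.trans (Eq.trans (by rw [e3, e4]) e2)

end Cohomology

/-! ### The norm relation for the classes `ξ_{G, r}` -/

section Construction

variable {p : ℕ} [Fact p.Prime] {OG OH : Type} [CommRing OG] [HopfAlgebra ℤ_[p] OG]
  [CommRing OH] [HopfAlgebra ℤ_[p] OH] [Algebra.FiniteType ℤ_[p] OG]
  {S : Submonoid (Points ℤ_[p] OG ℚ_[p])} (hS : ∀ g ∈ intPts p OG, g ∈ S)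

/-- `G(ℤ_p)` as an open compact subgroup of `G(ℚ_p)`. -/
noncomputable def levelInt : Level S where
  toSubgroup := intPts p OG
  isOpen := isOpen_intPts
  isCompact := isCompact_intPts
  le := hS

theorem mirabolicPts_le {ι : OG →ₐc[ℤ_[p]] OH} (hι : Function.Surjective ι)
    (QH0 : ClosedSubgroup ℤ_[p] OH) : mirabolicPts QH0 ≤
      ((levelInt hS).comap (precomp ℚ_[p] ι) (isClosedEmbedding_precomp ι hι)).toSubgroup := by
  rintro _ ⟨h, -, rfl⟩
  exact ⟨precomp ℤ_[p] ι h, rfl⟩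

variable {ι : OG →ₐc[ℤ_[p]] OH} {QH0 : ClosedSubgroup ℤ_[p] OH}
  {η : OG →ₐc[ℤ_[p]] ℤ_[p][T;T⁻¹]} {LG0 : ClosedSubgroup ℤ_[p] OG} {u : Points ℤ_[p] OG ℤ_[p]}
  {A : Type*} [CommRing A] {MG : CohomologyFunctor S A}
  {MH : CohomologyFunctor (S.comap (precomp ℚ_[p] ι)) A}

theorem mem_levelConjU {r : ℕ} {x : Points ℤ_[p] OG ℚ_[p]} :
    x ∈ (levelConjU hS η LG0 u r).toSubgroup ↔
      (toRat p OG u)⁻¹ * x * toRat p OG u ∈ groupU η LG0 r := mem_map_conj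

/-- The level `u (U_r ∩ τ U_r τ⁻¹) u⁻¹`. -/
noncomputable def levelConjUInter (hS : ∀ g ∈ intPts p OG, g ∈ S) (η : OG →ₐc[ℤ_[p]] ℤ_[p][T;T⁻¹])
    (LG0 : ClosedSubgroup ℤ_[p] OG) (u : Points ℤ_[p] OG ℤ_[p]) (r : ℕ) : Level S :=
  ((levelU hS η LG0 r).interConj (levelU hS η LG0 r) (tau η)).conj (toRat p OG u)
    fun x hx => conj_intPt_mem hS η LG0 r u x hx.1

theorem mem_levelConjUInter {r : ℕ} {x : Points ℤ_[p] OG ℚ_[p]} :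
    x ∈ (levelConjUInter hS η LG0 u r).toSubgroup ↔
      (toRat p OG u)⁻¹ * x * toRat p OG u ∈ groupU η LG0 r ∧
      (tau η)⁻¹ * ((toRat p OG u)⁻¹ * x * toRat p OG u) * tau η ∈ groupU η LG0 r :=
  mem_map_conj.trans (and_congr_right fun _ => mem_map_conj)

theorem levelConjUInter_le (r : ℕ) :
    (levelConjUInter hS η LG0 u r).toSubgroup ≤ (levelConjU hS η LG0 u r).toSubgroup :=
  fun _ hx => (mem_levelConjU hS).2 ((mem_levelConjUInter hS).1 hx).1

theorem levelConjU_succ_le (hL : IsNormalInLevi η LG0) (r : ℕ) :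
    (levelConjU hS η LG0 u (r + 1)).toSubgroup ≤ (levelConjUInter hS η LG0 u r).toSubgroup :=
  fun x hx => by
    have hx' := (mem_levelConjU hS).1 hx
    exact (mem_levelConjUInter hS).2
      ⟨groupU_succ_le η LG0 r hx', conj_tau_mem_groupU_of_succ hL hx'⟩

/-- `exists_mul_of_mem_groupU`, conjugated by u and applied to the inverse so that the factor from
Q_H⁰ stands on the right. -/
theorem exists_mul_of_mem_levelConjU (hL : IsNormalInLevi η LG0)
    (hA : HasOpenOrbit ι QH0 η u) {r : ℕ} (hr : 1 ≤ r) {w : Points ℤ_[p] OG ℚ_[p]}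
    (hw : w ∈ (levelConjU hS η LG0 u r).toSubgroup) :
    ∃ a ∈ (levelConjUInter hS η LG0 u r).toSubgroup, ∃ b ∈ mirabolicPts QH0,
      w = a * precomp ℚ_[p] ι b := by
  obtain ⟨h, hh, q, hq, hq', he⟩ := exists_mul_of_mem_groupU hL hA hr
    (inv_mem ((mem_levelConjU hS).1 hw))
  refine ⟨toRat p OG u * q⁻¹ * (toRat p OG u)⁻¹, (mem_levelConjUInter hS).2 ?_,
    h⁻¹, inv_mem hh, ?_⟩
  · have e1 : (toRat p OG u)⁻¹ * (toRat p OG u * q⁻¹ * (toRat p OG u)⁻¹) * toRat p OG u = q⁻¹ := by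
      group
    rw [e1]
    refine ⟨inv_mem hq, ?_⟩
    have e2 : (tau η)⁻¹ * q⁻¹ * tau η = ((tau η)⁻¹ * q * tau η)⁻¹ := by group
    rw [e2]
    exact inv_mem hq'
  · have e1 : (toRat p OG u)⁻¹ * w * toRat p OG u = q⁻¹ * ((toRat p OG u)⁻¹ *
        precomp ℚ_[p] ι h * toRat p OG u)⁻¹ := by
      rw [← mul_inv_rev, ← he, inv_inv]
    have e2 : w = toRat p OG u * ((toRat p OG u)⁻¹ * w * toRat p OG u) * (toRat p OG u)⁻¹ := by
      group
    rw [e2, e1, map_inv]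
    group

/-- The place where the geometry enters the cohomology: (A) supplies the factorisation W = W' K, and
(B) shows that elements of K in W' already lie in W''. -/
theorem prPull_toLevel_levelConjU (hι : Function.Surjective ι) (hL : IsNormalInLevi η LG0)
    (hA : HasOpenOrbit ι QH0 η u) (hB : StabilizerLE ι QH0 η LG0 u)
    (hM : MH.IsCartesian) (f : PushforwardMap (precomp ℚ_[p] ι) MH MG) {r : ℕ} (hr : 1 ≤ r)
    (z : MH.Iw (mirabolicPts QH0)) :
    MG.prPull (levelConjUInter_le hS r) (f.toLevel (isClosedEmbedding_precomp ι hι)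
        (levelConjU hS η LG0 u r) inf_le_right (MH.iwPull _ hM (mirabolicPts_le hS hι QH0)
          ((levelConjU hS η LG0 u r).comap _ (isClosedEmbedding_precomp ι hι)).isOpen z)) =
      MG.prPush (levelConjU_succ_le hS hL r) (f.toLevel (isClosedEmbedding_precomp ι hι)
        (levelConjU hS η LG0 u (r + 1)) inf_le_right (MH.iwPull _ hM (mirabolicPts_le hS hι QH0)
          ((levelConjU hS η LG0 u (r + 1)).comap _ (isClosedEmbedding_precomp ι hι)).isOpen z)) :=
  f.prPull_toLevel (isClosedEmbedding_precomp ι hι) hM _ (mirabolicPts_le hS hι QH0)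
    (levelConjUInter_le hS r) (levelConjU_succ_le hS hL r)
    (fun _ hx hx' => (mem_levelConjU hS).2 (conj_mem_groupU hB hx
      (conj_pow_succ_mem_intPts ((mem_levelConjUInter hS).1 hx').2)))
    (fun _ hw => exists_mul_of_mem_levelConjU hS hL hA hr hw) z

theorem carries_levelConjU_levelV (r : ℕ) : Carries (toRat p OG u * tau η ^ r)
    (levelConjU hS η LG0 u r).toSubgroup (levelV hS η LG0 r).toSubgroup := by
  intro x hx
  refine (mem_levelV hS).2 ?_
  have e : tau η ^ r * ((toRat p OG u * tau η ^ r)⁻¹ * x * (toRat p OG u * tau η ^ r)) *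
      (tau η ^ r)⁻¹ = (toRat p OG u)⁻¹ * x * toRat p OG u := by group
  rw [e]
  exact (mem_levelConjU hS).1 hx

theorem carries_levelV_levelConjU (r : ℕ) : Carries (toRat p OG u * tau η ^ r)⁻¹
    (levelV hS η LG0 r).toSubgroup (levelConjU hS η LG0 u r).toSubgroup := by
  intro x hx
  refine (mem_levelConjU hS).2 ?_
  have e : (toRat p OG u)⁻¹ * ((toRat p OG u * tau η ^ r)⁻¹⁻¹ * x *
      (toRat p OG u * tau η ^ r)⁻¹) * toRat p OG u = tau η ^ r * x * (tau η ^ r)⁻¹ := by group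
  rw [e]
  exact (mem_levelV hS).1 hx

theorem mem_levelV_interConj_iff {r : ℕ} {x : Points ℤ_[p] OG ℚ_[p]} :
    x ∈ ((levelV hS η LG0 r).interConj (levelV hS η LG0 r) (tau η)).toSubgroup ↔
      tau η ^ r * x * (tau η ^ r)⁻¹ ∈ groupU η LG0 r ∧
      (tau η)⁻¹ * (tau η ^ r * x * (tau η ^ r)⁻¹) * tau η ∈ groupU η LG0 r := by
  have e : (tau η)⁻¹ * (tau η ^ r * x * (tau η ^ r)⁻¹) * tau η =
      tau η ^ r * ((tau η)⁻¹ * x * tau η) * (tau η ^ r)⁻¹ := by group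
  rw [e]
  exact (mem_levelV_interConj hS).trans (and_congr (mem_levelV hS) (mem_levelV hS))

theorem carries_levelConjUInter (r : ℕ) : Carries (toRat p OG u * tau η ^ r)
    (levelConjUInter hS η LG0 u r).toSubgroup
    ((levelV hS η LG0 r).interConj (levelV hS η LG0 r) (tau η)).toSubgroup := by
  intro x hx
  refine (mem_levelV_interConj_iff hS).2 ?_
  have e : tau η ^ r * ((toRat p OG u * tau η ^ r)⁻¹ * x * (toRat p OG u * tau η ^ r)) *
      (tau η ^ r)⁻¹ = (toRat p OG u)⁻¹ * x * toRat p OG u := by group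
  rw [e]
  exact (mem_levelConjUInter hS).1 hx

theorem carries_levelV_interConj (r : ℕ) : Carries (toRat p OG u * tau η ^ r)⁻¹
    ((levelV hS η LG0 r).interConj (levelV hS η LG0 r) (tau η)).toSubgroup
    (levelConjUInter hS η LG0 u r).toSubgroup := by
  intro x hx
  refine (mem_levelConjUInter hS).2 ?_
  have e : (toRat p OG u)⁻¹ * ((toRat p OG u * tau η ^ r)⁻¹⁻¹ * x *
      (toRat p OG u * tau η ^ r)⁻¹) * toRat p OG u = tau η ^ r * x * (tau η ^ r)⁻¹ := by group
  rw [e]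
  exact (mem_levelV_interConj_iff hS).1 hx

omit [Algebra.FiniteType ℤ_[p] OG] in
theorem mul_tau_pow_inv_mem (hS : ∀ g ∈ intPts p OG, g ∈ S) (hτ : (tau η)⁻¹ ∈ S) (r : ℕ) :
    (toRat p OG u * tau η ^ r)⁻¹ ∈ S := by
  rw [mul_inv_rev, ← inv_pow]
  exact mul_mem (pow_mem hτ r) (hS _ (inv_mem ⟨u, rfl⟩))

theorem classXi_apply (hι : Function.Surjective ι) (hτ : (tau η)⁻¹ ∈ S)
    (f : PushforwardMap (precomp ℚ_[p] ι) MH MG) (r : ℕ)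
    (z : MH.Iw (mirabolicPtsLevel ι QH0 hS η LG0 u r)) :
    classXi hι QH0 hS η hτ LG0 u f r z = MG.push (toRat p OG u * tau η ^ r)
      (mul_tau_pow_inv_mem hS hτ r) (carries_levelConjU_levelV hS r)
      (f.toLevel (isClosedEmbedding_precomp ι hι) (levelConjU hS η LG0 u r) inf_le_right z) :=
  MG.push_push rfl _ _ _ _ _ _ _

/-- The class ξ_r is the pushforward by u τ^r of the class at u U_r u⁻¹, and u τ^{r+1} = (u τ^r) τ.
So the extra τ is the one in the Hecke operator, and the preceding identity of classes transports to
the tower V_r. -/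
theorem prPush_classXi (hι : Function.Surjective ι) (hL : IsNormalInLevi η LG0)
    (hA : HasOpenOrbit ι QH0 η u) (hB : StabilizerLE ι QH0 η LG0 u) (hτ : (tau η)⁻¹ ∈ S)
    (hM : MH.IsCartesian) (f : PushforwardMap (precomp ℚ_[p] ι) MH MG) {r : ℕ} (hr : 1 ≤ r)
    (hV : (levelV hS η LG0 (r + 1)).toSubgroup ≤ (levelV hS η LG0 r).toSubgroup)
    (z : MH.Iw (mirabolicPts QH0)) :
    MG.prPush hV (classXi hι QH0 hS η hτ LG0 u f (r + 1) (MH.iwPull _ hM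
        (mirabolicPts_le hS hι QH0)
        ((levelConjU hS η LG0 u (r + 1)).comap _ (isClosedEmbedding_precomp ι hι)).isOpen z)) =
      MG.hecke (tau η) hτ (levelV hS η LG0 r) (classXi hι QH0 hS η hτ LG0 u f r (MH.iwPull _ hM
        (mirabolicPts_le hS hι QH0)
        ((levelConjU hS η LG0 u r).comap _ (isClosedEmbedding_precomp ι hι)).isOpen z)) := by
  have h1 := classXi_apply hS hι hτ f r (MH.iwPull _ hM (mirabolicPts_le hS hι QH0)
    ((levelConjU hS η LG0 u r).comap _ (isClosedEmbedding_precomp ι hι)).isOpen z)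
  have h2 := classXi_apply hS hι hτ f (r + 1) (MH.iwPull _ hM (mirabolicPts_le hS hι QH0)
    ((levelConjU hS η LG0 u (r + 1)).comap _ (isClosedEmbedding_precomp ι hι)).isOpen z)
  refine (congrArg (MG.prPush hV) h2).trans (Eq.trans ?_
    (congrArg (MG.hecke (tau η) hτ (levelV hS η LG0 r)) h1.symm))
  exact MG.prPush_push_eq_hecke_push _ hτ _ (by rw [pow_succ, mul_assoc]) hV _
    (carries_levelV_levelConjU hS r) (carries_levelConjUInter hS r)
    (carries_levelV_interConj hS r) _ _ _ (prPull_toLevel_levelConjU hS hι hL hA hB hM f hr z)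

end Construction

end NormRel

/-! ### Assembly of the theorem -/

open NormRel in
theorem theorem4 (p : ℕ) [Fact p.Prime]
    (OG OH : Type) [CommRing OG] [HopfAlgebra ℤ_[p] OG] [CommRing OH] [HopfAlgebra ℤ_[p] OH]
    [IsReductiveGroupScheme p OG] [IsReductiveGroupScheme p OH]
    -- the closed immersion `ι : H ↪ G`
    (ι : OG →ₐc[ℤ_[p]] OH) (hι : Function.Surjective ι)
    -- the mirabolic subgroup of `H`
    (QH0 : ClosedSubgroup ℤ_[p] OH) (hQH0 : IsMirabolic QH0)
    -- the cocharacter `η` with `Q_G = P_G(η)`, and the normal subgroup of the Levi subgroup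
    (η : OG →ₐc[ℤ_[p]] ℤ_[p][T;T⁻¹])
    (LG0 : ClosedSubgroup ℤ_[p] OG) (hLG0 : IsNormalInLevi η LG0)
    -- the point `u` with the conditions (A) and (B)
    (u : Points ℤ_[p] OG ℤ_[p])
    (hA : HasOpenOrbit ι QH0 η u) (hB : StabilizerLE ι QH0 η LG0 u)
    -- the monoid, and the cohomology functors
    (S : Submonoid (Points ℤ_[p] OG ℚ_[p])) (hSopen : IsOpen (S : Set (Points ℤ_[p] OG ℚ_[p])))
    (hS : ∀ g ∈ intPts p OG, g ∈ S) (hτ : (tau η)⁻¹ ∈ S)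
    (A : Type*) [CommRing A]
    (MG : CohomologyFunctor S A) (hMG : MG.IsCartesian)
    (MH : CohomologyFunctor (S.comap (precomp ℚ_[p] ι)) A) (hMH : MH.IsCartesian)
    (f : PushforwardMap (precomp ℚ_[p] ι) MH MG) :
    -- the restriction of `z` to `Q_H⁰(ℤ_p) ∩ u U_r u⁻¹` is well-defined
    (∀ (r : ℕ+) (z : MH.Iw (mirabolicPts QH0)),
      ∃! z' : MH.Iw (mirabolicPtsLevel ι QH0 hS η LG0 u r),
        MH.IsIwPull 1 (one_mem _) z z') ∧
    -- the groups `V_r` are decreasing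
    ∃ (hV : ∀ r : ℕ+, (levelV hS η LG0 (r + 1 : ℕ+)).toSubgroup ≤
        (levelV hS η LG0 r).toSubgroup)
      -- the Hecke operators on the `M_G(V_r)` are compatible
      (hT : ∀ (r : ℕ+) (m : MG.obj (levelV hS η LG0 (r + 1 : ℕ+))),
        MG.prPush (hV r) (MG.hecke (tau η) hτ (levelV hS η LG0 (r + 1 : ℕ+)) m) =
          MG.hecke (tau η) hτ (levelV hS η LG0 r) (MG.prPush (hV r) m))
      -- the map to the inverse limit of the finite-slope parts
      (Φ : MH.Iw (mirabolicPts QH0) →ₗ[A]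
        fsLimit (fun r : ℕ+ => MG.hecke (tau η) hτ (levelV hS η LG0 r))
          (fun r => MG.prPush (hV r)) hT),
      ∀ (z : MH.Iw (mirabolicPts QH0)) (r : ℕ+)
        (z' : MH.Iw (mirabolicPtsLevel ι QH0 hS η LG0 u r)),
        MH.IsIwPull 1 (one_mem _) z z' →
        (Φ z).1 r = FiniteSlope.tmul (MG.hecke (tau η) hτ (levelV hS η LG0 r)) (-(r : ℤ))
          (classXi hι QH0 hS η hτ LG0 u f r z') := by
  have hK := mirabolicPts_le hS hι QH0
  have hc := isClosedEmbedding_precomp (R := ℚ_[p]) ι hι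
  -- The restriction is characterised by `IsIwPull`. Identifying it with the explicit `iwPull`
  -- yields existence and uniqueness at once, and A-linearity of the final map.
  have huniq : ∀ (r : ℕ+) (z : MH.Iw (mirabolicPts QH0))
      (z' : MH.Iw (mirabolicPtsLevel ι QH0 hS η LG0 u r)),
      MH.IsIwPull 1 (one_mem _) z z' ↔
        z' = MH.iwPull _ hMH hK ((levelConjU hS η LG0 u r).comap _ hc).isOpen z :=
    fun r z z' => CohomologyFunctor.isIwPull_one_iff MH _ hMH hK _
      (relIndex_ne_zero_of_isOpen _ hK ((levelConjU hS η LG0 u r).comap _ hc).isOpen) z z'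
  have hV : ∀ r : ℕ+, (levelV hS η LG0 (r + 1 : ℕ+)).toSubgroup ≤
      (levelV hS η LG0 r).toSubgroup := fun r => levelV_succ_le hS hLG0 r
  have hT : ∀ (r : ℕ+) (m : MG.obj (levelV hS η LG0 (r + 1 : ℕ+))),
      MG.prPush (hV r) (MG.hecke (tau η) hτ (levelV hS η LG0 (r + 1 : ℕ+)) m) =
        MG.hecke (tau η) hτ (levelV hS η LG0 r) (MG.prPush (hV r) m) := fun r m =>
    hMG.prPush_hecke hτ (hV r) (fun _ hv hv' => mem_levelV_interConj_succ hS hLG0 hv hv')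
      (fun _ hv => exists_mul_of_mem_levelV hS hLG0 r.pos hv) m
  refine ⟨fun r z => ⟨_, (huniq r z _).2 rfl, fun z' hz' => (huniq r z z').1 hz'⟩, hV, hT,
    fsLimitLift _ _ hT
      (fun r => classXi hι QH0 hS η hτ LG0 u f r ∘ₗ
        MH.iwPull _ hMH hK ((levelConjU hS η LG0 u r).comap _ hc).isOpen)
      (fun r z => prPush_classXi hS hι hLG0 hA hB hτ hMH f r.pos (hV r) z), ?_⟩
  intro z r z' hz'
  rw [(huniq r z z').1 hz']
  rfl
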